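/- Let $n\ge 2$, $M=(0,\infty)_x\times\mathbb R^{n-1}_y$, and let $(x,y,\xi,\eta)$ be the coordinates on ${}^{sc}T^*M$ for which this point stands for $\xi\frac{dx}{x^2}+\eta\cdot\frac{dy}{x}$. Put $\rho=\langle(\xi,\eta)\rangle^{-1}$, $\tau=\rho\,(\xi,\eta_2,\dots,\eta_{n-1})$, $d_\Sigma=(|\tau|^2+\rho)^{1/2}$, $\tilde\tau=\tau/d_\Sigma$, $d_\Gamma=(x+d_\Sigma^2+|\tilde\tau|^2)^{1/2}$. Let $\mathscr X$ be the fibrewise radial compactification of ${}^{sc}T^*M$ with the boundary $x=0$ added. Let $\mathscr X_2$ be the manifold with corners obtained from $\mathscr X$ by blowing up first $\{\rho=0,\tau=0\}$ (with $\rho^{1/2}$ and $\tau$ of the same homogeneity) and then $\{x=0,d_\Sigma=0,\tilde\tau=0\}$ (with $x^{1/2}$, $d_\Sigma$ and $\tilde\tau$ of the same homogeneity), so that its boundary hypersurfaces are defined by $\rho/d_\Sigma^2$, $x/d_\Gamma^2$, $d_\Sigma/d_\Gamma$ and $d_\Gamma$. Let $\mathcal V_2$ be the smooth vector fields on $\mathscr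 X_2$ tangent to $\partial\mathscr X_2$. Let $S^{0,0,0,0}$ be the set of smooth $a:{}^{sc}T^*M\to\mathbb C$ such that, for every finite product $V^\alpha$ of elements of $\mathcal V_2$, $V^\alpha a$ is bounded over every subset of the base that is pre-compact in $[0,\infty)\times\mathbb R^{n-1}$, uniformly in the fibre. Let $S^{0,0,0,0}_{full}$ be the set of smooth $\tilde a(x,y,X,Y,\xi,\eta)$ on ${}^{sc}T^*M\times\mathbb R^n_{X,Y}$ such that the same holds, uniformly also in $(X,Y)\in\mathbb R^n$, for every finite product of elements of $\mathcal V_2$ (acting with no $(X,Y)$-component) and of the vector fields $\frac1x\partial_X$, $\frac1x\partial_{Y_i}$. For $m,l,k,j\in\mathbb R$ put $S^{m,l,k,j}=\rho^{-m}x^{-l}d_\Sigma^{-k}d_\Gamma^{-j}S^{0,0,0,0}$ and $S^{m,l,k,j}_{full}=\rho^{-m}x^{-l}d_\Sigma^{-k}d_\Gamma^{-j}S^{0,0,0,0}_{full}$. The principal symbol $\sigma(a)$ of $a\in S^{m,l,k,j}$ is its class modulo $S^{m-1,l-1,k+1,j+1}$. For $\tilde a\in S^{m,l,k,j}_{full}$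 and $(x,y)\in M$ let $K_{\tilde a}(x,y,\cdot)$ be the distribution on $\mathbb R^n_{X,Y}$ $$K_{\tilde a}(x,y,X,Y)=(2\pi)^{-n}\int_{\mathbb R^n}e^{i(\xi X+\eta\cdot Y)}\,\tilde a(x,y,X,Y,\xi,\eta)\,d\xi\,d\eta,$$ an oscillatory integral: it is paired with a Schwartz function by integrating first in $(X,Y)$ and then in $(\xi,\eta)$. An $a\in S^{m,l,k,j}$ is regarded here as a full symbol that does not depend on $(X,Y)$. **Proposition.** Let $\tilde a\in S^{m,l,k,j}_{full}$. Then there is $a\in S^{m,l,k,j}$ such that, for every $(x,y)\in M$, the integrals that define $K_a(x,y,\cdot)$ and $K_{\tilde a}(x,y,\cdot)$ on Schwartz functions converge absolutely (as iterated integrals) and $K_a(x,y,\cdot)=K_{\tilde a}(x,y,\cdot)$. Moreover $$a-\sum_{|\alpha|<N}\frac{i^{|\alpha|}}{\alpha!}\,\partial^\alpha_{(\xi,\eta)}\partial^\alpha_{(X,Y)}\tilde a\Big|_{(X,Y)=(0,0)}\in S^{m-N,\,l-N,\,k+N,\,j+N}\qquad\text{for every } N\in\mathbb N_0.$$ In particular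 $\tilde a|_{(X,Y)=(0,0)}\in S^{m,l,k,j}$ and $\sigma(a)=\sigma\big(\tilde a|_{(X,Y)=(0,0)}\big)$. -/

import Mathlib

open scoped ContDiff SchwartzMap

noncomputable section

namespace BBCalculus

/-! ### Coordinates

The dimension is `n = d + 2`.  A base point of `M = (0,∞) × ℝ^(n-1)` is `p : Coord d`, with
`p 0 = x` and `p i = y_i` for `i ≥ 1`.  A fibre coordinate is `ζ : Coord d`, with `ζ 0 = ξ` and
`ζ i = η_i` for `i ≥ 1`; the pair `(p, ζ)` is the scattering covector `ξ dx/x² + η · dy/x`.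
Likewise `Z : Coord d` stands for `(X, Y)`. -/

/-- `ℝ^n`, with `n = d + 2`. -/
abbrev Coord (d : ℕ) : Type := Fin (d + 2) → ℝ

/-- Pairs `(p, ζ)` of base and fibre coordinates. -/
abbrev Phase (d : ℕ) : Type := Coord d × Coord d

/-- Triples `((p, ζ), Z)`. -/
abbrev FullPhase (d : ℕ) : Type := Phase d × Coord d

/-- The scattering cotangent bundle of `M`, i.e. the region `x > 0`. It is the interior of the
compactification `𝒳` and of its blow-ups. -/
def scT (d : ℕ) : Set (Phase d) := {q | 0 < q.1 0}

/-- The product of the scattering cotangent bundle with `ℝ^n_{X,Y}`. -/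
def scTFull (d : ℕ) : Set (FullPhase d) := {w | w.1 ∈ scT d}

variable {d : ℕ}

/-! ### Boundary defining functions -/

/-- `x`. -/
def xb (q : Phase d) : ℝ := q.1 0

/-- `ρ = ⟨(ξ, η)⟩⁻¹`. -/
def rho (q : Phase d) : ℝ := (Real.sqrt (1 + ∑ i, q.2 i ^ 2))⁻¹

/-- `τ = ρ (ξ, η_2, …, η_{n-1})`: all the fibre coordinates except `η_1`. -/
def tau (q : Phase d) (i : Fin (d + 1)) : ℝ := rho q * q.2 ((1 : Fin (d + 2)).succAbove i)

/-- `d_Σ = (|τ|² + ρ)^{1/2}`. -/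
def dSigma (q : Phase d) : ℝ := Real.sqrt (∑ i, tau q i ^ 2 + rho q)

/-- `τ̃ = τ / d_Σ`. -/
def tauT (q : Phase d) (i : Fin (d + 1)) : ℝ := tau q i / dSigma q

/-- `d_Γ = (x + d_Σ² + |τ̃|²)^{1/2}`. -/
def dGamma (q : Phase d) : ℝ := Real.sqrt (xb q + dSigma q ^ 2 + ∑ i, tauT q i ^ 2)

/-! ### The twice blown-up space `𝒳₂`

`𝒳` is the radial fibre compactification of the bundle, with the boundary `x = 0` added: it is
embedded by `(x, y)` and by the half sphere coordinates `(ρ, ρζ)`. Blowing up `Σ = {ρ = 0, τ = 0}`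
parabolically adds the smooth functions `d_Σ`, `ρ/d_Σ²`, `τ̃ = τ/d_Σ`; blowing up
`Γ = {x = 0, d_Σ = 0, τ̃ = 0}` (with `x^{1/2}`, `d_Σ`, `τ̃` of the same homogeneity) adds
`d_Γ`, `x/d_Γ²`, `d_Σ/d_Γ`, `τ̃/d_Γ`. Together these functions embed `𝒳₂` as a closed submanifold
with corners of a Euclidean space, the closure of the image of the interior. -/

/-- The Euclidean space in which `𝒳₂` is embedded. -/
abbrev Ambient (d : ℕ) : Type :=
  (Coord d × ℝ × Coord d) × (ℝ × ℝ × (Fin (d + 1) → ℝ)) × (ℝ × ℝ × ℝ × (Fin (d + 1) → ℝ))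

/-- The embedding of `𝒳₂`, on its interior. -/
def embX2 (q : Phase d) : Ambient d :=
  ((q.1, rho q, fun i => rho q * q.2 i),
   (dSigma q, rho q / dSigma q ^ 2, tauT q),
   (dGamma q, xb q / dGamma q ^ 2, dSigma q / dGamma q, fun i => tauT q i / dGamma q))

/-- `f ∈ C^∞(𝒳₂)`: on the interior, `f` is the pull-back of a smooth function on the Euclidean
space in which `𝒳₂` is embedded. -/
def SmoothX2 (f : Phase d → ℝ) : Prop :=
  ∃ F : Ambient d → ℝ, ContDiff ℝ ∞ F ∧ ∀ q ∈ scT d, f q = F (embX2 q)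

/-- The action of a vector field `V` on a function `f`. -/
def act {W F : Type*} [NormedAddCommGroup W] [NormedSpace ℝ W] [NormedAddCommGroup F]
    [NormedSpace ℝ F] (V : W → W) (f : W → F) : W → F :=
  fun w => fderiv ℝ f w (V w)

/-- `V b` vanishes where `b` does: it is a `C^∞(𝒳₂)` multiple of `b`. -/
def TangentTo (b : Phase d → ℝ) (V : Phase d → Phase d) : Prop :=
  ∃ g : Phase d → ℝ, SmoothX2 g ∧ ∀ q ∈ scT d, act V b q = g q * b q

/-- `𝒱₂`: the vector fields on the interior which extend to smooth vector fields on `𝒳₂` and are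
tangent to its boundary. The four boundary hypersurfaces of `𝒳₂` are fibre infinity, base infinity
and the two front faces, with the respective defining functions `ρ/d_Σ²`, `x/d_Γ²`, `d_Σ/d_Γ`
and `d_Γ`. -/
def V2 (d : ℕ) : Set (Phase d → Phase d) :=
  {V | (∀ f : Phase d → ℝ, SmoothX2 f → SmoothX2 (act V f)) ∧
    TangentTo (fun q => rho q / dSigma q ^ 2) V ∧
    TangentTo (fun q => xb q / dGamma q ^ 2) V ∧
    TangentTo (fun q => dSigma q / dGamma q) V ∧
    TangentTo dGamma V}

/-! ### Symbol classes -/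

/-- `ρ^{-m} x^{-l} d_Σ^{-k} d_Γ^{-j}`. -/
def weight (m l k j : ℝ) (q : Phase d) : ℝ :=
  rho q ^ (-m) * xb q ^ (-l) * dSigma q ^ (-k) * dGamma q ^ (-j)

/-- `S^{0,0,0,0}`: smooth on the interior, with every product of vector fields in `𝒱₂` applied to
`a` bounded over every subset of the base that is pre-compact in `[0,∞) × ℝ^(n-1)`, uniformly in
the whole fibre. -/
def SymbolZero (d : ℕ) : Set (Phase d → ℂ) :=
  {a | ContDiffOn ℝ ∞ a (scT d) ∧
    ∀ Vs : List (Phase d → Phase d), (∀ V ∈ Vs, V ∈ V2 d) →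
      ∀ B : Set (Coord d), IsCompact B →
        ∃ C : ℝ, ∀ q ∈ scT d, q.1 ∈ B → ‖Vs.foldr act a q‖ ≤ C}

/-- `S^{m,l,k,j} = ρ^{-m} x^{-l} d_Σ^{-k} d_Γ^{-j} S^{0,0,0,0}`. -/
def Symbol (d : ℕ) (m l k j : ℝ) : Set (Phase d → ℂ) :=
  {a | ∃ b ∈ SymbolZero d, ∀ q ∈ scT d, a q = (weight m l k j q : ℂ) * b q}

/-- The test vector fields for full symbols: those of `𝒱₂`, with no `(X,Y)` component, and the
vector fields `x⁻¹ ∂_X`, `x⁻¹ ∂_{Y_j}`. -/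
def VFull (d : ℕ) : Set (FullPhase d → FullPhase d) :=
  {V | (∃ V' ∈ V2 d, V = fun w => (V' w.1, 0)) ∨
    ∃ i : Fin (d + 2), V = fun w => (0, Pi.single i (xb w.1)⁻¹)}

/-- `S^{0,0,0,0}_full`; the estimates are uniform in `(X,Y)` and in `(ξ,η)`. -/
def FullSymbolZero (d : ℕ) : Set (FullPhase d → ℂ) :=
  {a | ContDiffOn ℝ ∞ a (scTFull d) ∧
    ∀ Vs : List (FullPhase d → FullPhase d), (∀ V ∈ Vs, V ∈ VFull d) →
      ∀ B : Set (Coord d), IsCompact B →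
        ∃ C : ℝ, ∀ w ∈ scTFull d, w.1.1 ∈ B → ‖Vs.foldr act a w‖ ≤ C}

/-- `S^{m,l,k,j}_full = ρ^{-m} x^{-l} d_Σ^{-k} d_Γ^{-j} S^{0,0,0,0}_full`. -/
def FullSymbol (d : ℕ) (m l k j : ℝ) : Set (FullPhase d → ℂ) :=
  {a | ∃ b ∈ FullSymbolZero d, ∀ w ∈ scTFull d, a w = (weight m l k j w.1 : ℂ) * b w}

/-- The principal symbol of `a ∈ S^{m,l,k,j}`: its class modulo `S^{m-1,l-1,k+1,j+1}`. -/
def principalSymbol (m l k j : ℝ) (a : Phase d → ℂ) : Set (Phase d → ℂ) :=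
  {b | b ∈ Symbol d m l k j ∧ b - a ∈ Symbol d (m - 1) (l - 1) (k + 1) (j + 1)}

/-! ### Oscillatory integrals -/

/-- `e^{i(ξX + η·Y)} b(x,y,X,Y,ξ,η) φ(X,Y)`. -/
def oscIntegrand (b : FullPhase d → ℂ) (p : Coord d) (φ : 𝓢(Coord d, ℂ)) (ζ Z : Coord d) : ℂ :=
  Complex.exp (Complex.I * ((∑ i, ζ i * Z i : ℝ) : ℂ)) * b ((p, ζ), Z) * φ Z

/-- The pairing of the distribution
`K_b(x,y,·) = (2π)^{-n} ∫ e^{i(ξX + η·Y)} b(x,y,X,Y,ξ,η) dξ dη` on `ℝ^n_{X,Y}` with the test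
function `φ`: the oscillatory integral, integrated first in `(X,Y)` and then in `(ξ,η)`. -/
def oscKernel (b : FullPhase d → ℂ) (p : Coord d) (φ : 𝓢(Coord d, ℂ)) : ℂ :=
  (((2 * Real.pi) ^ (d + 2))⁻¹ : ℝ) * ∫ ζ : Coord d, ∫ Z : Coord d, oscIntegrand b p φ ζ Z

/-- Both integrals in the pairing converge absolutely. -/
def OscConverges (b : FullPhase d → ℂ) (p : Coord d) (φ : 𝓢(Coord d, ℂ)) : Prop :=
  (∀ ζ : Coord d, MeasureTheory.Integrable (oscIntegrand b p φ ζ)) ∧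
    MeasureTheory.Integrable (fun ζ : Coord d => ∫ Z : Coord d, oscIntegrand b p φ ζ Z)

/-- A symbol in `(x,y,ξ,η)`, regarded as a function that does not depend on `(X,Y)`. -/
def constInZ (a : Phase d → ℂ) : FullPhase d → ℂ := fun w => a w.1

/-! ### The asymptotic expansion -/

/-- `∂_{(X,Y)}^α`. -/
def partialZ (α : Fin (d + 2) → ℕ) (b : FullPhase d → ℂ) : FullPhase d → ℂ :=
  (List.finRange (d + 2)).foldr
    (fun i g => (act (fun _ => ((0, 0), Pi.single i 1)))^[α i] g) b

/-- `∂_{(ξ,η)}^α`. -/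
def partialZeta (α : Fin (d + 2) → ℕ) (b : FullPhase d → ℂ) : FullPhase d → ℂ :=
  (List.finRange (d + 2)).foldr
    (fun i g => (act (fun _ => ((0, Pi.single i 1), 0)))^[α i] g) b

/-- The restriction to `(X,Y) = (0,0)`. -/
def atZero (b : FullPhase d → ℂ) : Phase d → ℂ := fun q => b (q, 0)

/-- `∑_{|α| < N} (i^{|α|}/α!) ∂_{(ξ,η)}^α ∂_{(X,Y)}^α b |_{(X,Y) = (0,0)}`. -/
def expansion (b : FullPhase d → ℂ) (N : ℕ) : Phase d → ℂ := fun q =>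
  ∑ r ∈ Finset.range N, ∑ α ∈ Finset.piAntidiag (Finset.univ : Finset (Fin (d + 2))) r,
    Complex.I ^ r / ((∏ i, (α i).factorial : ℕ) : ℂ) *
      atZero (partialZeta α (partialZ α b)) q

end BBCalculus

end

open scoped ContDiff SchwartzMap

noncomputable section
namespace BBCalculus
open MeasureTheory Topology Set

variable {d : ℕ}

/-! ### Calculus of the action of vector fields -/

section Act

variable {W F : Type*} [NormedAddCommGroup W] [NormedSpace ℝ W] [NormedAddCommGroup F]
  [NormedSpace ℝ F] {V : W → W} {w : W}

/-! The argument is the classical reduction of an amplitude to a left symbol, carried out with the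
weights of the blown-up space.

Geometry enters only through a frame. The fields x∂_x, ∂_{y_i}, ρ⁻¹∂_{η_1} and ρ⁻¹d_Σd_Γ∂_{ζ_i}, for
the remaining fibre directions, lie in 𝒱₂ (`frame_mem`). Conversely every field in 𝒱₂ has smooth
coefficients in this frame (`exists_base_coeff`, `exists_fib_coeff`). Since weights have smooth
logarithmic derivatives along 𝒱₂ (`tangentTo_wt`), membership in a symbol class becomes a family of
bounds on iterated coordinate derivatives, each derivative shifting the order by a fixed vector
`ord`. This is `IsAmp`; the translations are `isAmp_of_mem_fullSymbol` and `mem_symbol_of_isAmp`.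

The left symbol is, formally, a(p,ζ) = (2π)^{-n} ∫∫ e^{iθ·Z} b(p,ζ+θ,Z) dZ dθ. The amplitude b need
not decay in Z, so it is first replaced by the iterated `gain`, which applies (1-Δ_ζ)(1+|Z|²)⁻¹.
Integration by parts in ζ shows that the oscillatory integral is unchanged (`pair_gain`), and the
amplitude becomes integrable in Z. Its Fourier transform in Z then decays faster than any power of
θ, while the weights grow at most polynomially under fibre translations (`temperate_wt`). Hence the
θ-integral converges and preserves the order (`isAmp_reduced`). Fubini and Fourier inversion
identify the kernels (`pair_reduced`).

For the expansion, Taylor's formula in Z writes b as b|_{Z=0} + ∑ Z_i R_i, and under the oscillatory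
integral Z_i becomes i∂_{ζ_i}. Thus b and b|_{Z=0} + `rem b` have the same kernel
(`pair_eq_atZero_add_rem`). Each application of `rem` gains one x from ∂_Z and at least ρ/(d_Σd_Γ)
from ∂_ζ, which is exactly the order shift claimed. Iterating, and using that a symbol independent
of Z is determined by its kernel (`eqOn_zero_of_pair`), gives an exact formula whose remainder is
the left symbol of `rem^[N] b` (`leftSymbol_expansion`). Finally the r-th iterate of `rem` at Z=0
equals (1/r!)(i∂_ζ·∂_Z)^r b at Z=0 (`atZero_rem_iterate`), and the multinomial theorem turns this
into the sum over multi-indices (`expansion_eq`). -/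

theorem act_congr {U : Set W} (hU : IsOpen U) {f g : W → F} (h : EqOn f g U) (hw : w ∈ U) :
    act V f w = act V g w := by
  have : f =ᶠ[𝓝 w] g := Filter.eventuallyEq_of_mem (hU.mem_nhds hw) h
  simp only [act, this.fderiv_eq]

theorem act_add {f g : W → F} (hf : DifferentiableAt ℝ f w) (hg : DifferentiableAt ℝ g w) :
    act V (fun z => f z + g z) w = act V f w + act V g w := by
  simp only [act, fderiv_fun_add hf hg, add_apply]

theorem act_mul {A : Type*} [NormedCommRing A] [NormedAlgebra ℝ A] {f g : W → A}
    (hf : DifferentiableAt ℝ f w) (hg : DifferentiableAt ℝ g w) :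
    act V (fun z => f z * g z) w = act V f w * g w + f w * act V g w := by
  simp only [act, fderiv_fun_mul hf hg, add_apply, smul_eq_mul,
    smul_apply]
  ring

theorem act_pow {f : W → ℝ} (n : ℕ) (hf : DifferentiableAt ℝ f w) :
    act V (fun z => f z ^ n) w = n * f w ^ (n - 1) * act V f w := by
  have := (hf.hasFDerivAt.pow n).fderiv
  simp only [act, this]
  simp

theorem act_const (c : F) : act V (fun _ => c) w = 0 := by
  simp [act]

theorem act_ofReal {f : W → ℝ} (hf : DifferentiableAt ℝ f w) :
    act V (fun z => (f z : ℂ)) w = ((act V f w : ℝ) : ℂ) := by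
  have h : HasFDerivAt (fun z => (f z : ℂ)) (Complex.ofRealCLM.comp (fderiv ℝ f w)) w :=
    Complex.ofRealCLM.hasFDerivAt.comp w hf.hasFDerivAt
  simp only [act, h.fderiv]
  simp

theorem act_rpow {f : W → ℝ} (s : ℝ) (hf : DifferentiableAt ℝ f w) (h0 : 0 < f w) :
    act V (fun z => f z ^ s) w = s * f w ^ s * (f w)⁻¹ * act V f w := by
  have := (hf.hasFDerivAt.rpow_const (p := s) (Or.inl h0.ne')).fderiv
  simp only [act, this, smul_apply, smul_eq_mul]
  rw [Real.rpow_sub_one h0.ne']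
  ring

theorem contDiffOn_act {U : Set W} (hU : IsOpen U) {f : W → F} (hf : ContDiffOn ℝ ∞ f U)
    (hV : ContDiffOn ℝ ∞ V U) : ContDiffOn ℝ ∞ (act V f) U := by
  have := (contDiffOn_infty_iff_fderiv_of_isOpen hU).1 hf
  exact this.2.clm_apply hV

theorem _root_.ContDiffOn.differentiableAt_of_isOpen {U : Set W} (hU : IsOpen U) {f : W → F}
    (hf : ContDiffOn ℝ ∞ f U) (hw : w ∈ U) : DifferentiableAt ℝ f w :=
  (hf.contDiffAt (hU.mem_nhds hw)).differentiableAt (by simp)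

end Act

/-! ### Directions and weights -/

theorem isOpen_scT : IsOpen (scT d) := by
  have : Continuous fun q : Phase d => q.1 0 := by fun_prop
  exact isOpen_lt continuous_const this

theorem isOpen_scTFull : IsOpen (scTFull d) := isOpen_scT.preimage continuous_fst

theorem rho_pos (q : Phase d) : 0 < rho q := by
  unfold rho
  have : 0 ≤ ∑ i, q.2 i ^ 2 := Finset.sum_nonneg fun i _ => sq_nonneg _
  positivity

theorem dSigma_pos (q : Phase d) : 0 < dSigma q := by
  unfold dSigma
  have : 0 ≤ ∑ i, tau q i ^ 2 := Finset.sum_nonneg fun i _ => sq_nonneg _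
  have := rho_pos q
  positivity

theorem dSigma_sq (q : Phase d) : dSigma q ^ 2 = ∑ i, tau q i ^ 2 + rho q := by
  have : 0 ≤ ∑ i, tau q i ^ 2 := Finset.sum_nonneg fun i _ => sq_nonneg _
  have := rho_pos q
  rw [dSigma, Real.sq_sqrt (by positivity)]

theorem dGamma_arg_pos {q : Phase d} (hq : q ∈ scT d) :
    0 < xb q + dSigma q ^ 2 + ∑ i, tauT q i ^ 2 := by
  have h1 : 0 ≤ ∑ i, tauT q i ^ 2 := Finset.sum_nonneg fun i _ => sq_nonneg _
  have h2 : 0 < xb q := hq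
  positivity

theorem dGamma_pos {q : Phase d} (hq : q ∈ scT d) : 0 < dGamma q :=
  Real.sqrt_pos.2 (dGamma_arg_pos hq)

theorem dGamma_sq {q : Phase d} (hq : q ∈ scT d) :
    dGamma q ^ 2 = xb q + dSigma q ^ 2 + ∑ i, tauT q i ^ 2 :=
  Real.sq_sqrt (dGamma_arg_pos hq).le

theorem contDiff_rho : ContDiff ℝ ∞ (rho : Phase d → ℝ) := by
  have h (q : Phase d) : 0 < 1 + ∑ i, q.2 i ^ 2 := by
    have : 0 ≤ ∑ i, q.2 i ^ 2 := Finset.sum_nonneg fun i _ => sq_nonneg _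
    positivity
  unfold rho
  refine ContDiff.inv (ContDiff.sqrt (by fun_prop) fun q => (h q).ne') fun q => ?_
  exact (Real.sqrt_pos.2 (h q)).ne'

theorem contDiff_tau (i : Fin (d + 1)) : ContDiff ℝ ∞ (fun q : Phase d => tau q i) := by
  unfold tau
  exact contDiff_rho.mul (by fun_prop)

theorem contDiff_dSigma : ContDiff ℝ ∞ (dSigma : Phase d → ℝ) := by
  unfold dSigma
  refine ContDiff.sqrt (ContDiff.add (ContDiff.sum fun i _ => (contDiff_tau i).pow 2)
    contDiff_rho) fun q => ?_
  rw [← dSigma_sq]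
  exact (pow_pos (dSigma_pos q) 2).ne'

theorem contDiff_tauT (i : Fin (d + 1)) : ContDiff ℝ ∞ (fun q : Phase d => tauT q i) := by
  unfold tauT
  exact (contDiff_tau i).div contDiff_dSigma fun q => (dSigma_pos q).ne'

theorem contDiff_xb : ContDiff ℝ ∞ (xb : Phase d → ℝ) := by
  unfold xb; fun_prop

theorem contDiffOn_dGamma : ContDiffOn ℝ ∞ (dGamma : Phase d → ℝ) (scT d) := by
  unfold dGamma
  refine ContDiffOn.sqrt ?_ fun q hq => (dGamma_arg_pos hq).ne'
  exact ((contDiff_xb.add (contDiff_dSigma.pow 2)).add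
    (ContDiff.sum fun i _ => (contDiff_tauT i).pow 2)).contDiffOn

theorem contDiffOn_embX2 : ContDiffOn ℝ ∞ (embX2 : Phase d → Ambient d) (scT d) := by
  have hg : ∀ q ∈ scT d, dGamma q ≠ 0 := fun q hq => (dGamma_pos hq).ne'
  have hs : ∀ q ∈ scT d, dSigma q ^ 2 ≠ 0 := fun q _ => (pow_pos (dSigma_pos q) 2).ne'
  unfold embX2
  refine ContDiffOn.prodMk (ContDiffOn.prodMk (by fun_prop) (ContDiffOn.prodMk
    contDiff_rho.contDiffOn (contDiffOn_pi.2 fun i => ?_))) (ContDiffOn.prodMk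
    (ContDiffOn.prodMk contDiff_dSigma.contDiffOn (ContDiffOn.prodMk ?_
    (contDiffOn_pi.2 fun i => (contDiff_tauT i).contDiffOn))) (ContDiffOn.prodMk
    contDiffOn_dGamma (ContDiffOn.prodMk ?_ (ContDiffOn.prodMk ?_ (contDiffOn_pi.2 fun i => ?_)))))
  · exact (contDiff_rho.mul (by fun_prop)).contDiffOn
  · exact contDiff_rho.contDiffOn.div (contDiff_dSigma.pow 2).contDiffOn hs
  · exact contDiff_xb.contDiffOn.div (contDiffOn_dGamma.pow 2)
      fun q hq => pow_ne_zero 2 (hg q hq)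
  · exact contDiff_dSigma.contDiffOn.div contDiffOn_dGamma hg
  · exact (contDiff_tauT i).contDiffOn.div contDiffOn_dGamma hg

theorem SmoothX2.contDiffOn {f : Phase d → ℝ} (hf : SmoothX2 f) : ContDiffOn ℝ ∞ f (scT d) := by
  obtain ⟨F, hF, h⟩ := hf
  exact (hF.comp_contDiffOn contDiffOn_embX2).congr h

/-- The orders of a symbol. -/
abbrev Order : Type := ℝ × ℝ × ℝ × ℝ

/-- The weight of a symbol of a given order. -/
def wt (μ : Order) (q : Phase d) : ℝ := weight μ.1 μ.2.1 μ.2.2.1 μ.2.2.2 q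

theorem wt_eq (μ : Order) (q : Phase d) : wt μ q =
    rho q ^ (-μ.1) * xb q ^ (-μ.2.1) * dSigma q ^ (-μ.2.2.1) * dGamma q ^ (-μ.2.2.2) := rfl

theorem wt_pos (μ : Order) {q : Phase d} (hq : q ∈ scT d) : 0 < wt μ q := by
  have h1 := rho_pos q
  have h2 : 0 < xb q := hq
  have h3 := dSigma_pos q
  have h4 := dGamma_pos hq
  rw [wt_eq]
  positivity

theorem wt_add (μ ν : Order) {q : Phase d} (hq : q ∈ scT d) :
    wt (μ + ν) q = wt μ q * wt ν q := by
  have h1 := rho_pos q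
  have h2 : 0 < xb q := hq
  have h3 := dSigma_pos q
  have h4 := dGamma_pos hq
  simp only [wt_eq, Prod.fst_add, Prod.snd_add, neg_add, Real.rpow_add h1, Real.rpow_add h2,
    Real.rpow_add h3, Real.rpow_add h4]
  ring

theorem wt_zero (q : Phase d) : wt 0 q = 1 := by
  simp [wt_eq]

theorem wt_neg (μ : Order) {q : Phase d} (hq : q ∈ scT d) : wt (-μ) q = (wt μ q)⁻¹ := by
  refine eq_inv_of_mul_eq_one_left ?_
  rw [← wt_add _ _ hq, neg_add_cancel, wt_zero]

theorem contDiffOn_wt (μ : Order) : ContDiffOn ℝ ∞ (wt μ : Phase d → ℝ) (scT d) := by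
  have h2 : ∀ q ∈ scT d, xb q ≠ 0 := fun q hq => ne_of_gt hq
  have h4 : ∀ q ∈ scT d, dGamma q ≠ 0 := fun q hq => (dGamma_pos hq).ne'
  have h : ContDiffOn ℝ ∞ (fun q : Phase d => rho q ^ (-μ.1) * xb q ^ (-μ.2.1) *
      dSigma q ^ (-μ.2.2.1) * dGamma q ^ (-μ.2.2.2)) (scT d) :=
    (((contDiff_rho.contDiffOn.rpow_const_of_ne fun q _ => (rho_pos q).ne').mul
      (contDiff_xb.contDiffOn.rpow_const_of_ne h2)).mul
      (contDiff_dSigma.contDiffOn.rpow_const_of_ne fun q _ => (dSigma_pos q).ne')).mul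
      (contDiffOn_dGamma.rpow_const_of_ne h4)
  exact h

/-- Labels of the coordinate directions: base, fibre, and `(X,Y)`. -/
abbrev Dir (d : ℕ) : Type := Fin (d + 2) ⊕ Fin (d + 2) ⊕ Fin (d + 2)

/-- The coordinate vectors in the base and the fibre; the `(X,Y)` directions project to `0`. -/
def vecP : Dir d → Phase d
  | .inl i => (Pi.single i 1, 0)
  | .inr (.inl i) => (0, Pi.single i 1)
  | .inr (.inr _) => 0

/-- The coordinate vectors. -/
def vec : Dir d → FullPhase d
  | .inl i => ((Pi.single i 1, 0), 0)
  | .inr (.inl i) => ((0, Pi.single i 1), 0)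
  | .inr (.inr i) => ((0, 0), Pi.single i 1)

/-- The change of order under differentiation; `o` is the gain of an `(X,Y)` derivative. -/
def ord (o : ℝ) : Dir d → Order
  | .inl i => if i = 0 then (0, 1, 0, 0) else 0
  | .inr (.inl i) => if i = 1 then (-1, 0, 0, 0) else (-1, 0, 1, 1)
  | .inr (.inr _) => (0, -o, 0, 0)

/-- The coordinate derivatives. -/
def pd (c : FullPhase d → ℂ) (e : Dir d) : FullPhase d → ℂ := act (fun _ => vec e) c

/-- The coordinates of a vector. -/
def coord : Dir d → FullPhase d →L[ℝ] ℝ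
  | .inl i => (ContinuousLinearMap.proj i).comp
      ((ContinuousLinearMap.fst ℝ _ _).comp (ContinuousLinearMap.fst ℝ _ _))
  | .inr (.inl i) => (ContinuousLinearMap.proj i).comp
      ((ContinuousLinearMap.snd ℝ _ _).comp (ContinuousLinearMap.fst ℝ _ _))
  | .inr (.inr i) => (ContinuousLinearMap.proj i).comp (ContinuousLinearMap.snd ℝ _ _)

theorem sum_coord (w : FullPhase d) : ∑ e, coord e w • vec e = w := by
  obtain ⟨⟨p, ζ⟩, Z⟩ := w
  simp only [Fintype.sum_sum_type, coord, vec]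
  refine Prod.ext (Prod.ext ?_ ?_) ?_ <;> ext i <;>
    simp [Prod.fst_sum, Prod.snd_sum, Finset.sum_apply, Pi.single_apply]

theorem sum_vecP (v : Phase d) :
    ∑ i, v.1 i • vecP (.inl i) + ∑ i, v.2 i • vecP (.inr (.inl i)) = v := by
  obtain ⟨p, ζ⟩ := v
  simp only [vecP]
  refine Prod.ext ?_ ?_ <;> ext i <;>
    simp [Prod.fst_sum, Prod.snd_sum, Finset.sum_apply, Pi.single_apply]

end BBCalculus
end

/-! ### The module 𝒱₂ and a frame that generates it. -/

noncomputable section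
namespace BBCalculus
open MeasureTheory Topology Set

variable {d : ℕ}

/-! ### Smooth functions on the blown-up space -/

/-- Vector valued functions which extend smoothly to `𝒳₂`. -/
def SmoothInto {E : Type*} [NormedAddCommGroup E] [NormedSpace ℝ E] (f : Phase d → E) : Prop :=
  ∃ F : Ambient d → E, ContDiff ℝ ∞ F ∧ ∀ q ∈ scT d, f q = F (embX2 q)

namespace SmoothInto

variable {E G : Type*} [NormedAddCommGroup E] [NormedSpace ℝ E] [NormedAddCommGroup G]
  [NormedSpace ℝ G]

theorem congr {f g : Phase d → E} (hf : SmoothInto f) (h : ∀ q ∈ scT d, g q = f q) :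
    SmoothInto g := by
  obtain ⟨F, hF, hf⟩ := hf
  exact ⟨F, hF, fun q hq => (h q hq).trans (hf q hq)⟩

theorem prodMk {f : Phase d → E} {g : Phase d → G} (hf : SmoothInto f) (hg : SmoothInto g) :
    SmoothInto (fun q => (f q, g q)) := by
  obtain ⟨F, hF, hf⟩ := hf
  obtain ⟨K, hK, hg⟩ := hg
  exact ⟨fun z => (F z, K z), hF.prodMk hK, fun q hq => by simp only [hf q hq, hg q hq]⟩

theorem pi {ι : Type*} [Fintype ι] {f : Phase d → ι → ℝ}
    (hf : ∀ i, SmoothX2 (fun q => f q i)) : SmoothInto f := by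
  choose F hF hf using hf
  exact ⟨fun z i => F i z, contDiff_pi.2 hF, fun q hq => funext fun i => hf i q hq⟩

end SmoothInto

namespace SmoothX2

variable {f g : Phase d → ℝ}

theorem congr (hf : SmoothX2 f) (h : ∀ q ∈ scT d, g q = f q) : SmoothX2 g :=
  SmoothInto.congr hf h

theorem const (c : ℝ) : SmoothX2 (fun _ : Phase d => c) := ⟨fun _ => c, contDiff_const, by simp⟩

theorem add (hf : SmoothX2 f) (hg : SmoothX2 g) : SmoothX2 (fun q => f q + g q) := by
  obtain ⟨F, hF, hf⟩ := hf
  obtain ⟨K, hK, hg⟩ := hg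
  exact ⟨fun z => F z + K z, hF.add hK, fun q hq => by simp only [hf q hq, hg q hq]⟩

theorem mul (hf : SmoothX2 f) (hg : SmoothX2 g) : SmoothX2 (fun q => f q * g q) := by
  obtain ⟨F, hF, hf⟩ := hf
  obtain ⟨K, hK, hg⟩ := hg
  exact ⟨fun z => F z * K z, hF.mul hK, fun q hq => by simp only [hf q hq, hg q hq]⟩

theorem const_mul (c : ℝ) (hf : SmoothX2 f) : SmoothX2 (fun q => c * f q) := (const c).mul hf

theorem neg (hf : SmoothX2 f) : SmoothX2 (fun q => -f q) :=
  (hf.const_mul (-1)).congr fun q _ => by ring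

theorem sub (hf : SmoothX2 f) (hg : SmoothX2 g) : SmoothX2 (fun q => f q - g q) :=
  (hf.add hg.neg).congr fun q _ => by ring

theorem pow (n : ℕ) (hf : SmoothX2 f) : SmoothX2 (fun q => f q ^ n) := by
  obtain ⟨F, hF, hf⟩ := hf
  exact ⟨fun z => F z ^ n, hF.pow n, fun q hq => by simp only [hf q hq]⟩

theorem sum {ι : Type*} [Fintype ι] {f : ι → Phase d → ℝ} (hf : ∀ i, SmoothX2 (f i)) :
    SmoothX2 (fun q => ∑ i, f i q) := by
  choose F hF hf using hf
  exact ⟨fun z => ∑ i, F i z, ContDiff.sum fun i _ => hF i, fun q hq => by simp only [hf _ q hq]⟩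

theorem base (i : Fin (d + 2)) : SmoothX2 (fun q : Phase d => q.1 i) :=
  ⟨fun z => z.1.1 i, by fun_prop, fun _ _ => rfl⟩

theorem rho : SmoothX2 (rho : Phase d → ℝ) := ⟨fun z => z.1.2.1, by fun_prop, fun _ _ => rfl⟩

theorem rho_mul (i : Fin (d + 2)) : SmoothX2 (fun q : Phase d => BBCalculus.rho q * q.2 i) :=
  ⟨fun z => z.1.2.2 i, by fun_prop, fun _ _ => rfl⟩

theorem dSigma : SmoothX2 (dSigma : Phase d → ℝ) := ⟨fun z => z.2.1.1, by fun_prop, fun _ _ => rfl⟩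

theorem rho_div : SmoothX2 (fun q : Phase d => BBCalculus.rho q / BBCalculus.dSigma q ^ 2) :=
  ⟨fun z => z.2.1.2.1, by fun_prop, fun _ _ => rfl⟩

theorem tauT (i : Fin (d + 1)) : SmoothX2 (fun q : Phase d => tauT q i) :=
  ⟨fun z => z.2.1.2.2 i, by fun_prop, fun _ _ => rfl⟩

theorem dGamma : SmoothX2 (dGamma : Phase d → ℝ) := ⟨fun z => z.2.2.1, by fun_prop, fun _ _ => rfl⟩

theorem xb_div : SmoothX2 (fun q : Phase d => xb q / BBCalculus.dGamma q ^ 2) :=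
  ⟨fun z => z.2.2.2.1, by fun_prop, fun _ _ => rfl⟩

theorem dSigma_div : SmoothX2 (fun q : Phase d => BBCalculus.dSigma q / BBCalculus.dGamma q) :=
  ⟨fun z => z.2.2.2.2.1, by fun_prop, fun _ _ => rfl⟩

theorem tauT_div (i : Fin (d + 1)) :
    SmoothX2 (fun q : Phase d => BBCalculus.tauT q i / BBCalculus.dGamma q) :=
  ⟨fun z => z.2.2.2.2.2 i, by fun_prop, fun _ _ => rfl⟩

theorem tau (i : Fin (d + 1)) : SmoothX2 (fun q : Phase d => tau q i) := rho_mul _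

theorem differentiableAt (hf : SmoothX2 f) {q : Phase d} (hq : q ∈ scT d) :
    DifferentiableAt ℝ f q := hf.contDiffOn.differentiableAt_of_isOpen isOpen_scT hq

end SmoothX2

/-! ### Vector fields -/

section ActLemmas

variable {V : Phase d → Phase d} {q : Phase d}

theorem act_prodMk {E G : Type*} [NormedAddCommGroup E] [NormedSpace ℝ E] [NormedAddCommGroup G]
    [NormedSpace ℝ G] {f : Phase d → E} {g : Phase d → G} (hf : DifferentiableAt ℝ f q)
    (hg : DifferentiableAt ℝ g q) :
    act V (fun z => (f z, g z)) q = (act V f q, act V g q) := by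
  simp only [act, hf.fderiv_prodMk hg, ContinuousLinearMap.prod_apply]

theorem act_pi {ι : Type*} [Fintype ι] {f : Phase d → ι → ℝ}
    (hf : ∀ i, DifferentiableAt ℝ (fun z => f z i) q) :
    act V f q = fun i => act V (fun z => f z i) q := by
  have : fderiv ℝ f q = _ := fderiv_pi hf
  simp only [act, this]
  rfl

theorem act_sum {ι : Type*} [Fintype ι] {f : ι → Phase d → ℝ}
    (hf : ∀ i, DifferentiableAt ℝ (f i) q) :
    act V (fun z => ∑ i, f i z) q = ∑ i, act V (f i) q := by
  simp only [act, fderiv_fun_sum fun i (_ : i ∈ Finset.univ) => hf i]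
  simp

theorem act_div {f g : Phase d → ℝ} (hf : DifferentiableAt ℝ f q) (hg : DifferentiableAt ℝ g q)
    (h0 : g q ≠ 0) {a b : ℝ} (ha : act V f q = a) (hb : act V g q = g q * b) :
    act V (fun z => f z / g z) q = a / g q - f q / g q * b := by
  have h := hf.hasFDerivAt.fun_mul ((hasDerivAt_inv h0).comp_hasFDerivAt q hg.hasFDerivAt)
  have h2 : HasFDerivAt (fun z => f z / g z) _ q := h
  simp only [act] at ha hb ⊢
  rw [h2.fderiv]
  simp only [add_apply, smul_apply, smul_eq_mul, Function.comp, ha, hb]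
  field_simp
  ring

end ActLemmas

/-- The embedding functions determine the action on all smooth functions. -/
theorem smoothX2_act_of_embX2 {V : Phase d → Phase d} (hV : SmoothInto (act V embX2))
    {f : Phase d → ℝ} (hf : SmoothX2 f) : SmoothX2 (act V f) := by
  obtain ⟨H, hH, hV⟩ := hV
  obtain ⟨F, hF, hf⟩ := hf
  refine ⟨fun z => fderiv ℝ F z (H z), ?_, fun q hq => ?_⟩
  · exact (contDiff_infty_iff_fderiv.1 hF).2.clm_apply hH
  · rw [act_congr isOpen_scT hf hq]
    beta_reduce
    rw [← hV q hq]
    have h1 := contDiffOn_embX2.differentiableAt_of_isOpen isOpen_scT hq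
    have h2 : DifferentiableAt ℝ F (embX2 q) := hF.differentiable (by simp) _
    have h3 := (h2.hasFDerivAt.comp q h1.hasFDerivAt).fderiv
    simp only [act]
    change fderiv ℝ (F ∘ embX2) q (V q) = _
    rw [h3]
    rfl

/-- A criterion for membership in `𝒱₂`. -/
theorem mem_V2_of {V : Phase d → Phase d} {ax ar : Phase d → ℝ} {at' : Fin (d + 1) → Phase d → ℝ}
    (hax : SmoothX2 ax) (har : SmoothX2 ar) (hat : ∀ i, SmoothX2 (at' i))
    (hb : ∀ i, SmoothX2 (fun q => (V q).1 i)) (hb0 : ∀ q ∈ scT d, (V q).1 0 = xb q * ax q)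
    (hr : ∀ q ∈ scT d, act V rho q = rho q * ar q)
    (ht : ∀ i, ∀ q ∈ scT d, act V (fun q => tau q i) q = dSigma q * dGamma q * at' i q)
    (hη : SmoothX2 (act V fun q => rho q * q.2 1)) : V ∈ V2 d := by
  have hx : ∀ q ∈ scT d, act V xb q = xb q * ax q := fun q hq => by
    have : fderiv ℝ (xb : Phase d → ℝ) q = (ContinuousLinearMap.proj 0).comp
      (ContinuousLinearMap.fst ℝ _ _) := ContinuousLinearMap.fderiv
        ((ContinuousLinearMap.proj (R := ℝ) 0).comp
          (ContinuousLinearMap.fst ℝ (Coord d) (Coord d)))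
    rw [← hb0 q hq]
    simp only [act, this]
    simp
  -- These coefficients come from differentiating d_Σ² = |τ|² + ρ, then τ̃ = τ/d_Σ, then d_Γ² = x +
  -- d_Σ² + |τ̃|². The goals are Vd_Σ = d_Σ·aS, Vτ̃_i = d_Γ·aT_i and Vd_Γ = d_Γ·aG. The factor d_Γ
  -- assumed in Vτ_i is what makes Vτ̃_i divisible by d_Γ, so that aG is smooth.
  set aS : Phase d → ℝ := fun q => dGamma q * ∑ i, tauT q i * at' i q +
    rho q / dSigma q ^ 2 * ar q * (1 / 2) with haS
  set aT : Fin (d + 1) → Phase d → ℝ := fun i q => at' i q - tauT q i / dGamma q * aS q with haT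
  set aG : Phase d → ℝ := fun q => xb q / dGamma q ^ 2 * ax q * (1 / 2) +
    (dSigma q / dGamma q) ^ 2 * aS q + ∑ i, tauT q i / dGamma q * aT i q with haG
  have sS : SmoothX2 aS := (SmoothX2.dGamma.mul (SmoothX2.sum fun i => (SmoothX2.tauT i).mul
    (hat i))).add ((SmoothX2.rho_div.mul har).mul (SmoothX2.const _))
  have sT : ∀ i, SmoothX2 (aT i) := fun i => (hat i).sub ((SmoothX2.tauT_div i).mul sS)
  have sG : SmoothX2 aG := (((SmoothX2.xb_div.mul hax).mul (SmoothX2.const _)).add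
    ((SmoothX2.dSigma_div.pow 2).mul sS)).add (SmoothX2.sum fun i => (SmoothX2.tauT_div i).mul
    (sT i))
  have hS : ∀ q ∈ scT d, act V dSigma q = dSigma q * aS q := fun q hq => by
    have h1 : act V (fun q => dSigma q ^ 2) q = 2 * dSigma q * act V dSigma q := by
      rw [act_pow _ (SmoothX2.dSigma.differentiableAt hq)]; simp
    have h2 : act V (fun q => dSigma q ^ 2) q =
        ∑ i, 2 * tau q i * (dSigma q * dGamma q * at' i q) + rho q * ar q := by
      rw [act_congr isOpen_scT (fun q _ => dSigma_sq q) hq, act_add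
        ((SmoothX2.sum fun i => (SmoothX2.tau i).pow 2).differentiableAt hq)
        (SmoothX2.rho.differentiableAt hq), hr q hq,
        act_sum fun i => ((SmoothX2.tau i).pow 2).differentiableAt hq]
      congr 1
      refine Finset.sum_congr rfl fun i _ => ?_
      rw [act_pow _ ((SmoothX2.tau i).differentiableAt hq), ht i q hq]
      simp
    have h0 := (dSigma_pos q).ne'
    have h3 : ∑ i, 2 * tau q i * (dSigma q * dGamma q * at' i q) =
        2 * dSigma q ^ 2 * (dGamma q * ∑ i, tauT q i * at' i q) := by
      simp only [Finset.mul_sum]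
      refine Finset.sum_congr rfl fun i _ => ?_
      unfold tauT
      field_simp
    rw [h2, h3] at h1
    have h4 : 2 * dSigma q * act V dSigma q = 2 * dSigma q * (dSigma q * aS q) := by
      rw [← h1, haS]
      field_simp
    exact mul_left_cancel₀ (by positivity) h4
  have hT : ∀ i, ∀ q ∈ scT d, act V (fun q => tauT q i) q = dGamma q * aT i q := fun i q hq => by
    have h0 := (dSigma_pos q).ne'
    have h1 := (dGamma_pos hq).ne'
    have := act_div (V := V) ((SmoothX2.tau i).differentiableAt hq)
      (SmoothX2.dSigma.differentiableAt hq) h0 (ht i q hq) (hS q hq)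
    unfold tauT
    rw [this]
    simp only [haT, tauT]
    field_simp
  have hG : ∀ q ∈ scT d, act V dGamma q = dGamma q * aG q := fun q hq => by
    have h0 := (dGamma_pos hq).ne'
    have h1 : act V (fun q => dGamma q ^ 2) q = 2 * dGamma q * act V dGamma q := by
      rw [act_pow _ (SmoothX2.dGamma.differentiableAt hq)]; simp
    have h2 : act V (fun q => dGamma q ^ 2) q = xb q * ax q + 2 * dSigma q * (dSigma q * aS q) +
        ∑ i, 2 * tauT q i * (dGamma q * aT i q) := by
      have e1 : DifferentiableAt ℝ (xb : Phase d → ℝ) q := contDiff_xb.differentiable (by simp) q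
      have e2 := (SmoothX2.dSigma.pow 2).differentiableAt hq
      rw [act_congr isOpen_scT (fun q hq => dGamma_sq hq) hq, act_add (e1.fun_add e2)
        ((SmoothX2.sum fun i => (SmoothX2.tauT i).pow 2).differentiableAt hq), act_add e1 e2,
        hx q hq, act_sum fun i => ((SmoothX2.tauT i).pow 2).differentiableAt hq,
        act_pow _ (SmoothX2.dSigma.differentiableAt hq), hS q hq]
      congr 1
      · simp
      refine Finset.sum_congr rfl fun i _ => ?_
      rw [act_pow _ ((SmoothX2.tauT i).differentiableAt hq), hT i q hq]
      simp
    have h3 : ∑ i, 2 * tauT q i * (dGamma q * aT i q) =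
        2 * dGamma q ^ 2 * ∑ i, tauT q i / dGamma q * aT i q := by
      simp only [Finset.mul_sum]
      refine Finset.sum_congr rfl fun i _ => ?_
      field_simp
    rw [h2, h3] at h1
    have h4 : 2 * dGamma q * act V dGamma q = 2 * dGamma q * (dGamma q * aG q) := by
      rw [← h1]
      simp only [haG]
      field_simp
    exact mul_left_cancel₀ (by positivity) h4
  have hu : ∀ q ∈ scT d, act V (fun q => rho q / dSigma q ^ 2) q =
      (ar q - 2 * aS q) * (rho q / dSigma q ^ 2) := fun q hq => by
    have h0 := (dSigma_pos q).ne'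
    rw [act_div (V := V) (b := 2 * aS q) (SmoothX2.rho.differentiableAt hq)
      ((SmoothX2.dSigma.pow 2).differentiableAt hq) (pow_ne_zero 2 h0) (hr q hq)]
    · field_simp
    · rw [act_pow _ (SmoothX2.dSigma.differentiableAt hq), hS q hq]
      simp; ring
  have hxg : ∀ q ∈ scT d, act V (fun q => xb q / dGamma q ^ 2) q =
      (ax q - 2 * aG q) * (xb q / dGamma q ^ 2) := fun q hq => by
    have h0 := (dGamma_pos hq).ne'
    rw [act_div (V := V) (b := 2 * aG q) (contDiff_xb.differentiable (by simp) q)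
      ((SmoothX2.dGamma.pow 2).differentiableAt hq) (pow_ne_zero 2 h0) (hx q hq)]
    · field_simp
    · rw [act_pow _ (SmoothX2.dGamma.differentiableAt hq), hG q hq]
      simp; ring
  have hsg : ∀ q ∈ scT d, act V (fun q => dSigma q / dGamma q) q =
      (aS q - aG q) * (dSigma q / dGamma q) := fun q hq => by
    have h0 := (dGamma_pos hq).ne'
    rw [act_div (V := V) (SmoothX2.dSigma.differentiableAt hq)
      (SmoothX2.dGamma.differentiableAt hq) h0 (hS q hq) (hG q hq)]
    field_simp
  have htg : ∀ i, ∀ q ∈ scT d, act V (fun q => tauT q i / dGamma q) q =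
      aT i q - tauT q i / dGamma q * aG q := fun i q hq => by
    have h0 := (dGamma_pos hq).ne'
    rw [act_div (V := V) ((SmoothX2.tauT i).differentiableAt hq)
      (SmoothX2.dGamma.differentiableAt hq) h0 (hT i q hq) (hG q hq)]
    field_simp
  have sη : ∀ i, SmoothX2 (act V fun q => rho q * q.2 i) := fun i => by
    by_cases h : i = 1
    · rw [h]; exact hη
    · obtain ⟨j, rfl⟩ := Fin.exists_succAbove_eq h
      exact ((SmoothX2.dSigma.mul SmoothX2.dGamma).mul (hat j)).congr (ht j)
  refine ⟨fun f hf => smoothX2_act_of_embX2 ?_ hf, ⟨_, har.sub (sS.const_mul 2), hu⟩,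
    ⟨_, hax.sub (sG.const_mul 2), hxg⟩, ⟨_, sS.sub sG, hsg⟩, ⟨aG, sG, fun q hq => ?_⟩⟩
  swap
  · rw [hG q hq, mul_comm]
  -- Smoothness of V on 𝒳₂ only has to be tested on the functions that embed it, all of whose
  -- derivatives are now explicit.
  have key : SmoothInto (fun q => (((V q).1, act V rho q, fun i => act V (fun q => rho q * q.2 i) q),
      (act V dSigma q, act V (fun q => rho q / dSigma q ^ 2) q, fun i => act V (fun q => tauT q i) q),
      (act V dGamma q, act V (fun q => xb q / dGamma q ^ 2) q,
        act V (fun q => dSigma q / dGamma q) q, fun i => act V (fun q => tauT q i / dGamma q) q))) :=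
    SmoothInto.prodMk (SmoothInto.prodMk (SmoothInto.pi hb) (SmoothInto.prodMk
      ((SmoothX2.rho.mul har).congr hr) (SmoothInto.pi sη))) (SmoothInto.prodMk
      (SmoothInto.prodMk ((SmoothX2.dSigma.mul sS).congr hS) (SmoothInto.prodMk
      (((har.sub (sS.const_mul 2)).mul SmoothX2.rho_div).congr hu)
      (SmoothInto.pi fun i => (SmoothX2.dGamma.mul (sT i)).congr (hT i))))
      (SmoothInto.prodMk ((SmoothX2.dGamma.mul sG).congr hG) (SmoothInto.prodMk
      (((hax.sub (sG.const_mul 2)).mul SmoothX2.xb_div).congr hxg) (SmoothInto.prodMk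
      (((sS.sub sG).mul SmoothX2.dSigma_div).congr hsg)
      (SmoothInto.pi fun i => ((sT i).sub ((SmoothX2.tauT_div i).mul sG)).congr (htg i))))))
  refine key.congr fun q hq => ?_
  have d0 : ∀ i, DifferentiableAt ℝ (fun q : Phase d => rho q * q.2 i) q :=
    fun i => (SmoothX2.rho_mul i).differentiableAt hq
  have d1 : ∀ i, DifferentiableAt ℝ (fun q : Phase d => tauT q i) q :=
    fun i => (SmoothX2.tauT i).differentiableAt hq
  have d2 : ∀ i, DifferentiableAt ℝ (fun q : Phase d => tauT q i / dGamma q) q :=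
    fun i => (SmoothX2.tauT_div i).differentiableAt hq
  have d0' := differentiableAt_pi.2 d0
  have d1' := differentiableAt_pi.2 d1
  have d2' := differentiableAt_pi.2 d2
  have d3 := SmoothX2.rho.differentiableAt hq
  have d4 := SmoothX2.dSigma.differentiableAt hq
  have d5 := SmoothX2.dGamma.differentiableAt hq
  have d6 := SmoothX2.rho_div.differentiableAt hq
  have d7 := SmoothX2.xb_div.differentiableAt hq
  have d8 := SmoothX2.dSigma_div.differentiableAt hq
  have d9 : DifferentiableAt ℝ (fun q : Phase d => q.1) q := differentiableAt_fst
  have e9 : act V (fun q : Phase d => q.1) q = (V q).1 := by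
    have := (ContinuousLinearMap.fst ℝ (Coord d) (Coord d)).fderiv (x := q)
    exact congrArg (fun L => L (V q)) this
  unfold embX2
  rw [act_prodMk (d9.prodMk (d3.prodMk d0')) ((d4.prodMk (d6.prodMk d1')).prodMk
      (d5.prodMk (d7.prodMk (d8.prodMk d2')))),
    act_prodMk d9 (d3.prodMk d0'), act_prodMk d3 d0',
    act_prodMk (d4.prodMk (d6.prodMk d1')) (d5.prodMk (d7.prodMk (d8.prodMk d2'))),
    act_prodMk d4 (d6.prodMk d1'), act_prodMk d6 d1', act_prodMk d5 (d7.prodMk (d8.prodMk d2')),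
    act_prodMk d7 (d8.prodMk d2'), act_prodMk d8 d2', act_pi d0, act_pi d1, act_pi d2, e9]

/-! ### A frame for `𝒱₂` -/

/-- The frame `x∂_x, ∂_y, ρ⁻¹∂_{η_1}, ρ⁻¹d_Σd_Γ∂_{ζ_i}` of `𝒱₂`. -/
def frame (e : Dir d) (q : Phase d) : Phase d := wt (-ord 1 e) q • vecP e

theorem act_smul_vec (V : Phase d → Phase d) (c : Phase d → ℝ) {f : Phase d → ℝ} {q : Phase d} :
    act (fun q => c q • V q) f q = c q * act V f q := by
  simp [act]

theorem act_base_vec (i : Fin (d + 2)) {f : Coord d → ℝ} {q : Phase d}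
    (hf : DifferentiableAt ℝ f q.2) :
    act (fun _ => (vecP (.inl i) : Phase d)) (fun q => f q.2) q = 0 := by
  have h := (hf.hasFDerivAt.comp q
    ((ContinuousLinearMap.snd ℝ (Coord d) (Coord d)).hasFDerivAt)).fderiv
  have h' : fderiv ℝ (fun q : Phase d => f q.2) q = _ := h
  simp only [act, h']
  simp [vecP]

theorem act_fib_coord (i j : Fin (d + 2)) (q : Phase d) :
    act (fun _ => (vecP (.inr (.inl i)) : Phase d)) (fun q => q.2 j) q =
      if i = j then 1 else 0 := by
  have h := ((ContinuousLinearMap.proj (R := ℝ) (φ := fun _ => ℝ) j).comp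
    (ContinuousLinearMap.snd ℝ (Coord d) (Coord d))).fderiv (x := q)
  have h' : fderiv ℝ (fun q : Phase d => q.2 j) q = _ := h
  simp only [act, h']
  simp [vecP, Pi.single_apply, eq_comm]

/-- Differentiating the identity ρ²(1+|ζ|²) = 1 gives the formula without differentiating a square
root. -/
theorem act_fib_rho (i : Fin (d + 2)) (q : Phase d) :
    act (fun _ => (vecP (.inr (.inl i)) : Phase d)) rho q = -(rho q ^ 2 * (rho q * q.2 i)) := by
  have hpos : 0 < 1 + ∑ i, q.2 i ^ 2 := by
    have : 0 ≤ ∑ i, q.2 i ^ 2 := Finset.sum_nonneg fun i _ => sq_nonneg _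
    positivity
  have hd : DifferentiableAt ℝ (rho : Phase d → ℝ) q := contDiff_rho.differentiable (by simp) q
  have hc : ∀ j, DifferentiableAt ℝ (fun q : Phase d => q.2 j) q := fun j => by fun_prop
  have h1 : ∀ q : Phase d, rho q ^ 2 * (1 + ∑ i, q.2 i ^ 2) = 1 := fun q => by
    have hpos : 0 < 1 + ∑ i, q.2 i ^ 2 := by
      have : 0 ≤ ∑ i, q.2 i ^ 2 := Finset.sum_nonneg fun i _ => sq_nonneg _
      positivity
    rw [rho, inv_pow, Real.sq_sqrt hpos.le, inv_mul_cancel₀ hpos.ne']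
  set V : Phase d → Phase d := fun _ => vecP (.inr (.inl i)) with hV
  have h2 : act V (fun q : Phase d => rho q ^ 2 * (1 + ∑ i, q.2 i ^ 2)) q = 0 := by
    rw [act_congr isOpen_univ (fun q _ => h1 q) (mem_univ q), act_const]
  have h3 : act V (fun q : Phase d => 1 + ∑ i, q.2 i ^ 2) q = 2 * q.2 i := by
    rw [act_add (differentiableAt_const _) (by fun_prop), act_const,
      act_sum fun i => (hc i).fun_pow 2]
    simp_rw [act_pow _ (hc _), hV, act_fib_coord]
    simp
  rw [act_mul (hd.fun_pow 2) (by fun_prop), act_pow _ hd, h3] at h2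
  have h4 := h1 q
  have h5 := (rho_pos q).ne'
  have h6 : (1 + ∑ i, q.2 i ^ 2) = (rho q ^ 2)⁻¹ := by
    field_simp; linarith
  rw [h6] at h2
  field_simp at h2
  simp at h2
  have h7 : rho q * (act V rho q + rho q ^ 2 * (rho q * q.2 i)) = 0 := by linear_combination h2 / 2
  linarith [(mul_eq_zero.1 h7).resolve_left h5]

theorem wt_ord_fib_one (o : ℝ) (q : Phase d) : wt (-ord (d := d) o (.inr (.inl 1))) q = (rho q)⁻¹ := by
  simp [wt_eq, ord, Real.rpow_neg_one]

theorem wt_ord_fib {o : ℝ} {i : Fin (d + 2)} (hi : i ≠ 1) (q : Phase d) :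
    wt (-ord o (.inr (.inl i))) q = (rho q)⁻¹ * dSigma q * dGamma q := by
  simp [wt_eq, ord, hi, Real.rpow_neg_one]

theorem wt_ord_base_zero (o : ℝ) (q : Phase d) : wt (-ord (d := d) o (.inl 0)) q = xb q := by
  simp [wt_eq, ord]

theorem wt_ord_base {o : ℝ} {i : Fin (d + 2)} (hi : i ≠ 0) (q : Phase d) :
    wt (-ord o (.inl i)) q = 1 := by
  simp [wt_eq, ord, hi]

theorem wt_ord_pos (q : Phase d) (i : Fin (d + 2)) :
    wt (-ord 1 (.inr (.inr i))) q = (xb q)⁻¹ := by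
  simp [wt_eq, ord, Real.rpow_neg_one]

theorem frame_base_mem (i : Fin (d + 2)) : frame (.inl i) ∈ V2 d := by
  have hf : ∀ f : Coord d → ℝ, Differentiable ℝ f → ∀ q : Phase d,
      act (frame (.inl i)) (fun q => f q.2) q = 0 := fun f hf q => by
    unfold frame
    rw [act_smul_vec, act_base_vec i (hf _), mul_zero]
  have hr := contDiff_rho (d := d).differentiable (by simp)
  have hr' : Differentiable ℝ (fun ζ : Coord d => rho ((0, ζ) : Phase d)) :=
    hr.comp (by fun_prop : Differentiable ℝ fun ζ : Coord d => ((0, ζ) : Phase d))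
  have hrc : ∀ j, Differentiable ℝ (fun ζ : Coord d => rho ((0, ζ) : Phase d) * ζ j) :=
    fun j => hr'.fun_mul (by fun_prop)
  refine mem_V2_of (ax := fun _ => if i = 0 then 1 else 0) (ar := fun _ => 0)
    (at' := fun _ _ => 0) (SmoothX2.const _) (SmoothX2.const _) (fun _ => SmoothX2.const _)
    (fun j => ?_) (fun q _ => ?_) (fun q _ => ?_) (fun j q _ => ?_) ?_
  · by_cases h : i = 0
    · subst h
      refine ((SmoothX2.base 0).const_mul (if j = 0 then 1 else 0)).congr fun q _ => ?_
      simp only [frame, wt_ord_base_zero, vecP, xb]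
      by_cases hj : j = 0 <;> simp [hj]
    · refine (SmoothX2.const (if j = i then 1 else 0)).congr fun q _ => ?_
      simp only [frame, wt_ord_base h, vecP]
      by_cases hj : j = i <;> simp [hj]
  · by_cases h : i = 0
    · subst h
      simp [frame, wt_ord_base_zero, vecP]
    · simp [frame, vecP, h, Ne.symm h]
  · exact (hf _ hr' q).trans (mul_zero _).symm
  · exact (hf _ (hrc _) q).trans (mul_zero _).symm
  · exact (SmoothX2.const 0).congr fun q _ => hf _ (hrc 1) q

theorem act_fib_rho_mul (i j : Fin (d + 2)) (q : Phase d) :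
    act (fun _ => (vecP (.inr (.inl i)) : Phase d)) (fun q => rho q * q.2 j) q =
      rho q * ((if i = j then 1 else 0) - (rho q * q.2 i) * (rho q * q.2 j)) := by
  rw [act_mul (contDiff_rho.differentiable (by simp) q) (by fun_prop), act_fib_rho, act_fib_coord]
  ring

/-- The derivative of τ_j along ρ⁻¹∂_{ζ_i} is δ - (ρζ_i)τ_j, with δ = 1 exactly when τ_j is the
rescaled ζ_i. In the direction η_1 the delta is absent and τ_j = d_Σd_Γ·(τ̃_j/d_Γ) already has the
required form. In the other directions the delta is not divisible by d_Σd_Γ, and this factor must be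
put into the field. -/
theorem frame_fib_mem (i : Fin (d + 2)) : frame (.inr (.inl i)) ∈ V2 d := by
  by_cases hi : i = 1
  · subst hi
    have hf : ∀ f : Phase d → ℝ, ∀ q, act (frame (.inr (.inl 1))) f q =
        (rho q)⁻¹ * act (fun _ => vecP (.inr (.inl 1))) f q := fun f q => by
      unfold frame
      rw [act_smul_vec, wt_ord_fib_one]
    refine mem_V2_of (ax := fun _ => 0) (ar := fun q => -(rho q * q.2 1))
      (at' := fun j q => -(rho q * q.2 1) * (tauT q j / dGamma q)) (SmoothX2.const _)
      (SmoothX2.rho_mul 1).neg (fun j => (SmoothX2.rho_mul 1).neg.mul (SmoothX2.tauT_div j))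
      (fun j => (SmoothX2.const 0).congr fun q _ => ?_) (fun q _ => ?_) (fun q _ => ?_)
      (fun j q hq => ?_) ?_
    · simp [frame, vecP]
    · simp [frame, vecP]
    · have := rho_pos q
      rw [hf, act_fib_rho]
      field_simp
    · have := rho_pos q
      have := dSigma_pos q
      have := dGamma_pos hq
      unfold tau
      rw [hf, act_fib_rho_mul, if_neg (Fin.succAbove_ne _ _).symm]
      unfold tauT tau
      field_simp
      ring
    · refine ((SmoothX2.const 1).sub ((SmoothX2.rho_mul 1).mul (SmoothX2.rho_mul 1))).congr
        fun q _ => ?_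
      have := rho_pos q
      rw [hf, act_fib_rho_mul, if_pos rfl]
      field_simp
  · have hf : ∀ f : Phase d → ℝ, ∀ q, act (frame (.inr (.inl i))) f q =
        (rho q)⁻¹ * dSigma q * dGamma q * act (fun _ => vecP (.inr (.inl i))) f q := fun f q => by
      unfold frame
      rw [act_smul_vec, wt_ord_fib hi]
    refine mem_V2_of (ax := fun _ => 0) (ar := fun q => -(rho q * q.2 i) * dSigma q * dGamma q)
      (at' := fun j q => (if i = (1 : Fin (d + 2)).succAbove j then 1 else 0) -
        (rho q * q.2 i) * tau q j) (SmoothX2.const _)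
      (((SmoothX2.rho_mul i).neg.mul SmoothX2.dSigma).mul SmoothX2.dGamma)
      (fun j => (SmoothX2.const _).sub ((SmoothX2.rho_mul i).mul (SmoothX2.tau j)))
      (fun j => (SmoothX2.const 0).congr fun q _ => ?_) (fun q _ => ?_) (fun q _ => ?_)
      (fun j q hq => ?_) ?_
    · simp [frame, vecP]
    · simp [frame, vecP]
    · have := rho_pos q
      rw [hf, act_fib_rho]
      field_simp
    · have := rho_pos q
      unfold tau
      rw [hf, act_fib_rho_mul]
      field_simp
    · refine ((SmoothX2.dSigma.mul SmoothX2.dGamma).mul ((SmoothX2.const 0).sub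
        ((SmoothX2.rho_mul i).mul (SmoothX2.rho_mul 1)))).congr fun q _ => ?_
      have := rho_pos q
      rw [hf, act_fib_rho_mul, if_neg hi]
      field_simp

theorem TangentTo.congr {V : Phase d → Phase d} {a b : Phase d → ℝ} (ha : TangentTo a V)
    (h : EqOn b a (scT d)) : TangentTo b V := by
  obtain ⟨g, hg, ha⟩ := ha
  exact ⟨g, hg, fun q hq => by rw [act_congr isOpen_scT h hq, ha q hq, h hq]⟩

theorem TangentTo.mul {V : Phase d → Phase d} {a b : Phase d → ℝ} (ha : TangentTo a V)
    (hb : TangentTo b V) (da : ∀ q ∈ scT d, DifferentiableAt ℝ a q)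
    (db : ∀ q ∈ scT d, DifferentiableAt ℝ b q) : TangentTo (fun q => a q * b q) V := by
  obtain ⟨g, hg, ha⟩ := ha
  obtain ⟨h, hh, hb⟩ := hb
  refine ⟨_, hg.add hh, fun q hq => ?_⟩
  rw [act_mul (da q hq) (db q hq), ha q hq, hb q hq]
  ring

theorem TangentTo.rpow {V : Phase d → Phase d} {a : Phase d → ℝ} (ha : TangentTo a V)
    (da : ∀ q ∈ scT d, DifferentiableAt ℝ a q) (h0 : ∀ q ∈ scT d, 0 < a q) (s : ℝ) :
    TangentTo (fun q => a q ^ s) V := by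
  obtain ⟨g, hg, ha⟩ := ha
  refine ⟨_, hg.const_mul s, fun q hq => ?_⟩
  have := h0 q hq
  rw [act_rpow s (da q hq) this, ha q hq]
  field_simp

section Tangent

variable {V : Phase d → Phase d} (hV : V ∈ V2 d)

theorem differentiableAt_xb (q : Phase d) : DifferentiableAt ℝ (xb : Phase d → ℝ) q :=
  contDiff_xb.differentiable (by simp) q

include hV

theorem tangentTo_xb : TangentTo xb V := by
  obtain ⟨-, -, h2, -, h4⟩ := hV
  refine ((h2.mul h4 (fun q hq => SmoothX2.xb_div.differentiableAt hq)
    fun q hq => SmoothX2.dGamma.differentiableAt hq).mul h4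
    (fun q hq => (SmoothX2.xb_div.mul SmoothX2.dGamma).differentiableAt hq)
    fun q hq => SmoothX2.dGamma.differentiableAt hq).congr fun q hq => ?_
  have := dGamma_pos hq
  field_simp

theorem tangentTo_dSigma : TangentTo dSigma V := by
  obtain ⟨-, -, -, h3, h4⟩ := hV
  refine (h3.mul h4 (fun q hq => SmoothX2.dSigma_div.differentiableAt hq)
    fun q hq => SmoothX2.dGamma.differentiableAt hq).congr fun q hq => ?_
  have := dGamma_pos hq
  field_simp

theorem tangentTo_rho : TangentTo rho V := by
  have h3 := tangentTo_dSigma hV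
  obtain ⟨-, h1, -, -, -⟩ := hV
  refine ((h1.mul h3 (fun q hq => SmoothX2.rho_div.differentiableAt hq)
    fun q hq => SmoothX2.dSigma.differentiableAt hq).mul h3
    (fun q hq => (SmoothX2.rho_div.mul SmoothX2.dSigma).differentiableAt hq)
    fun q hq => SmoothX2.dSigma.differentiableAt hq).congr fun q hq => ?_
  have := dSigma_pos q
  field_simp

/-- The functions ρ, x, d_Σ and d_Γ are products of powers of the boundary defining functions, so
each is multiplied by a smooth function under V; the same then holds for products of their real
powers. Hence multiplication by a weight only shifts orders. -/
theorem tangentTo_wt (μ : Order) : TangentTo (wt μ) V := by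
  have e1 := (tangentTo_rho hV).rpow (fun q hq => SmoothX2.rho.differentiableAt hq)
    (fun q _ => rho_pos q) (-μ.1)
  have e2 := (tangentTo_xb hV).rpow (fun q _ => differentiableAt_xb q)
    (fun q hq => hq) (-μ.2.1)
  have e3 := (tangentTo_dSigma hV).rpow (fun q hq => SmoothX2.dSigma.differentiableAt hq)
    (fun q _ => dSigma_pos q) (-μ.2.2.1)
  have e4 := hV.2.2.2.2.rpow (fun q hq => SmoothX2.dGamma.differentiableAt hq)
    (fun q hq => dGamma_pos hq) (-μ.2.2.2)
  have d1 : ∀ q ∈ scT d, DifferentiableAt ℝ (fun q : Phase d => rho q ^ (-μ.1)) q :=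
    fun q hq => (SmoothX2.rho.differentiableAt hq).rpow_const (Or.inl (rho_pos q).ne')
  have d2 : ∀ q ∈ scT d, DifferentiableAt ℝ (fun q : Phase d => xb q ^ (-μ.2.1)) q :=
    fun q hq => (differentiableAt_xb q).rpow_const (Or.inl (ne_of_gt hq))
  have d3 : ∀ q ∈ scT d, DifferentiableAt ℝ (fun q : Phase d => dSigma q ^ (-μ.2.2.1)) q :=
    fun q hq => (SmoothX2.dSigma.differentiableAt hq).rpow_const (Or.inl (dSigma_pos q).ne')
  have d4 : ∀ q ∈ scT d, DifferentiableAt ℝ (fun q : Phase d => dGamma q ^ (-μ.2.2.2)) q :=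
    fun q hq => (SmoothX2.dGamma.differentiableAt hq).rpow_const (Or.inl (dGamma_pos hq).ne')
  exact ((e1.mul e2 d1 d2).mul e3 (fun q hq => (d1 q hq).fun_mul (d2 q hq)) d3).mul e4
    (fun q hq => ((d1 q hq).fun_mul (d2 q hq)).fun_mul (d3 q hq)) d4

theorem exists_base_coeff (i : Fin (d + 2)) : ∃ c : Phase d → ℝ, SmoothX2 c ∧
    ∀ q ∈ scT d, (V q).1 i = c q * wt (-ord 1 (.inl i)) q := by
  have hi : ∀ q, act V (fun q => q.1 i) q = (V q).1 i := fun q => by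
    have h := ((ContinuousLinearMap.proj (R := ℝ) (φ := fun _ => ℝ) i).comp
      (ContinuousLinearMap.fst ℝ (Coord d) (Coord d))).fderiv (x := q)
    exact congrArg (fun L => L (V q)) h
  by_cases h0 : i = 0
  · subst h0
    obtain ⟨g, hg, h⟩ := tangentTo_xb hV
    refine ⟨g, hg, fun q hq => ?_⟩
    rw [wt_ord_base_zero, ← hi]
    exact h q hq
  · refine ⟨_, hV.1 _ (SmoothX2.base i), fun q hq => ?_⟩
    rw [wt_ord_base h0, hi, mul_one]

/-- By the product rule, ρ times the ζ_i component of V is V(ρζ_i) - (Vρ/ρ)ρζ_i. For i = 1 this is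
smooth. For the other indices ρζ_i = d_Σd_Γ·(τ̃_k/d_Γ), where V multiplies d_Σ and d_Γ by smooth
functions and maps τ̃_k/d_Γ to a smooth one, so a factor d_Σd_Γ splits off. -/
theorem exists_fib_coeff (i : Fin (d + 2)) : ∃ c : Phase d → ℝ, SmoothX2 c ∧
    ∀ q ∈ scT d, (V q).2 i = c q * wt (-ord 1 (.inr (.inl i))) q := by
  have hi : ∀ q, act V (fun q => q.2 i) q = (V q).2 i := fun q => by
    have h := ((ContinuousLinearMap.proj (R := ℝ) (φ := fun _ => ℝ) i).comp
      (ContinuousLinearMap.snd ℝ (Coord d) (Coord d))).fderiv (x := q)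
    exact congrArg (fun L => L (V q)) h
  obtain ⟨ar, sr, hr⟩ := tangentTo_rho hV
  obtain ⟨as, ss, hs⟩ := tangentTo_dSigma hV
  have hm : ∀ q ∈ scT d, act V (fun q => rho q * q.2 i) q =
      ar q * (rho q * q.2 i) + rho q * (V q).2 i := fun q hq => by
    rw [act_mul (SmoothX2.rho.differentiableAt hq) (by fun_prop), hr q hq, hi]
    ring
  obtain ⟨hS, -, -, -, ⟨ag, sg, hg⟩⟩ := hV
  by_cases h0 : i = 1
  · subst h0
    refine ⟨_, (hS _ (SmoothX2.rho_mul 1)).sub (sr.mul (SmoothX2.rho_mul 1)), fun q hq => ?_⟩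
    have := rho_pos q
    rw [wt_ord_fib_one, hm q hq]
    field_simp
    ring
  · obtain ⟨k, rfl⟩ := Fin.exists_succAbove_eq h0
    refine ⟨_, ((hS _ (SmoothX2.tauT_div k)).add (((ss.add sg).sub sr).mul
      (SmoothX2.tauT_div k))), fun q hq => ?_⟩
    have p1 := rho_pos q
    rw [wt_ord_fib h0]
    have e : EqOn (fun q : Phase d => rho q * q.2 ((1 : Fin (d + 2)).succAbove k))
        (fun q => dSigma q * dGamma q * (tauT q k / dGamma q)) (scT d) := fun q hq => by
      have := dGamma_pos hq
      have := dSigma_pos q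
      simp only [tauT, tau]
      field_simp
    have h5 := hm q hq
    have h6 := e hq
    beta_reduce at h6
    rw [act_congr isOpen_scT e hq, act_mul ((SmoothX2.dSigma.mul
      SmoothX2.dGamma).differentiableAt hq) ((SmoothX2.tauT_div k).differentiableAt hq),
      act_mul (SmoothX2.dSigma.differentiableAt hq) (SmoothX2.dGamma.differentiableAt hq),
      hs q hq, hg q hq, h6] at h5
    have h7 : rho q * (V q).2 ((1 : Fin (d + 2)).succAbove k) = dSigma q * dGamma q *
        (act V (fun q => tauT q k / dGamma q) q + (as q + ag q - ar q) *
          (tauT q k / dGamma q)) := by linear_combination -h5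
    rw [eq_comm, ← mul_right_inj' p1.ne', h7]
    field_simp

end Tangent

theorem zero_mem_V2 : (fun _ => 0) ∈ V2 d := by
  have h : ∀ b : Phase d → ℝ, TangentTo b (fun _ => 0) :=
    fun b => ⟨fun _ => 0, SmoothX2.const 0, fun q _ => by simp [act]⟩
  exact ⟨fun f _ => (SmoothX2.const 0).congr fun q _ => by simp [act], h _, h _, h _, h _⟩

theorem frame_mem : ∀ e : Dir d, frame e ∈ V2 d
  | .inl i => frame_base_mem i
  | .inr (.inl i) => frame_fib_mem i
  | .inr (.inr i) => by
    have : frame (.inr (.inr i) : Dir d) = fun _ => 0 := by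
      ext1 q
      simp [frame, vecP]
    rw [this]
    exact zero_mem_V2

end BBCalculus
end

/-! ### Symbol classes described by weighted coordinate derivatives. -/

noncomputable section
namespace BBCalculus
open MeasureTheory Topology Set

variable {d : ℕ}

/-! ### Amplitudes -/

/-- The bound of an amplitude of order `μ`, with decay `D` in `(X,Y)`. -/
def Bd (D : Coord d → ℝ) (μ : Order) (c : FullPhase d → ℂ) : Prop :=
  ∀ B : Set (Coord d), IsCompact B → ∃ C : ℝ, 0 ≤ C ∧
    ∀ w ∈ scTFull d, w.1.1 ∈ B → ‖c w‖ ≤ C * wt μ w.1 * D w.2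

/-- The bounds for the coordinate derivatives of order at most `n`. -/
def Est (o : ℝ) (D : Coord d → ℝ) : ℕ → Order → (FullPhase d → ℂ) → Prop
  | 0, μ, c => Bd D μ c
  | n + 1, μ, c => Bd D μ c ∧ ∀ e, Est o D n (μ + ord o e) (pd c e)

/-- Amplitudes of order `μ`, with decay `D` in `(X,Y)` and a gain of `x ^ o` for every
`(X,Y)` derivative. -/
structure IsAmp (o : ℝ) (D : Coord d → ℝ) (μ : Order) (c : FullPhase d → ℂ) : Prop where
  smooth : ContDiffOn ℝ ∞ c (scTFull d)
  est : ∀ n, Est o D n μ c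

section Pd

variable {c g : FullPhase d → ℂ} {w : FullPhase d}

theorem contDiffOn_pd (hc : ContDiffOn ℝ ∞ c (scTFull d)) (e : Dir d) :
    ContDiffOn ℝ ∞ (pd c e) (scTFull d) :=
  contDiffOn_act isOpen_scTFull hc contDiffOn_const

theorem pd_congr (h : EqOn c g (scTFull d)) (e : Dir d) : EqOn (pd c e) (pd g e) (scTFull d) :=
  fun _ hw => act_congr isOpen_scTFull h hw

theorem _root_.ContDiffOn.differentiableAt_scTFull (hc : ContDiffOn ℝ ∞ c (scTFull d))
    (hw : w ∈ scTFull d) : DifferentiableAt ℝ c w :=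
  hc.differentiableAt_of_isOpen isOpen_scTFull hw

theorem pd_add (hc : ContDiffOn ℝ ∞ c (scTFull d)) (hg : ContDiffOn ℝ ∞ g (scTFull d))
    (e : Dir d) : EqOn (pd (fun w => c w + g w) e) (fun w => pd c e w + pd g e w) (scTFull d) :=
  fun _ hw => act_add (hc.differentiableAt_scTFull hw) (hg.differentiableAt_scTFull hw)

theorem pd_mul (hc : ContDiffOn ℝ ∞ c (scTFull d)) (hg : ContDiffOn ℝ ∞ g (scTFull d))
    (e : Dir d) : EqOn (pd (fun w => c w * g w) e)
      (fun w => pd c e w * g w + c w * pd g e w) (scTFull d) :=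
  fun _ hw => act_mul (hc.differentiableAt_scTFull hw) (hg.differentiableAt_scTFull hw)

end Pd

section Est

variable {o : ℝ} {D D' : Coord d → ℝ} {μ ν : Order} {c g : FullPhase d → ℂ} {n : ℕ}

theorem Bd.congr (hc : Bd D μ c) (h : EqOn g c (scTFull d)) : Bd D μ g := fun B hB => by
  obtain ⟨C, hC, H⟩ := hc B hB
  exact ⟨C, hC, fun w hw hwB => by rw [h hw]; exact H w hw hwB⟩

theorem Bd.add (hc : Bd D μ c) (hg : Bd D μ g) : Bd D μ (fun w => c w + g w) := fun B hB => by
  obtain ⟨C, hC, H⟩ := hc B hB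
  obtain ⟨C', hC', H'⟩ := hg B hB
  refine ⟨C + C', by positivity, fun w hw hwB => (norm_add_le _ _).trans ?_⟩
  rw [add_mul, add_mul]
  exact add_le_add (H w hw hwB) (H' w hw hwB)

theorem Bd.mul (hc : Bd D μ c) (hg : Bd D' ν g) :
    Bd (fun Z => D Z * D' Z) (μ + ν) (fun w => c w * g w) := fun B hB => by
  obtain ⟨C, hC, H⟩ := hc B hB
  obtain ⟨C', hC', H'⟩ := hg B hB
  refine ⟨C * C', by positivity, fun w hw hwB => ?_⟩
  have h1 := H w hw hwB
  have h2 := H' w hw hwB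
  rw [norm_mul, wt_add _ _ hw]
  calc _ ≤ (C * wt μ w.1 * D w.2) * (C' * wt ν w.1 * D' w.2) :=
        mul_le_mul h1 h2 (norm_nonneg _) ((norm_nonneg _).trans h1)
    _ = _ := by ring

/-- A comparison of the weights of two classes. -/
def WtLe (D D' : Coord d → ℝ) (μ ν : Order) : Prop :=
  (∀ B : Set (Coord d), IsCompact B → ∃ C : ℝ, 0 ≤ C ∧ ∀ w ∈ scTFull d, w.1.1 ∈ B →
    wt μ w.1 * D w.2 ≤ C * (wt ν w.1 * D' w.2))

theorem Bd.mono (hc : Bd D μ c) (h : WtLe D D' μ ν) : Bd D' ν c := fun B hB => by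
  obtain ⟨C, hC, H⟩ := hc B hB
  obtain ⟨C', hC', H'⟩ := h B hB
  refine ⟨C * C', by positivity, fun w hw hwB => (H w hw hwB).trans ?_⟩
  have := mul_le_mul_of_nonneg_left (H' w hw hwB) hC
  linarith

theorem Est.congr (hc : Est o D n μ c) (h : EqOn g c (scTFull d)) : Est o D n μ g := by
  induction n generalizing μ c g with
  | zero => exact Bd.congr hc h
  | succ n ih => exact ⟨hc.1.congr h, fun e => ih (hc.2 e) (pd_congr h e)⟩

theorem Est.of_succ (hc : Est o D (n + 1) μ c) : Est o D n μ c := by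
  induction n generalizing μ c with
  | zero => exact hc.1
  | succ n ih => exact ⟨hc.1, fun e => ih (hc.2 e)⟩

theorem Est.add (hc : Est o D n μ c) (hg : Est o D n μ g) (sc : ContDiffOn ℝ ∞ c (scTFull d))
    (sg : ContDiffOn ℝ ∞ g (scTFull d)) : Est o D n μ (fun w => c w + g w) := by
  induction n generalizing μ c g with
  | zero => exact Bd.add hc hg
  | succ n ih =>
    exact ⟨hc.1.add hg.1, fun e => (ih (hc.2 e) (hg.2 e) (contDiffOn_pd sc e)
      (contDiffOn_pd sg e)).congr (pd_add sc sg e)⟩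

theorem Est.mul (hc : Est o D n μ c) (hg : Est o D' n ν g) (sc : ContDiffOn ℝ ∞ c (scTFull d))
    (sg : ContDiffOn ℝ ∞ g (scTFull d)) :
    Est o (fun Z => D Z * D' Z) n (μ + ν) (fun w => c w * g w) := by
  induction n generalizing μ ν c g with
  | zero => exact Bd.mul hc hg
  | succ n ih =>
    refine ⟨hc.1.mul hg.1, fun e => ?_⟩
    have sc' := contDiffOn_pd sc e
    have sg' := contDiffOn_pd sg e
    have h1 := ih (hc.2 e) hg.of_succ sc' sg
    have h2 := ih hc.of_succ (hg.2 e) sc sg'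
    rw [show μ + ord o e + ν = μ + ν + ord o e by abel] at h1
    rw [← add_assoc] at h2
    exact (h1.add h2 (sc'.mul sg) (sc.mul sg')).congr (pd_mul sc sg e)

end Est

namespace IsAmp

variable {o o' : ℝ} {D D' : Coord d → ℝ} {μ ν : Order} {c g : FullPhase d → ℂ}

theorem bd (hc : IsAmp o D μ c) : Bd D μ c := hc.est 0

theorem congr (hc : IsAmp o D μ c) (h : EqOn g c (scTFull d)) : IsAmp o D μ g :=
  ⟨hc.smooth.congr h, fun n => (hc.est n).congr h⟩

theorem add (hc : IsAmp o D μ c) (hg : IsAmp o D μ g) : IsAmp o D μ (fun w => c w + g w) :=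
  ⟨hc.smooth.add hg.smooth, fun n => (hc.est n).add (hg.est n) hc.smooth hg.smooth⟩

theorem mul (hc : IsAmp o D μ c) (hg : IsAmp o D' ν g) :
    IsAmp o (fun Z => D Z * D' Z) (μ + ν) (fun w => c w * g w) :=
  ⟨hc.smooth.mul hg.smooth, fun n => (hc.est n).mul (hg.est n) hc.smooth hg.smooth⟩

theorem pd (hc : IsAmp o D μ c) (e : Dir d) : IsAmp o D (μ + ord o e) (pd c e) :=
  ⟨contDiffOn_pd hc.smooth e, fun n => (hc.est (n + 1)).2 e⟩

theorem differentiableAt (hc : IsAmp o D μ c) {w : FullPhase d} (hw : w ∈ scTFull d) :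
    DifferentiableAt ℝ c w := hc.smooth.differentiableAt_scTFull hw

/-- A class of smooth functions with the right bounds which is stable under differentiation, up
to the right orders, consists of amplitudes. -/
theorem of_stable (P : Order → (FullPhase d → ℂ) → Prop)
    (hs : ∀ μ c, P μ c → ContDiffOn ℝ ∞ c (scTFull d)) (hb : ∀ μ c, P μ c → Bd D μ c)
    (hd : ∀ μ c, P μ c → ∀ e, ∃ g, P (μ + ord o e) g ∧ EqOn (BBCalculus.pd c e) g (scTFull d))
    (hc : P μ c) : IsAmp o D μ c := by
  refine ⟨hs _ _ hc, fun n => ?_⟩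
  induction n generalizing μ c with
  | zero => exact hb _ _ hc
  | succ n ih =>
    refine ⟨hb _ _ hc, fun e => ?_⟩
    obtain ⟨g, hg, h⟩ := hd _ _ hc e
    exact (ih hg).congr h

theorem _root_.BBCalculus.WtLe.add_right (h : WtLe D D' μ ν) (κ : Order) :
    WtLe D D' (μ + κ) (ν + κ) := fun B hB => by
  obtain ⟨C, hC, H⟩ := h B hB
  refine ⟨C, hC, fun w hw hwB => ?_⟩
  rw [wt_add _ _ hw, wt_add _ _ hw]
  have := mul_le_mul_of_nonneg_right (H w hw hwB) (wt_pos κ hw).le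
  linarith

/-- A derivative shifts both orders by the same κ, and a common factor of weight does not affect the
comparison; so the comparison at the top order covers all derivatives. -/
theorem mono (hc : IsAmp o D μ c) (h : WtLe D D' μ ν) : IsAmp o D' ν c := by
  refine of_stable (fun ν' c => ∃ μ', IsAmp o D μ' c ∧ ∃ κ, μ' = μ + κ ∧ ν' = ν + κ)
    (fun _ c ⟨_, h, _⟩ => h.smooth) ?_ ?_ ⟨μ, hc, 0, by simp, by simp⟩
  · rintro _ c ⟨_, hc, κ, rfl, rfl⟩
    exact hc.bd.mono (h.add_right κ)
  · rintro _ c ⟨_, hc, κ, rfl, rfl⟩ e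
    exact ⟨_, ⟨_, hc.pd e, κ + ord o e, by abel, by abel⟩, fun _ _ => rfl⟩

theorem zero : IsAmp o D μ (fun _ => 0) := by
  refine of_stable (fun _ c => c = fun _ => 0) ?_ ?_ ?_ rfl
  · rintro _ _ rfl
    exact contDiffOn_const
  · rintro _ _ rfl B -
    exact ⟨0, le_rfl, fun w _ _ => by simp⟩
  · rintro _ _ rfl e
    exact ⟨_, rfl, fun w _ => act_const 0⟩

theorem const (z : ℂ) : IsAmp o (fun _ : Coord d => 1) 0 (fun _ => z) := by
  refine ⟨contDiffOn_const, fun n => ?_⟩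
  have hb : Bd (fun _ : Coord d => 1) 0 (fun _ => z) := fun B _ =>
    ⟨‖z‖, norm_nonneg _, fun w _ _ => by simp [wt_zero]⟩
  cases n with
  | zero => exact hb
  | succ n => exact ⟨hb, fun e => (IsAmp.zero.est n).congr fun w _ => act_const z⟩

theorem const_mul (hc : IsAmp o D μ c) (z : ℂ) : IsAmp o D μ (fun w => z * c w) := by
  simpa using (const z).mul hc

theorem sum {ι : Type*} {c : ι → FullPhase d → ℂ} {s : Finset ι}
    (hc : ∀ i ∈ s, IsAmp o D μ (c i)) : IsAmp o D μ (fun w => ∑ i ∈ s, c i w) := by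
  classical
  induction s using Finset.induction_on with
  | empty => simpa using zero
  | insert i s hi ih =>
    simp only [Finset.sum_insert hi]
    exact (hc i (by simp)).add (ih fun j hj => hc j (by simp [hj]))

end IsAmp

/-! ### Smooth functions on `𝒳₂` and weights are amplitudes -/

theorem rho_le_one (q : Phase d) : rho q ≤ 1 := by
  have : 0 ≤ ∑ i, q.2 i ^ 2 := Finset.sum_nonneg fun i _ => sq_nonneg _
  exact inv_le_one_of_one_le₀ (Real.one_le_sqrt.2 (by linarith))

theorem abs_rho_mul_le_one (q : Phase d) (i : Fin (d + 2)) : |rho q * q.2 i| ≤ 1 := by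
  have h0 : 0 ≤ ∑ i, q.2 i ^ 2 := Finset.sum_nonneg fun i _ => sq_nonneg _
  have h1 : q.2 i ^ 2 ≤ ∑ i, q.2 i ^ 2 :=
    Finset.single_le_sum (f := fun i => q.2 i ^ 2) (fun i _ => sq_nonneg _) (Finset.mem_univ i)
  rw [abs_mul, abs_of_pos (rho_pos q), rho, inv_mul_le_one₀ (Real.sqrt_pos.2 (by linarith))]
  exact Real.abs_le_sqrt (by linarith)

theorem rho_le_dSigma_sq (q : Phase d) : rho q ≤ dSigma q ^ 2 := by
  rw [dSigma_sq]
  have : 0 ≤ ∑ i, tau q i ^ 2 := Finset.sum_nonneg fun i _ => sq_nonneg _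
  linarith

theorem abs_tauT_le_one (q : Phase d) (i : Fin (d + 1)) : |tauT q i| ≤ 1 := by
  rw [tauT, abs_div, abs_of_pos (dSigma_pos q), div_le_one (dSigma_pos q)]
  refine Real.abs_le_sqrt ?_
  have h1 : tau q i ^ 2 ≤ ∑ i, tau q i ^ 2 :=
    Finset.single_le_sum (f := fun i => tau q i ^ 2) (fun i _ => sq_nonneg _) (Finset.mem_univ i)
  have := rho_pos q
  linarith

theorem dSigma_sq_le (q : Phase d) : dSigma q ^ 2 ≤ d + 2 := by
  rw [dSigma_sq]
  have h : ∑ i, tau q i ^ 2 ≤ ∑ _i : Fin (d + 1), (1 : ℝ) :=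
    Finset.sum_le_sum fun i _ => (sq_le_one_iff_abs_le_one _).2 (abs_rho_mul_le_one q _)
  simp at h
  have := rho_le_one q
  linarith

theorem dSigma_le_dGamma {q : Phase d} (hq : q ∈ scT d) : dSigma q ≤ dGamma q := by
  refine Real.le_sqrt_of_sq_le ?_
  have : 0 < xb q := hq
  have : 0 ≤ ∑ i, tauT q i ^ 2 := Finset.sum_nonneg fun i _ => sq_nonneg _
  linarith

theorem xb_le_dGamma_sq {q : Phase d} (hq : q ∈ scT d) : xb q ≤ dGamma q ^ 2 := by
  rw [dGamma_sq hq]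
  have : 0 ≤ ∑ i, tauT q i ^ 2 := Finset.sum_nonneg fun i _ => sq_nonneg _
  have := sq_nonneg (dSigma q)
  linarith

theorem abs_tauT_le_dGamma {q : Phase d} (hq : q ∈ scT d) (i : Fin (d + 1)) :
    |tauT q i| ≤ dGamma q := by
  refine Real.abs_le_sqrt ?_
  have h1 : tauT q i ^ 2 ≤ ∑ i, tauT q i ^ 2 :=
    Finset.single_le_sum (f := fun i => tauT q i ^ 2) (fun i _ => sq_nonneg _) (Finset.mem_univ i)
  have : 0 < xb q := hq
  have := sq_nonneg (dSigma q)
  linarith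

theorem dGamma_sq_le {q : Phase d} (hq : q ∈ scT d) : dGamma q ^ 2 ≤ xb q + (2 * d + 3) := by
  rw [dGamma_sq hq]
  have h : ∑ i, tauT q i ^ 2 ≤ ∑ _i : Fin (d + 1), (1 : ℝ) :=
    Finset.sum_le_sum fun i _ => (sq_le_one_iff_abs_le_one _).2 (abs_tauT_le_one q _)
  simp at h
  have := dSigma_sq_le q
  linarith

theorem exists_xb_le {B : Set (Coord d)} (hB : IsCompact B) :
    ∃ R : ℝ, 1 ≤ R ∧ ∀ q : Phase d, q.1 ∈ B → xb q ≤ R := by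
  obtain ⟨R, hR⟩ := hB.exists_bound_of_continuousOn (f := fun p : Coord d => p 0) (by fun_prop)
  exact ⟨max R 1, le_max_right _ _, fun q hq => (le_abs_self _).trans
    ((hR _ hq).trans (le_max_left _ _))⟩

theorem le_of_sq_le {a R : ℝ} (h : a ^ 2 ≤ R) : a ≤ R + 1 := by
  nlinarith [sq_nonneg (a - 1)]

/-- The part of 𝒳₂ over a compact set of base points is compact: the embedding maps it into a
product of B with bounded intervals, and a continuous function is bounded there. The bound holds up
to x = 0 and uniformly in the fibre. -/
theorem exists_bound_of_smoothX2 {s : Phase d → ℝ} (hs : SmoothX2 s) {B : Set (Coord d)}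
    (hB : IsCompact B) : ∃ C : ℝ, 0 ≤ C ∧ ∀ q ∈ scT d, q.1 ∈ B → |s q| ≤ C := by
  obtain ⟨F, hF, hs⟩ := hs
  obtain ⟨R, -, hR⟩ := exists_xb_le hB
  have hI : ∀ n, IsCompact (Set.univ.pi fun _ : Fin n => Icc (-1 : ℝ) 1) :=
    fun n => isCompact_univ_pi fun _ => isCompact_Icc
  have hK : IsCompact ((B ×ˢ Icc (0 : ℝ) 1 ×ˢ Set.univ.pi fun _ : Fin (d + 2) => Icc (-1 : ℝ) 1) ×ˢ
      (Icc (0 : ℝ) (d + 2 + 1) ×ˢ Icc (0 : ℝ) 1 ×ˢ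
        Set.univ.pi fun _ : Fin (d + 1) => Icc (-1 : ℝ) 1) ×ˢ
      (Icc (0 : ℝ) (R + (2 * d + 3) + 1) ×ˢ Icc (0 : ℝ) 1 ×ˢ Icc (0 : ℝ) 1 ×ˢ
        Set.univ.pi fun _ : Fin (d + 1) => Icc (-1 : ℝ) 1)) :=
    (hB.prod (isCompact_Icc.prod (hI _))).prod ((isCompact_Icc.prod (isCompact_Icc.prod
      (hI _))).prod (isCompact_Icc.prod (isCompact_Icc.prod (isCompact_Icc.prod (hI _)))))
  obtain ⟨C, hC⟩ := hK.exists_bound_of_continuousOn hF.continuous.continuousOn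
  refine ⟨max C 0, le_max_right _ _, fun q hq hqB => ?_⟩
  rw [hs q hq]
  refine (hC _ ?_).trans (le_max_left _ _)
  have h1 := rho_pos q
  have h2 := dSigma_pos q
  have h3 := dGamma_pos hq
  have h4 : 0 < xb q := hq
  refine ⟨⟨hqB, ⟨h1.le, rho_le_one q⟩, fun i _ => abs_le.1 (abs_rho_mul_le_one q i)⟩,
    ⟨⟨h2.le, le_of_sq_le (dSigma_sq_le q)⟩, ⟨(by positivity : 0 ≤ rho q / dSigma q ^ 2),
      (div_le_one (by positivity)).2 (rho_le_dSigma_sq q)⟩,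
      fun i _ => abs_le.1 (abs_tauT_le_one q i)⟩, ⟨h3.le, le_of_sq_le ?_⟩,
    ⟨(by positivity : 0 ≤ xb q / dGamma q ^ 2),
      (div_le_one (by positivity)).2 (xb_le_dGamma_sq hq)⟩,
    ⟨(by positivity : 0 ≤ dSigma q / dGamma q), (div_le_one h3).2 (dSigma_le_dGamma hq)⟩,
    fun i _ => abs_le.1 ?_⟩
  · have := dGamma_sq_le hq
    have := hR q hqB
    change dGamma q ^ 2 ≤ _
    linarith
  · change |tauT q i / dGamma q| ≤ 1
    rw [abs_div, abs_of_pos h3, div_le_one h3]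
    exact abs_tauT_le_dGamma hq i

theorem vec_fst (e : Dir d) : (vec e).1 = vecP e := by
  rcases e with i | i | i <;> rfl

theorem act_vecP_eq (o : ℝ) (e : Dir d) (s : Phase d → ℝ) {q : Phase d} (hq : q ∈ scT d) :
    act (fun _ => vecP e) s q = wt (ord o e) q * act (frame e) s q := by
  unfold frame
  rw [act_smul_vec]
  have h : ∀ e : Dir d, (∀ o, ord o e = ord 1 e) → act (fun _ => vecP e) s q =
      wt (ord o e) q * (wt (-ord 1 e) q * act (fun _ => vecP e) s q) := fun e h => by
    rw [h, wt_neg _ hq, mul_inv_cancel_left₀ (wt_pos _ hq).ne']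
  rcases e with i | i | i
  · exact h _ fun _ => rfl
  · exact h _ fun _ => rfl
  · simp [act, vecP]

theorem pd_ofReal_comp {s : Phase d → ℝ} {w : FullPhase d} (hs : DifferentiableAt ℝ s w.1)
    (e : Dir d) : pd (fun w => ((s w.1 : ℝ) : ℂ)) e w = ((act (fun _ => vecP e) s w.1 : ℝ) : ℂ) := by
  have h := hs.hasFDerivAt.comp w
    (ContinuousLinearMap.fst ℝ (Phase d) (Coord d)).hasFDerivAt
  rw [pd, act_ofReal (f := fun w : FullPhase d => s w.1) h.differentiableAt]
  have h' : fderiv ℝ (fun w : FullPhase d => s w.1) w = _ := h.fderiv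
  simp only [act, h', ContinuousLinearMap.comp_apply, ContinuousLinearMap.coe_fst', vec_fst]

theorem contDiffOn_ofReal_comp {s : Phase d → ℝ} (hs : ContDiffOn ℝ ∞ s (scT d)) :
    ContDiffOn ℝ ∞ (fun w : FullPhase d => ((s w.1 : ℝ) : ℂ)) (scTFull d) :=
  Complex.ofRealCLM.contDiff.comp_contDiffOn
    (hs.comp contDiff_fst.contDiffOn fun _ hw => hw)

/-- A coordinate derivative is a weight times a frame field V, and V(s·wt) = (Vs + s·g)·wt with g
the smooth logarithmic derivative of the weight. So functions of this shape are stable under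
differentiation. -/
theorem isAmp_smooth_mul_wt (o : ℝ) {s : Phase d → ℝ} (hs : SmoothX2 s) (μ : Order) :
    IsAmp o (fun _ => 1) μ (fun w => ((s w.1 * wt μ w.1 : ℝ) : ℂ)) := by
  refine IsAmp.of_stable (fun μ c => ∃ s, SmoothX2 s ∧
    c = fun w : FullPhase d => ((s w.1 * wt μ w.1 : ℝ) : ℂ)) ?_ ?_ ?_ ⟨s, hs, rfl⟩
  · rintro μ _ ⟨s, hs, rfl⟩
    exact contDiffOn_ofReal_comp (hs.contDiffOn.mul (contDiffOn_wt μ))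
  · rintro μ _ ⟨s, hs, rfl⟩ B hB
    obtain ⟨C, hC, H⟩ := exists_bound_of_smoothX2 hs hB
    refine ⟨C, hC, fun w hw hwB => ?_⟩
    rw [Complex.norm_real, norm_mul, Real.norm_of_nonneg (wt_pos μ hw).le, mul_one]
    exact mul_le_mul_of_nonneg_right (H _ hw hwB) (wt_pos μ hw).le
  · rintro μ _ ⟨s, hs, rfl⟩ e
    obtain ⟨g, hg, h⟩ := tangentTo_wt (frame_mem e) μ
    refine ⟨_, ⟨_, ((frame_mem e).1 s hs).add (hs.mul hg), rfl⟩, fun w hw => ?_⟩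
    have d1 := hs.differentiableAt hw
    have d2 : DifferentiableAt ℝ (wt μ) w.1 :=
      (contDiffOn_wt μ).differentiableAt_of_isOpen isOpen_scT hw
    rw [pd_ofReal_comp (s := fun q => s q * wt μ q) (d1.mul d2), act_vecP_eq o e _ hw,
      act_mul d1 d2, h _ hw, wt_add _ _ hw]
    congr 1
    ring

theorem isAmp_wt (o : ℝ) (μ : Order) :
    IsAmp o (fun _ : Coord d => 1) μ (fun w => ((wt μ w.1 : ℝ) : ℂ)) := by
  simpa using isAmp_smooth_mul_wt o (SmoothX2.const 1) μ

/-! ### Symbols are amplitudes -/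

theorem IsAmp.wt_mul {o : ℝ} {D : Coord d → ℝ} {ν : Order} {c : FullPhase d → ℂ}
    (hc : IsAmp o D ν c) (μ : Order) :
    IsAmp o D (μ + ν) (fun w => ((wt μ w.1 : ℝ) : ℂ) * c w) := by
  simpa using (isAmp_wt o μ).mul hc

/-- The frame of the test vector fields for full symbols. -/
def frameFull (e : Dir d) (w : FullPhase d) : FullPhase d := wt (-ord 1 e) w.1 • vec e

theorem frameFull_mem (e : Dir d) : frameFull e ∈ VFull d := by
  rcases e with i | i | i
  · refine Or.inl ⟨_, frame_mem (.inl i), funext fun w => ?_⟩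
    simp [frameFull, frame, vec, vecP]
  · refine Or.inl ⟨_, frame_mem (.inr (.inl i)), funext fun w => ?_⟩
    simp [frameFull, frame, vec, vecP]
  · refine Or.inr ⟨i, funext fun w => ?_⟩
    simp only [frameFull, vec, wt_ord_pos]
    refine Prod.ext (by simp) ?_
    ext k
    simp [Pi.single_apply]

theorem pd_eq_frameFull (c : FullPhase d → ℂ) (e : Dir d) {w : FullPhase d} (hw : w ∈ scTFull d) :
    pd c e w = ((wt (ord 1 e) w.1 : ℝ) : ℂ) * act (frameFull e) c w := by
  have h := (wt_pos (ord 1 e) hw).ne'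
  simp only [pd, act, frameFull, map_smul, Complex.real_smul, wt_neg _ hw, Complex.ofReal_inv]
  rw [mul_inv_cancel_left₀ (by exact_mod_cast h)]

theorem act_mem_fullSymbolZero {b : FullPhase d → ℂ} (hb : b ∈ FullSymbolZero d) (e : Dir d) :
    act (frameFull e) b ∈ FullSymbolZero d := by
  refine ⟨contDiffOn_act isOpen_scTFull hb.1 ?_, fun Vs hVs B hB => ?_⟩
  · exact ((contDiffOn_wt _).comp contDiff_fst.contDiffOn fun _ hw => hw).smul contDiffOn_const
  · obtain ⟨C, hC⟩ := hb.2 (Vs ++ [frameFull e]) (by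
      intro V hV
      rcases List.mem_append.1 hV with h | h
      · exact hVs V h
      · rw [List.mem_singleton.1 h]
        exact frameFull_mem e) B hB
    exact ⟨C, by simpa using hC⟩

/-- Frame fields preserve the class, and ∂_e is a weight of order `ord 1 e` times a frame field. The
product rule for estimates then closes the induction. -/
theorem isAmp_of_mem_fullSymbolZero {b : FullPhase d → ℂ} (hb : b ∈ FullSymbolZero d) :
    IsAmp 1 (fun _ => 1) 0 b := by
  refine ⟨hb.1, fun n => ?_⟩
  have h0 : ∀ b ∈ FullSymbolZero d, Bd (fun _ => 1) 0 b := fun b hb B hB => by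
    obtain ⟨C, hC⟩ := hb.2 [] (by simp) B hB
    refine ⟨max C 0, le_max_right _ _, fun w hw hwB => ?_⟩
    rw [wt_zero, mul_one, mul_one]
    exact (hC w hw hwB).trans (le_max_left _ _)
  induction n generalizing b with
  | zero => exact h0 b hb
  | succ n ih =>
    refine ⟨h0 b hb, fun e => ?_⟩
    have h1 := act_mem_fullSymbolZero hb e
    have h2 := ((isAmp_wt 1 (ord 1 e)).est n).mul (ih h1) (isAmp_wt 1 _).smooth h1.1
    rw [zero_add]
    simp only [add_zero, mul_one] at h2
    exact h2.congr fun w hw => pd_eq_frameFull b e hw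

theorem isAmp_of_mem_fullSymbol {m l k j : ℝ} {b : FullPhase d → ℂ}
    (hb : b ∈ FullSymbol d m l k j) : IsAmp 1 (fun _ => 1) (m, l, k, j) b := by
  obtain ⟨b', hb', h⟩ := hb
  have := (isAmp_of_mem_fullSymbolZero hb').wt_mul (m, l, k, j)
  rw [add_zero] at this
  exact this.congr h

/-- Expanding V in the frame writes Vf as a sum of terms s·wt(-ord)·∂f with s smooth; the weight
cancels the order of ∂f. This is where generation of 𝒱₂ by the frame is needed, since the symbol
classes test against all of 𝒱₂. -/
theorem IsAmp.act_V2 {f : Phase d → ℂ} (hf : IsAmp 1 (fun _ => 1) 0 (constInZ f))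
    {V : Phase d → Phase d} (hV : V ∈ V2 d) :
    IsAmp 1 (fun _ => 1) 0 (constInZ (act V f)) := by
  choose c1 s1 h1 using exists_base_coeff hV
  choose c2 s2 h2 using exists_fib_coeff hV
  have key : ∀ (e : Dir d) {c : Phase d → ℝ}, SmoothX2 c → IsAmp 1 (fun _ => 1) 0 (fun w =>
      ((c w.1 * wt (-ord 1 e) w.1 : ℝ) : ℂ) * BBCalculus.pd (constInZ f) e w) := fun e c hc => by
    have := (isAmp_smooth_mul_wt 1 hc (-ord 1 e)).mul (hf.pd e)
    simpa using this
  have hs := (IsAmp.sum (s := Finset.univ) fun i _ => key (.inl i) (s1 i)).add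
    (IsAmp.sum (s := Finset.univ) fun i _ => key (.inr (.inl i)) (s2 i))
  refine hs.congr fun w hw => ?_
  have hd : DifferentiableAt ℝ f w.1 := by
    have : DifferentiableAt ℝ (constInZ f) ((w.1, 0) : FullPhase d) := hf.differentiableAt hw
    exact DifferentiableAt.comp (f := fun q : Phase d => ((q, 0) : FullPhase d)) w.1 this
      (by fun_prop)
  have hp : ∀ e, BBCalculus.pd (constInZ f) e w = fderiv ℝ f w.1 (vecP e) := fun e => by
    have h := (hd.hasFDerivAt.comp w
      (ContinuousLinearMap.fst ℝ (Phase d) (Coord d)).hasFDerivAt).fderiv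
    have h' : fderiv ℝ (constInZ f) w = _ := h
    simp only [BBCalculus.pd, act, h', ContinuousLinearMap.comp_apply,
      ContinuousLinearMap.coe_fst', vec_fst]
  simp only [constInZ] at hp ⊢
  simp only [act, hp]
  conv_lhs => rw [← sum_vecP (V w.1)]
  simp only [map_add, map_sum, map_smul, Complex.real_smul, h1 _ _ hw, h2 _ _ hw]

theorem mem_symbol_of_isAmp {m l k j : ℝ} {a : Phase d → ℂ}
    (ha : IsAmp 1 (fun _ => 1) (m, l, k, j) (constInZ a)) : a ∈ Symbol d m l k j := by
  set f : Phase d → ℂ := fun q => ((wt (-(m, l, k, j)) q : ℝ) : ℂ) * a q with hf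
  have h0 : IsAmp 1 (fun _ => 1) 0 (constInZ f) := by
    have := ha.wt_mul (-(m, l, k, j))
    rw [neg_add_cancel] at this
    exact this
  refine ⟨f, ⟨?_, fun Vs hVs B hB => ?_⟩, fun q hq => ?_⟩
  · exact h0.smooth.comp (g := constInZ f) (f := fun q : Phase d => ((q, 0) : FullPhase d))
      (by fun_prop) fun q hq => hq
  · have h1 : IsAmp 1 (fun _ => 1) 0 (constInZ (Vs.foldr act f)) := by
      induction Vs with
      | nil => exact h0
      | cons V Vs ih =>
        exact (ih fun V hV => hVs V (List.mem_cons_of_mem _ hV)).act_V2 (hVs V (by simp))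
    obtain ⟨C, -, hC⟩ := h1.bd B hB
    refine ⟨C, fun q hq hqB => ?_⟩
    have := hC (q, 0) hq hqB
    simpa [wt_zero, constInZ] using this
  · have h := wt_pos (m, l, k, j) hq
    rw [hf]
    beta_reduce
    rw [wt_neg _ hq, Complex.ofReal_inv]
    change a q = ((wt (m, l, k, j) q : ℝ) : ℂ) * _
    rw [mul_inv_cancel_left₀ (by exact_mod_cast h.ne')]

end BBCalculus
end

/-! ### Translation estimates for the weights and inclusions between orders. -/

noncomputable section
namespace BBCalculus
open MeasureTheory Topology Set

variable {d : ℕ}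

/-! ### The weights are temperate in the fibre -/

/-- Polynomial control of the translates of `G` in the fibre by `F`. -/
def TempLe (G F : Phase d → ℝ) : Prop :=
  ∃ C : ℝ, 1 ≤ C ∧ ∃ k : ℕ, ∀ q ∈ scT d, ∀ θ : Coord d,
    G (q.1, q.2 + θ) ≤ C * (1 + ‖θ‖) ^ k * F q

/-- Polynomial control of a function under translations in the fibre. -/
abbrev Temperate (F : Phase d → ℝ) : Prop := TempLe F F

theorem TempLe.mul {F G F' G' : Phase d → ℝ} (hF : TempLe F F') (hG : TempLe G G')
    (h0 : ∀ q ∈ scT d, 0 ≤ F' q) (h1 : ∀ q ∈ scT d, 0 ≤ G q) :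
    TempLe (fun q => F q * G q) (fun q => F' q * G' q) := by
  obtain ⟨C, hC, k, hF⟩ := hF
  obtain ⟨C', hC', k', hG⟩ := hG
  refine ⟨C * C', one_le_mul_of_one_le_of_one_le hC hC', k + k', fun q hq θ => ?_⟩
  have hq' : (q.1, q.2 + θ) ∈ scT d := hq
  have h2 := h0 q hq
  calc _ ≤ (C * (1 + ‖θ‖) ^ k * F' q) * (C' * (1 + ‖θ‖) ^ k' * G' q) :=
        mul_le_mul (hF q hq θ) (hG q hq θ) (h1 _ hq') (by positivity)
    _ = _ := by ring

theorem TempLe.mono {F G F' : Phase d → ℝ} (hG : TempLe G F) {A : ℝ} (hA : 1 ≤ A)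
    (h : ∀ q ∈ scT d, F q ≤ A * F' q) : TempLe G F' := by
  obtain ⟨C, hC, k, hG⟩ := hG
  refine ⟨C * A, one_le_mul_of_one_le_of_one_le hC hA, k, fun q hq θ => (hG q hq θ).trans ?_⟩
  have := mul_le_mul_of_nonneg_left (h q hq) (by positivity : 0 ≤ C * (1 + ‖θ‖) ^ k)
  linarith

theorem TempLe.add {F G G' : Phase d → ℝ} (hG : TempLe G F) (hG' : TempLe G' F)
    (h0 : ∀ q ∈ scT d, 0 ≤ F q) : TempLe (fun q => G q + G' q) F := by
  obtain ⟨C, hC, k, hG⟩ := hG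
  obtain ⟨C', hC', k', hG'⟩ := hG'
  refine ⟨C + C', by linarith, max k k', fun q hq θ => ?_⟩
  have hN : 1 ≤ 1 + ‖θ‖ := by linarith [norm_nonneg θ]
  have e1 := pow_le_pow_right₀ hN (le_max_left k k')
  have e2 := pow_le_pow_right₀ hN (le_max_right k k')
  have h2 := h0 q hq
  have e3 : C * (1 + ‖θ‖) ^ k * F q ≤ C * (1 + ‖θ‖) ^ (max k k') * F q := by gcongr
  have e4 : C' * (1 + ‖θ‖) ^ k' * F q ≤ C' * (1 + ‖θ‖) ^ (max k k') * F q := by gcongr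
  rw [add_mul, add_mul]
  exact add_le_add ((hG q hq θ).trans e3) ((hG' q hq θ).trans e4)

theorem TempLe.sum {ι : Type*} {s : Finset ι} {G : ι → Phase d → ℝ} {F : Phase d → ℝ}
    (hG : ∀ i, TempLe (G i) F) (h0 : ∀ q ∈ scT d, 0 ≤ F q) :
    TempLe (fun q => ∑ i ∈ s, G i q) F := by
  classical
  induction s using Finset.induction_on with
  | empty =>
    refine ⟨1, le_rfl, 0, fun q hq θ => ?_⟩
    simpa using h0 q hq
  | insert i s hi ih =>
    simp only [Finset.sum_insert hi]
    exact (hG i).add ih h0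

theorem TempLe.rpow {F : Phase d → ℝ} (hF : Temperate F) (h0 : ∀ q ∈ scT d, 0 < F q) (s : ℝ) :
    Temperate (fun q => F q ^ s) := by
  obtain ⟨C, hC, k, hF⟩ := hF
  refine ⟨C ^ ⌈|s|⌉₊, one_le_pow₀ hC, k * ⌈|s|⌉₊, fun q hq θ => ?_⟩
  have hq' : (q.1, q.2 + θ) ∈ scT d := hq
  have h2 := h0 q hq
  have h3 := h0 _ hq'
  have hN : 1 ≤ 1 + ‖θ‖ := by linarith [norm_nonneg θ]
  set A := C * (1 + ‖θ‖) ^ k with hA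
  have hA1 : 1 ≤ A := one_le_mul_of_one_le_of_one_le hC (one_le_pow₀ hN)
  have hA0 : 0 < A := by linarith
  have h4 : A ^ |s| ≤ C ^ ⌈|s|⌉₊ * (1 + ‖θ‖) ^ (k * ⌈|s|⌉₊) := by
    rw [pow_mul, ← mul_pow, ← Real.rpow_natCast]
    exact Real.rpow_le_rpow_of_exponent_le hA1 (Nat.le_ceil _)
  refine le_trans ?_ (mul_le_mul_of_nonneg_right h4 (by positivity))
  rcases le_total 0 s with hs | hs
  · rw [abs_of_nonneg hs, ← Real.mul_rpow hA0.le h2.le]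
    exact Real.rpow_le_rpow h3.le (hF q hq θ) hs
  -- A negative power needs a lower bound for the translate; it is the upper bound at the translated
  -- point, shifted back by -θ.
  · have h5 := hF _ hq' (-θ)
    simp only [add_neg_cancel_right, norm_neg] at h5
    have h6 : A⁻¹ * F q ≤ F (q.1, q.2 + θ) := by
      rw [inv_mul_le_iff₀ hA0]; exact h5
    refine (Real.rpow_le_rpow_of_nonpos (by positivity) h6 hs).trans (le_of_eq ?_)
    rw [Real.mul_rpow (by positivity) h2.le, Real.inv_rpow hA0.le, abs_of_nonpos hs,
      Real.rpow_neg hA0.le]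

theorem rho_sq (q : Phase d) : rho q ^ 2 * (1 + ∑ i, q.2 i ^ 2) = 1 := by
  have hpos : 0 < 1 + ∑ i, q.2 i ^ 2 := by
    have : 0 ≤ ∑ i, q.2 i ^ 2 := Finset.sum_nonneg fun i _ => sq_nonneg _
    positivity
  rw [rho, inv_pow, Real.sq_sqrt hpos.le, inv_mul_cancel₀ hpos.ne']

/-- Peetre's inequality ⟨ζ⟩ ≤ C(1+‖θ‖)⟨ζ+θ⟩. The constant 2d+6 also absorbs the comparison of the
Euclidean norm with the sup norm on ℝ^{d+2}. -/
theorem temperate_rho : Temperate (rho : Phase d → ℝ) := by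
  refine ⟨2 * d + 6, by have := Nat.cast_nonneg (α := ℝ) d; linarith, 1, fun q _ θ => ?_⟩
  set q' : Phase d := (q.1, q.2 + θ) with hq'
  have h1 := rho_sq q
  have h2 := rho_sq q'
  have p1 := rho_pos q
  have p2 := rho_pos q'
  have hN : 0 ≤ ‖θ‖ := norm_nonneg θ
  have hsum : ∑ i, q.2 i ^ 2 ≤ 2 * ∑ i, q'.2 i ^ 2 + 2 * ((d + 2) * ‖θ‖ ^ 2) := by
    have : ∀ i, q.2 i ^ 2 ≤ 2 * q'.2 i ^ 2 + 2 * ‖θ‖ ^ 2 := fun i => by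
      have h3 : θ i ^ 2 ≤ ‖θ‖ ^ 2 := sq_le_sq' (by linarith [abs_le.1 (norm_le_pi_norm θ i)])
        ((le_abs_self _).trans (norm_le_pi_norm θ i))
      simp only [hq', Pi.add_apply]
      nlinarith [sq_nonneg (q.2 i + 2 * θ i)]
    refine (Finset.sum_le_sum fun i _ => this i).trans (le_of_eq ?_)
    rw [Finset.sum_add_distrib, ← Finset.mul_sum]
    simp
    ring
  have h4 : 0 ≤ ∑ i, q'.2 i ^ 2 := Finset.sum_nonneg fun i _ => sq_nonneg _
  have hd := Nat.cast_nonneg (α := ℝ) d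
  have h5 : 1 + ∑ i, q.2 i ^ 2 ≤ ((2 * d + 6) * (1 + ‖θ‖)) ^ 2 * (1 + ∑ i, q'.2 i ^ 2) := by
    have h6 : (2 * d + 6) * (1 + ‖θ‖) ^ 2 ≤ ((2 * d + 6) * (1 + ‖θ‖)) ^ 2 := by
      rw [mul_pow]
      refine mul_le_mul_of_nonneg_right ?_ (by positivity)
      nlinarith
    refine le_trans ?_ (mul_le_mul_of_nonneg_right h6 (by positivity))
    have h7 : 2 + (2 * d + 4) * ‖θ‖ ^ 2 ≤ (2 * d + 6) * (1 + ‖θ‖) ^ 2 := by nlinarith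
    have h8 : (2 + (2 * d + 4) * ‖θ‖ ^ 2) * (1 + ∑ i, q'.2 i ^ 2) ≤ _ :=
      mul_le_mul_of_nonneg_right h7 (by positivity)
    have h9 : 0 ≤ (2 * d + 4) * ‖θ‖ ^ 2 * ∑ i, q'.2 i ^ 2 := by positivity
    linarith
  have h6 : rho q' ^ 2 ≤ ((2 * d + 6) * (1 + ‖θ‖) * rho q) ^ 2 := by
    have h7 := mul_le_mul_of_nonneg_left h5 (by positivity : 0 ≤ rho q ^ 2 * rho q' ^ 2)
    have e1 : rho q ^ 2 * rho q' ^ 2 * (1 + ∑ i, q.2 i ^ 2) = rho q' ^ 2 := by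
      linear_combination rho q' ^ 2 * h1
    have e2 : rho q ^ 2 * rho q' ^ 2 * (((2 * d + 6) * (1 + ‖θ‖)) ^ 2 * (1 + ∑ i, q'.2 i ^ 2)) =
      ((2 * d + 6) * (1 + ‖θ‖) * rho q) ^ 2 := by
      linear_combination ((2 * d + 6) * (1 + ‖θ‖) * rho q) ^ 2 * h2
    rwa [e1, e2] at h7
  rw [pow_one]
  exact le_of_sq_le_sq h6 (by positivity)

/-- τ_i can vanish at a point and not at its translates, so |τ_i| cannot control itself. The shift
of ζ_j adds at most ‖θ‖ times the translated ρ, hence the extra ρ on the right; both terms are later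
dominated through d_Σ. -/
theorem tempLe_abs_tau (i : Fin (d + 1)) :
    TempLe (fun q : Phase d => |tau q i|) (fun q => |tau q i| + rho q) := by
  obtain ⟨K, hK, k, h⟩ := temperate_rho (d := d)
  refine ⟨K, hK, k + 1, fun q hq θ => ?_⟩
  have h1 := h q hq θ
  have p1 := rho_pos q
  have p2 := rho_pos (q.1, q.2 + θ)
  set j := (1 : Fin (d + 2)).succAbove i with hj
  have h3 : |θ j| ≤ ‖θ‖ := norm_le_pi_norm θ j
  simp only [tau, abs_mul, abs_of_pos p1, abs_of_pos p2, ← hj, Pi.add_apply]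
  have h4 : |q.2 j + θ j| ≤ (1 + ‖θ‖) * (|q.2 j| + 1) := by
    have := abs_add_le (q.2 j) (θ j)
    have := mul_nonneg (norm_nonneg θ) (abs_nonneg (q.2 j))
    linarith
  calc _ ≤ (K * (1 + ‖θ‖) ^ k * rho q) * ((1 + ‖θ‖) * (|q.2 j| + 1)) :=
        mul_le_mul h1 h4 (abs_nonneg _) (by positivity)
    _ = _ := by ring

theorem sq_tau_le (q : Phase d) (i : Fin (d + 1)) : tau q i ^ 2 ≤ dSigma q ^ 2 := by
  have h1 : tau q i ^ 2 ≤ ∑ i, tau q i ^ 2 :=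
    Finset.single_le_sum (f := fun i => tau q i ^ 2) (fun i _ => sq_nonneg _) (Finset.mem_univ i)
  rw [dSigma_sq]
  linarith [rho_pos q]

theorem temperate_of_sq {F : Phase d → ℝ} (h : Temperate fun q => F q ^ 2)
    (h0 : ∀ q ∈ scT d, 0 < F q) : Temperate F := by
  obtain ⟨C, hC, k, h⟩ := TempLe.rpow h (fun q hq => pow_pos (h0 q hq) 2) (1 / 2)
  refine ⟨C, hC, k, fun q hq θ => ?_⟩
  have hq' : (q.1, q.2 + θ) ∈ scT d := hq
  have := h q hq θ
  beta_reduce at this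
  rwa [← Real.sqrt_eq_rpow, ← Real.sqrt_eq_rpow, Real.sqrt_sq (h0 q hq).le,
    Real.sqrt_sq (h0 _ hq').le] at this

theorem temperate_dSigma : Temperate (dSigma : Phase d → ℝ) := by
  refine temperate_of_sq ?_ fun q _ => dSigma_pos q
  have h1 : ∀ i : Fin (d + 1), TempLe (fun q : Phase d => tau q i ^ 2) fun q => dSigma q ^ 2 :=
      fun i => by
    have := ((tempLe_abs_tau i).mul (tempLe_abs_tau i)
      (fun q _ => add_nonneg (abs_nonneg _) (rho_pos q).le) fun q _ => abs_nonneg _).mono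
      (A := 4) (F' := fun q => dSigma q ^ 2) (by norm_num) fun q _ => by
        have e1 := sq_tau_le q i
        have e2 := rho_le_dSigma_sq q
        have e3 := rho_le_one q
        have e4 := rho_pos q
        have e5 := sq_abs (tau q i)
        nlinarith [sq_nonneg (|tau q i| - rho q)]
    obtain ⟨C, hC, k, h⟩ := this
    refine ⟨C, hC, k, fun q hq θ => ?_⟩
    have := h q hq θ
    beta_reduce at this
    rwa [← sq, sq_abs] at this
  have h2 := (TempLe.sum (s := Finset.univ) h1 fun q _ => sq_nonneg _).add
    (temperate_rho.mono (A := 1) (F' := fun q => dSigma q ^ 2) le_rfl fun q _ => by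
      rw [one_mul]; exact rho_le_dSigma_sq q) fun q _ => sq_nonneg _
  simpa only [← dSigma_sq] using h2

/-- The summands of d_Γ² are treated separately: x does not move, d_Σ is temperate and at most d_Γ,
and translates of |τ̃_i| are controlled by (|τ_i|+ρ)/d_Σ. The last is at most 2d_Γ because ρ ≤ d_Σ²
≤ d_Σd_Γ. -/
theorem temperate_dGamma : Temperate (dGamma : Phase d → ℝ) := by
  refine temperate_of_sq ?_ fun q hq => dGamma_pos hq
  have hx : TempLe (fun q : Phase d => xb q) fun q => dGamma q ^ 2 :=
    ⟨1, le_rfl, 0, fun q hq θ => by simpa [xb] using xb_le_dGamma_sq hq⟩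
  have hs : TempLe (fun q : Phase d => dSigma q ^ 2) fun q => dGamma q ^ 2 := by
    have h := (temperate_dSigma (d := d)).mul temperate_dSigma (fun q _ => (dSigma_pos q).le)
      fun q _ => (dSigma_pos q).le
    simp only [← sq] at h
    refine h.mono le_rfl fun q hq => ?_
    have := dSigma_le_dGamma hq
    have := dSigma_pos q
    rw [one_mul]
    gcongr
  have ht : ∀ i, TempLe (fun q : Phase d => tauT q i ^ 2) fun q => dGamma q ^ 2 := fun i => by
    have h := (tempLe_abs_tau i).mul (TempLe.rpow temperate_dSigma (fun q _ => dSigma_pos q) (-1))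
      (fun q _ => add_nonneg (abs_nonneg _) (rho_pos q).le)
      fun q _ => Real.rpow_nonneg (dSigma_pos q).le _
    have h0 : ∀ q : Phase d, 0 ≤ (|tau q i| + rho q) * dSigma q ^ (-1 : ℝ) := fun q =>
      mul_nonneg (add_nonneg (abs_nonneg _) (rho_pos q).le) (Real.rpow_nonneg (dSigma_pos q).le _)
    have h' := (h.mul h (fun q _ => h0 q) fun q _ => mul_nonneg (abs_nonneg _)
      (Real.rpow_nonneg (dSigma_pos q).le _)).mono (A := 4) (F' := fun q => dGamma q ^ 2)
      (by norm_num) fun q hq => by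
        have p1 := dSigma_pos q
        have e1 := abs_tauT_le_dGamma hq i
        have e2 : rho q * (dSigma q)⁻¹ ≤ dGamma q := by
          rw [← div_eq_mul_inv, div_le_iff₀ p1]
          have := rho_le_dSigma_sq q
          have := dSigma_le_dGamma hq
          nlinarith
        have e3 : (|tau q i| + rho q) * dSigma q ^ (-1 : ℝ) ≤ 2 * dGamma q := by
          rw [Real.rpow_neg_one, add_mul, ← div_eq_mul_inv]
          rw [tauT, abs_div, abs_of_pos p1] at e1
          linarith
        have := h0 q
        nlinarith
    obtain ⟨C, hC, k, h⟩ := h'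
    refine ⟨C, hC, k, fun q hq θ => ?_⟩
    have := h q hq θ
    have e : ∀ q : Phase d, |tau q i| * dSigma q ^ (-1 : ℝ) * (|tau q i| * dSigma q ^ (-1 : ℝ)) =
        tauT q i ^ 2 := fun q => by
      rw [Real.rpow_neg_one, tauT, ← sq, mul_pow, sq_abs, div_pow, inv_pow, div_eq_mul_inv]
    beta_reduce at this
    rwa [e] at this
  obtain ⟨C, hC, k, h⟩ := (hx.add hs fun q _ => sq_nonneg _).add
    (TempLe.sum (s := Finset.univ) ht fun q _ => sq_nonneg _) fun q _ => sq_nonneg _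
  refine ⟨C, hC, k, fun q hq θ => ?_⟩
  have hq' : (q.1, q.2 + θ) ∈ scT d := hq
  have := h q hq θ
  beta_reduce at this
  rwa [← dGamma_sq hq'] at this

/-- This allows an amplitude to be evaluated at ζ+θ at the price of a power of 1+‖θ‖, which rapid
decay in θ absorbs. -/
theorem temperate_wt (μ : Order) : Temperate (wt μ : Phase d → ℝ) := by
  have hx : Temperate (fun q : Phase d => xb q ^ (-μ.2.1)) :=
    ⟨1, le_rfl, 0, fun q _ θ => by simp [xb]⟩
  have h1 := fun q (_ : q ∈ scT d) => (rho_pos q)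
  have h2 := fun q (hq : q ∈ scT d) => (hq : 0 < xb q)
  have h3 := fun q (_ : q ∈ scT d) => (dSigma_pos q)
  have h4 := fun q (hq : q ∈ scT d) => (dGamma_pos hq)
  have n1 := fun q hq => Real.rpow_nonneg (h1 q hq).le (-μ.1)
  have n2 := fun q hq => Real.rpow_nonneg (h2 q hq).le (-μ.2.1)
  have n3 := fun q hq => Real.rpow_nonneg (h3 q hq).le (-μ.2.2.1)
  have n4 := fun q hq => Real.rpow_nonneg (h4 q hq).le (-μ.2.2.2)
  exact (((TempLe.rpow temperate_rho h1 _).mul hx n1 n2).mul (TempLe.rpow temperate_dSigma h3 _)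
    (fun q hq => mul_nonneg (n1 q hq) (n2 q hq)) n3).mul (TempLe.rpow temperate_dGamma h4 _)
    (fun q hq => mul_nonneg (mul_nonneg (n1 q hq) (n2 q hq)) (n3 q hq)) n4

/-! ### Comparison of orders -/

theorem wtLe_of_wt {ν μ : Order} (D : Coord d → ℝ) (hD : ∀ Z, 0 ≤ D Z)
    (h : ∀ B : Set (Coord d), IsCompact B → ∃ C : ℝ, 0 ≤ C ∧ ∀ q ∈ scT d, q.1 ∈ B →
      wt (μ - ν) q ≤ C) : WtLe D D μ ν := fun B hB => by
  obtain ⟨C, hC, H⟩ := h B hB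
  refine ⟨C, hC, fun w hw hwB => ?_⟩
  have h1 := H w.1 hw hwB
  rw [← sub_add_cancel μ ν, wt_add _ _ hw, mul_assoc]
  exact mul_le_mul_of_nonneg_right h1 (mul_nonneg (wt_pos _ hw).le (hD _))

/-- Since ρ ≤ 1 and ρ ≤ d_Σ² ≤ d_Σd_Γ, differentiation in the fibre never worsens the order.
Integrations by parts in ζ are therefore free. -/
theorem wtLe_ord_fib (o : ℝ) (D : Coord d → ℝ) (hD : ∀ Z, 0 ≤ D Z) (μ : Order)
    (i : Fin (d + 2)) : WtLe D D (μ + ord o (.inr (.inl i))) μ := by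
  refine wtLe_of_wt D hD fun B hB => ⟨1, by norm_num, fun q hq _ => ?_⟩
  have p1 := rho_pos q
  have p2 := dSigma_pos q
  have p3 := dGamma_pos hq
  rw [add_sub_cancel_left, ← neg_neg (ord o _), wt_neg _ hq]
  by_cases hi : i = 1
  · subst hi
    rw [wt_ord_fib_one, inv_inv]
    exact rho_le_one q
  · rw [wt_ord_fib hi]
    refine inv_le_one_of_one_le₀ ?_
    rw [mul_assoc, ← div_eq_inv_mul, one_le_div p1]
    have := rho_le_dSigma_sq q
    have := dSigma_le_dGamma hq
    nlinarith

/-- ∂_{η_1} gains a full ρ, and d_Σd_Γ is bounded over compact base sets, so this is at least as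
good as the gain ρ/(d_Σd_Γ) of the other fibre directions. The latter is the uniform gain seen in
the expansion. -/
theorem wtLe_ord_fib_le (o : ℝ) (D : Coord d → ℝ) (hD : ∀ Z, 0 ≤ D Z) (μ : Order)
    (i : Fin (d + 2)) : WtLe D D (μ + ord o (.inr (.inl i))) (μ + (-1, 0, 1, 1)) := by
  refine wtLe_of_wt D hD fun B hB => ?_
  by_cases hi : i = 1
  · subst hi
    obtain ⟨R, hR1, hR⟩ := exists_xb_le hB
    refine ⟨(d + 2 + 1) * (R + (2 * d + 3) + 1), by positivity, fun q hq hqB => ?_⟩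
    have e : μ + ord (d := d) o (.inr (.inl 1)) - (μ + (-1, 0, 1, 1)) = (0, 0, -1, -1) := by
      simp [ord]
    rw [e]
    have h1 := le_of_sq_le (dSigma_sq_le q)
    have h2 := le_of_sq_le (dGamma_sq_le hq)
    have h3 := hR q hqB
    have p2 := dSigma_pos q
    have p3 := dGamma_pos hq
    simp only [wt_eq, neg_zero, Real.rpow_zero, neg_neg, Real.rpow_one, one_mul]
    gcongr
    linarith
  · refine ⟨1, by norm_num, fun q hq _ => ?_⟩
    simp [ord, hi, wt_zero]

/-- After k derivatives in Z there is an extra x^{ko}, bounded over compact base sets and so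
discardable. The class with o = 0 contains Schwartz functions of Z and is the setting for the
oscillatory integrals; the gain matters only for the orders in the expansion. -/
theorem IsAmp.of_gain {o : ℝ} (ho : 0 ≤ o) {μ : Order} {D : Coord d → ℝ} (hD : ∀ Z, 0 ≤ D Z)
    {c : FullPhase d → ℂ} (hc : IsAmp o D μ c) : IsAmp 0 D μ c := by
  refine of_stable (fun μ c => ∃ k : ℕ, IsAmp o D (μ + (0, -(k * o), 0, 0)) c)
    (fun _ c ⟨_, h⟩ => h.smooth) ?_ ?_ ⟨0, ?_⟩
  rotate_left 2
  · have e : μ + (0, -(((0 : ℕ) : ℝ) * o), 0, 0) = μ := by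
      ext <;> simp
    rwa [e]
  · rintro μ c ⟨k, hc⟩
    refine hc.bd.mono (wtLe_of_wt D hD fun B hB => ?_)
    obtain ⟨R, hR1, hR⟩ := exists_xb_le hB
    refine ⟨R ^ (k * o), by positivity, fun q hq hqB => ?_⟩
    rw [add_sub_cancel_left]
    simp only [wt_eq, neg_zero, Real.rpow_zero, neg_neg, one_mul, mul_one]
    have : 0 < xb q := hq
    exact Real.rpow_le_rpow this.le (hR q hqB) (by positivity)
  · rintro μ c ⟨k, hc⟩ e
    rcases e with i | i | i
    · refine ⟨_, ⟨k, ?_⟩, fun _ _ => rfl⟩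
      rw [add_right_comm]
      exact hc.pd (.inl i)
    · refine ⟨_, ⟨k, ?_⟩, fun _ _ => rfl⟩
      rw [add_right_comm]
      exact hc.pd (.inr (.inl i))
    · refine ⟨_, ⟨k + 1, ?_⟩, fun _ _ => rfl⟩
      convert hc.pd (.inr (.inr i)) using 1
      simp [ord, add_assoc]
      ring_nf

end BBCalculus
end

noncomputable section
namespace BBCalculus
open MeasureTheory Topology Set

variable {d : ℕ}

/-! ### Parametric integrals -/

theorem clm_eq_sum (L : FullPhase d →L[ℝ] ℂ) : L = ∑ e, (coord e).smulRight (L (vec e)) := by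
  refine ContinuousLinearMap.ext fun w => ?_
  conv_lhs => rw [← sum_coord w]
  simp

/-- Differentiation under the integral sign. -/
theorem differentiableAt_integral {Ω : Type*} [MeasurableSpace Ω] {ν : Measure Ω}
    {F : FullPhase d → Ω → ℂ} {w₀ : FullPhase d} {s : Set (FullPhase d)} (hs : s ∈ 𝓝 w₀)
    {bound : Ω → ℝ} (hd : ∀ a, ∀ w ∈ s, DifferentiableAt ℝ (fun w => F w a) w)
    (hm : ∀ w ∈ s, AEStronglyMeasurable (F w) ν) (hi : Integrable (F w₀) ν)
    (hm' : ∀ e, AEStronglyMeasurable (fun a => pd (fun w => F w a) e w₀) ν)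
    (hb : ∀ᵐ a ∂ν, ∀ w ∈ s, ∀ e, ‖pd (fun w => F w a) e w‖ ≤ bound a) (hbi : Integrable bound ν) :
    DifferentiableAt ℝ (fun w => ∫ a, F w a ∂ν) w₀ ∧
      ∀ e, pd (fun w => ∫ a, F w a ∂ν) e w₀ = ∫ a, pd (fun w => F w a) e w₀ ∂ν := by
  have hrep : ∀ a w, fderiv ℝ (fun w => F w a) w =
      ∑ e, (coord e).smulRight (pd (fun w => F w a) e w) := fun a w => clm_eq_sum _
  have hM : AEStronglyMeasurable (fun a => fderiv ℝ (fun w => F w a) w₀) ν := by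
    simp only [hrep]
    refine Finset.aestronglyMeasurable_fun_sum _ fun e _ => ?_
    have hc : Continuous fun z : ℂ => (coord (d := d) e).smulRight z :=
      ((ContinuousLinearMap.smulRightL ℝ (FullPhase d) ℂ) (coord e)).continuous
    exact hc.comp_aestronglyMeasurable (hm' e)
  have hB : ∀ᵐ a ∂ν, ∀ w ∈ s, ‖fderiv ℝ (fun w => F w a) w‖ ≤
      ∑ e : Dir d, ‖coord e‖ * bound a := by
    filter_upwards [hb] with a h w hw
    rw [hrep]
    refine (norm_sum_le _ _).trans (Finset.sum_le_sum fun e _ => ?_)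
    rw [ContinuousLinearMap.norm_smulRight_apply]
    exact mul_le_mul_of_nonneg_left (h w hw e) (norm_nonneg _)
  have hBi : Integrable (fun a => ∑ e : Dir d, ‖coord e‖ * bound a) ν :=
    integrable_finsetSum _ fun e _ => hbi.const_mul _
  have key := hasFDerivAt_integral_of_dominated_of_fderiv_le hs
    (Filter.eventually_of_mem hs hm) hi hM hB hBi
    (Filter.Eventually.of_forall fun a w hw => (hd a w hw).hasFDerivAt)
  refine ⟨key.differentiableAt, fun e => ?_⟩
  have hI : Integrable (fun a => fderiv ℝ (fun w => F w a) w₀) ν :=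
    hBi.mono' hM (by
      filter_upwards [hB] with a h
      exact h w₀ (mem_of_mem_nhds hs))
  simp only [pd, act, key.fderiv]
  exact ContinuousLinearMap.integral_apply hI _

/-- A class of differentiable functions which is stable under differentiation consists of smooth
functions. -/
theorem contDiffOn_of_stable (P : (FullPhase d → ℂ) → Prop)
    (hs : ∀ c, P c → ∀ w ∈ scTFull d, DifferentiableAt ℝ c w)
    (hd : ∀ c, P c → ∀ e, ∃ g, P g ∧ EqOn (pd c e) g (scTFull d)) {c : FullPhase d → ℂ}
    (hc : P c) : ContDiffOn ℝ ∞ c (scTFull d) := by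
  have h : ∀ n : ℕ, ∀ c, P c → ContDiffOn ℝ n c (scTFull d) := by
    intro n
    induction n with
    | zero =>
      intro c hc
      rw [Nat.cast_zero, contDiffOn_zero]
      exact fun w hw => (hs c hc w hw).continuousAt.continuousWithinAt
    | succ n ih =>
      intro c hc
      rw [Nat.cast_succ, contDiffOn_succ_iff_fderiv_of_isOpen isOpen_scTFull]
      refine ⟨fun w hw => (hs c hc w hw).differentiableWithinAt, by simp, ?_⟩
      have e1 : ∀ w, fderiv ℝ c w = ∑ e, (coord e).smulRight (pd c e w) := fun w => clm_eq_sum _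
      have e2 : fderiv ℝ c = fun w => ∑ e, (coord e).smulRight (pd c e w) := funext e1
      rw [e2]
      refine ContDiffOn.sum fun e _ => ?_
      obtain ⟨g, hg, h⟩ := hd c hc e
      exact ((ContinuousLinearMap.smulRightL ℝ (FullPhase d) ℂ) (coord e)).contDiff.comp_contDiffOn
        ((ih g hg).congr h)
  exact contDiffOn_infty.2 fun n => h n c hc

/-- Designed for parameter integrals: differentiation under the integral sign yields
differentiability and another integral of the same kind, and smoothness follows by iteration. -/
theorem IsAmp.of_stable_diff {o : ℝ} {D : Coord d → ℝ} {μ : Order} {c : FullPhase d → ℂ}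
    (P : Order → (FullPhase d → ℂ) → Prop)
    (hs : ∀ μ c, P μ c → ∀ w ∈ scTFull d, DifferentiableAt ℝ c w)
    (hb : ∀ μ c, P μ c → Bd D μ c)
    (hd : ∀ μ c, P μ c → ∀ e, ∃ g, P (μ + ord o e) g ∧ EqOn (BBCalculus.pd c e) g (scTFull d))
    (hc : P μ c) : IsAmp o D μ c := by
  refine IsAmp.of_stable P (fun μ c hc => ?_) hb hd hc
  refine contDiffOn_of_stable (fun c => ∃ μ, P μ c) (fun c ⟨μ, hc⟩ => hs μ c hc)
    (fun c ⟨μ, hc⟩ e => ?_) ⟨μ, hc⟩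
  obtain ⟨g, hg, h⟩ := hd μ c hc e
  exact ⟨g, ⟨_, hg⟩, h⟩

/-- Local bounds, uniform in `(X,Y)`. -/
theorem Bd.exists_nhds {D : Coord d → ℝ} {μ : Order} {c : FullPhase d → ℂ} (hc : Bd D μ c)
    (hD : ∀ Z, 0 ≤ D Z) {w₀ : FullPhase d} (hw : w₀ ∈ scTFull d) :
    ∃ s ∈ 𝓝 w₀, s ⊆ scTFull d ∧ ∃ C : ℝ, 0 ≤ C ∧ ∀ w ∈ s, ∀ Z, ‖c (w.1, Z)‖ ≤ C * D Z := by
  obtain ⟨C, hC, H⟩ := hc _ (isCompact_closedBall w₀.1.1 1)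
  have h1 : ContinuousAt (fun w : FullPhase d => wt μ w.1) w₀ :=
    (((contDiffOn_wt μ).contDiffAt (isOpen_scT.mem_nhds hw)).continuousAt).comp
      (f := fun w : FullPhase d => w.1) continuousAt_fst
  have h2 : ∀ᶠ w in 𝓝 w₀, wt μ w.1 < wt μ w₀.1 + 1 :=
    h1.eventually (gt_mem_nhds (lt_add_one _))
  have h3 : ∀ᶠ w in 𝓝 w₀, w.1.1 ∈ Metric.closedBall w₀.1.1 1 :=
    (by fun_prop : ContinuousAt (fun w : FullPhase d => w.1.1) w₀).eventually
      (Metric.closedBall_mem_nhds _ one_pos)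
  have h4 : ∀ᶠ w in 𝓝 w₀, w ∈ scTFull d := isOpen_scTFull.mem_nhds hw
  refine ⟨_, (h2.and h3).and h4, fun w hw => hw.2, C * (wt μ w₀.1 + 1),
    mul_nonneg hC (by linarith [wt_pos μ hw]), fun w hw' Z => ?_⟩
  refine (H (w.1, Z) hw'.2 hw'.1.2).trans ?_
  refine mul_le_mul_of_nonneg_right (mul_le_mul_of_nonneg_left hw'.1.1.le hC) (hD _)

/-! ### Averages along rays in `(X,Y)` -/

/-- `1` for the `(X,Y)` directions, `0` otherwise. -/
def zdeg : Dir d → ℕ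
  | .inl _ => 0
  | .inr (.inl _) => 0
  | .inr (.inr _) => 1

/-- Only the derivatives in Z see the dilation, and each contributes one factor t. The family of
averages must therefore carry the exponent κ. -/
theorem pd_dilate {g : FullPhase d → ℂ} (hg : ContDiffOn ℝ ∞ g (scTFull d)) (κ : ℕ) (t : ℝ)
    (e : Dir d) {w : FullPhase d} (hw : w ∈ scTFull d) :
    DifferentiableAt ℝ (fun w : FullPhase d => (t : ℂ) ^ κ * g (w.1, t • w.2)) w ∧
    pd (fun w : FullPhase d => (t : ℂ) ^ κ * g (w.1, t • w.2)) e w =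
      (t : ℂ) ^ (κ + zdeg e) * pd g e (w.1, t • w.2) := by
  have h1 : DifferentiableAt ℝ g (w.1, t • w.2) := hg.differentiableAt_scTFull hw
  set S : FullPhase d →L[ℝ] FullPhase d := (ContinuousLinearMap.fst ℝ _ _).prod
    (t • ContinuousLinearMap.snd ℝ _ _) with hS
  have h2 : HasFDerivAt (fun w : FullPhase d => g (w.1, t • w.2)) _ w :=
    h1.hasFDerivAt.comp (f := S) w S.hasFDerivAt
  have h3 := h2.const_mul ((t : ℂ) ^ κ)
  refine ⟨h3.differentiableAt, ?_⟩
  have h4 : S (vec e) = t ^ zdeg e • vec e := by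
    rcases e with i | i | i <;> simp [hS, vec, zdeg]
  simp only [pd, act, h3.fderiv, smul_apply, ContinuousLinearMap.comp_apply, h4, map_smul,
    smul_eq_mul, Complex.real_smul]
  push_cast
  ring

/-- `∫_0^1 t^κ g(tZ) dt`. -/
def rayAvg (κ : ℕ) (g : FullPhase d → ℂ) : FullPhase d → ℂ :=
  fun w => ∫ t in Ioc (0 : ℝ) 1, (t : ℂ) ^ κ * g (w.1, t • w.2)

theorem continuous_dilate {g : FullPhase d → ℂ} (hg : ContDiffOn ℝ ∞ g (scTFull d)) (κ : ℕ)
    {w : FullPhase d} (hw : w ∈ scTFull d) :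
    Continuous fun t : ℝ => (t : ℂ) ^ κ * g (w.1, t • w.2) := by
  have : Continuous fun t : ℝ => g (w.1, t • w.2) :=
    hg.continuousOn.comp_continuous (by fun_prop) fun t => hw
  exact (Complex.continuous_ofReal.pow κ).mul this

theorem integrable_dilate {g : FullPhase d → ℂ} (hg : ContDiffOn ℝ ∞ g (scTFull d)) (κ : ℕ)
    {w : FullPhase d} (hw : w ∈ scTFull d) :
    IntegrableOn (fun t : ℝ => (t : ℂ) ^ κ * g (w.1, t • w.2)) (Ioc 0 1) :=
  (continuous_dilate hg κ hw).integrableOn_Icc.mono_set Ioc_subset_Icc_self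

theorem norm_pow_mul_le {t : ℝ} (ht : t ∈ Ioc (0 : ℝ) 1) (κ : ℕ) {z : ℂ} {C : ℝ} (hz : ‖z‖ ≤ C) :
    ‖(t : ℂ) ^ κ * z‖ ≤ C := by
  rw [norm_mul, norm_pow, Complex.norm_real, Real.norm_of_nonneg ht.1.le]
  exact (mul_le_of_le_one_left (norm_nonneg _) (pow_le_one₀ ht.1.le ht.2)).trans hz

theorem rayAvg_diff {o : ℝ} {μ : Order} {g : FullPhase d → ℂ} (hg : IsAmp o (fun _ => 1) μ g)
    (κ : ℕ) {w : FullPhase d} (hw : w ∈ scTFull d) :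
    DifferentiableAt ℝ (rayAvg κ g) w ∧
      ∀ e, pd (rayAvg κ g) e w = rayAvg (κ + zdeg e) (pd g e) w := by
  choose s hs hss C hC H using fun e => (hg.pd e).bd.exists_nhds (fun _ => zero_le_one) hw
  have hmem : (⋂ e, s e) ∈ 𝓝 w := Filter.iInter_mem.2 hs
  have hsub : ∀ w' ∈ ⋂ e, s e, w' ∈ scTFull d := fun w' hw' => hss (.inl 0) (mem_iInter.1 hw' _)
  have key := differentiableAt_integral (ν := volume.restrict (Ioc (0 : ℝ) 1))
    (F := fun w t => (t : ℂ) ^ κ * g (w.1, t • w.2)) (bound := fun _ => ∑ e, C e) hmem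
    (fun t w' hw' => (pd_dilate hg.smooth κ t (.inl 0) (hsub w' hw')).1)
    (fun w' hw' => (continuous_dilate hg.smooth κ (hsub w' hw')).aestronglyMeasurable)
    (integrable_dilate hg.smooth κ hw)
    (fun e => by
      simp only [fun t => (pd_dilate hg.smooth κ t e hw).2]
      exact (continuous_dilate (hg.pd e).smooth _ hw).aestronglyMeasurable)
    (by
      filter_upwards [ae_restrict_mem measurableSet_Ioc] with t ht w' hw' e
      rw [(pd_dilate hg.smooth κ t e (hsub w' hw')).2]
      refine norm_pow_mul_le ht _ ((H e w' (mem_iInter.1 hw' e) _).trans ?_)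
      rw [mul_one]
      exact Finset.single_le_sum (fun e _ => hC e) (Finset.mem_univ e))
    (integrable_const _)
  refine ⟨key.1, fun e => (key.2 e).trans ?_⟩
  simp only [fun t => (pd_dilate hg.smooth κ t e hw).2]
  rfl

theorem IsAmp.rayAvg {o : ℝ} {μ : Order} {g : FullPhase d → ℂ} (hg : IsAmp o (fun _ => 1) μ g)
    (κ : ℕ) : IsAmp o (fun _ => 1) μ (rayAvg κ g) := by
  refine of_stable_diff (fun μ c => ∃ κ g, IsAmp o (fun _ => 1) μ g ∧ c = BBCalculus.rayAvg κ g)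
    ?_ ?_ ?_ ⟨κ, g, hg, rfl⟩
  · rintro μ _ ⟨κ, g, hg, rfl⟩ w hw
    exact (rayAvg_diff hg κ hw).1
  · rintro μ _ ⟨κ, g, hg, rfl⟩ B hB
    obtain ⟨C, hC, H⟩ := hg.bd B hB
    refine ⟨C, hC, fun w hw hwB => ?_⟩
    have := norm_setIntegral_le_of_norm_le_const (μ := volume) (s := Ioc (0 : ℝ) 1)
      (C := C * wt μ w.1 * 1) (f := fun t : ℝ => (t : ℂ) ^ κ * g (w.1, t • w.2)) (by simp)
      fun t ht => norm_pow_mul_le ht κ (H (w.1, t • w.2) hw hwB)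
    simpa [BBCalculus.rayAvg] using this
  · rintro μ _ ⟨κ, g, hg, rfl⟩ e
    exact ⟨_, ⟨_, _, hg.pd e, rfl⟩, fun w hw => (rayAvg_diff hg κ hw).2 e⟩

theorem rayAvg_at_zero (κ : ℕ) (g : FullPhase d → ℂ) (q : Phase d) :
    rayAvg κ g (q, 0) = ((κ : ℂ) + 1)⁻¹ * g (q, 0) := by
  simp only [rayAvg, smul_zero]
  rw [integral_mul_const, ← intervalIntegral.integral_of_le zero_le_one]
  have : ∫ t in (0 : ℝ)..1, (t : ℂ) ^ κ = ((∫ t in (0 : ℝ)..1, t ^ κ : ℝ) : ℂ) := by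
    rw [← intervalIntegral.integral_ofReal]
    simp
  rw [this, integral_pow]
  simp

/-- The first order Taylor formula in `(X,Y)`. -/
theorem eq_atZero_add_rayAvg {b : FullPhase d → ℂ} (hb : ContDiffOn ℝ ∞ b (scTFull d))
    {w : FullPhase d} (hw : w ∈ scTFull d) :
    b w = b (w.1, 0) + ∑ i, (w.2 i : ℂ) * rayAvg 0 (pd b (.inr (.inr i))) w := by
  have h1 : ∀ t : ℝ, HasDerivAt (fun t : ℝ => b (w.1, t • w.2))
      (∑ i, (w.2 i : ℂ) * pd b (.inr (.inr i)) (w.1, t • w.2)) t := fun t => by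
    have e1 : HasDerivAt (fun t : ℝ => ((w.1, t • w.2) : FullPhase d)) (0, w.2) t := by
      have := (hasDerivAt_id t).smul_const w.2
      simp only [one_smul] at this
      exact (hasDerivAt_const t w.1).prodMk this
    have e2 : DifferentiableAt ℝ b (w.1, t • w.2) := hb.differentiableAt_scTFull hw
    have e3 := e2.hasFDerivAt.comp_hasDerivAt t e1
    have e4 : ((0, w.2) : FullPhase d) = ∑ i, w.2 i • vec (.inr (.inr i)) := by
      have := sum_coord ((0, w.2) : FullPhase d)
      simp only [Fintype.sum_sum_type, coord] at this
      simpa using this.symm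
    rw [e4, map_sum] at e3
    simp only [map_smul, Complex.real_smul] at e3
    exact e3
  have h2 : Continuous fun t : ℝ => ∑ i, (w.2 i : ℂ) * pd b (.inr (.inr i)) (w.1, t • w.2) := by
    refine continuous_finsetSum _ fun i _ => continuous_const.mul ?_
    simpa using continuous_dilate (contDiffOn_pd hb (.inr (.inr i))) 0 hw
  have h3 := intervalIntegral.integral_eq_sub_of_hasDerivAt (fun t _ => h1 t)
    (h2.intervalIntegrable 0 1)
  rw [intervalIntegral.integral_of_le zero_le_one, integral_finsetSum _ fun i _ => ?_] at h3
  · simp only [integral_const_mul, one_smul, zero_smul] at h3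
    simp only [rayAvg, pow_zero, one_mul, h3]
    simp
  · have := (integrable_dilate (contDiffOn_pd hb (.inr (.inr i))) 0 hw).const_mul (w.2 i : ℂ)
    simpa using this

end BBCalculus
end

/-! ### The algebra of the expansion: iterated Taylor remainders and multi-indices. -/

noncomputable section
namespace BBCalculus
open MeasureTheory Topology Set

variable {d : ℕ}

/-! ### The Taylor expansion -/

/-- The label of the direction of `ζ_i`. -/
abbrev dirF (i : Fin (d + 2)) : Dir d := .inr (.inl i)

/-- The label of the direction of `Z_i`. -/
abbrev dirZ (i : Fin (d + 2)) : Dir d := .inr (.inr i)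

/-- The operator `i ∂_ζ · ∂_Z`. -/
def mixed (b : FullPhase d → ℂ) : FullPhase d → ℂ :=
  fun w => ∑ i, Complex.I * pd (pd b (dirZ i)) (dirF i) w

/-- The first Taylor remainder in `(X,Y)`, after an integration by parts in the fibre. -/
def rem (b : FullPhase d → ℂ) : FullPhase d → ℂ :=
  fun w => ∑ i, Complex.I * pd (rayAvg 0 (pd b (dirZ i))) (dirF i) w

/-- ∂_Z supplies the gain in x, averaging along rays costs nothing, and ∂_ζ supplies the common
fibre gain of `wtLe_ord_fib_le`. -/
theorem isAmp_rem {b : FullPhase d → ℂ} {μ : Order} (hb : IsAmp 1 (fun _ => 1) μ b) :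
    IsAmp 1 (fun _ => 1) (μ + (-1, -1, 1, 1)) (rem b) := by
  refine IsAmp.sum fun i _ => IsAmp.const_mul ?_ _
  have h := (((hb.pd (dirZ i)).rayAvg 0).pd (dirF i)).mono
    (wtLe_ord_fib_le 1 (fun _ => 1) (fun _ => zero_le_one) _ i)
  have e : μ + ord 1 (dirZ i) + (-1, 0, 1, 1) = μ + (-1, -1, 1, 1) := by
    rw [add_assoc]
    simp [ord]
  rwa [e] at h

theorem isAmp_mixed {b : FullPhase d → ℂ} {μ : Order} (hb : IsAmp 1 (fun _ => 1) μ b) :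
    IsAmp 1 (fun _ => 1) (μ + (-1, -1, 1, 1)) (mixed b) := by
  refine IsAmp.sum fun i _ => IsAmp.const_mul ?_ _
  have h := ((hb.pd (dirZ i)).pd (dirF i)).mono
    (wtLe_ord_fib_le 1 (fun _ => 1) (fun _ => zero_le_one) _ i)
  have e : μ + ord 1 (dirZ i) + (-1, 0, 1, 1) = μ + (-1, -1, 1, 1) := by
    rw [add_assoc]
    simp [ord]
  rwa [e] at h

theorem mixed_congr {b b' : FullPhase d → ℂ} (h : EqOn b b' (scTFull d)) :
    EqOn (mixed b) (mixed b') (scTFull d) := fun w hw => by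
  unfold mixed
  exact Finset.sum_congr rfl fun i _ => by rw [pd_congr (pd_congr h _) _ hw]

theorem rayAvg_sum (κ : ℕ) {ι : Type*} {s : Finset ι} {g : ι → FullPhase d → ℂ}
    (hg : ∀ i, ContDiffOn ℝ ∞ (g i) (scTFull d)) (z : ℂ) :
    EqOn (rayAvg κ fun w => ∑ i ∈ s, z * g i w) (fun w => ∑ i ∈ s, z * rayAvg κ (g i) w)
      (scTFull d) := fun w hw => by
  simp only [rayAvg, Finset.mul_sum]
  rw [integral_finsetSum _ fun i _ => ?_]
  · refine Finset.sum_congr rfl fun i _ => ?_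
    rw [← integral_const_mul]
    congr 1
    ext t
    ring
  · have := (integrable_dilate (hg i) κ hw).const_mul z
    refine this.congr (Filter.Eventually.of_forall fun t => ?_)
    simp only
    ring

theorem rem_eq_rayAvg_mixed {b : FullPhase d → ℂ} {μ : Order} (hb : IsAmp 1 (fun _ => 1) μ b) :
    EqOn (rem b) (rayAvg 0 (mixed b)) (scTFull d) := fun w hw => by
  unfold rem mixed
  rw [rayAvg_sum 0 (fun i => ((hb.pd (dirZ i)).pd (dirF i)).smooth) Complex.I hw]
  exact Finset.sum_congr rfl fun i _ => by
    rw [(rayAvg_diff (hb.pd (dirZ i)) 0 hw).2 (dirF i)]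
    rfl

theorem mixed_rayAvg {b : FullPhase d → ℂ} {μ : Order} (hb : IsAmp 1 (fun _ => 1) μ b) (κ : ℕ) :
    EqOn (mixed (rayAvg κ b)) (rayAvg (κ + 1) (mixed b)) (scTFull d) := fun w hw => by
  unfold mixed
  rw [rayAvg_sum _ (fun i => ((hb.pd (dirZ i)).pd (dirF i)).smooth) Complex.I hw]
  refine Finset.sum_congr rfl fun i _ => ?_
  have h : EqOn (pd (rayAvg κ b) (dirZ i)) (rayAvg (κ + 1) (pd b (dirZ i))) (scTFull d) :=
    fun w hw => (rayAvg_diff hb κ hw).2 (dirZ i)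
  rw [pd_congr h _ hw, (rayAvg_diff (hb.pd (dirZ i)) (κ + 1) hw).2 (dirF i)]
  rfl

theorem isAmp_iterate {f : (FullPhase d → ℂ) → FullPhase d → ℂ}
    (hf : ∀ b μ, IsAmp 1 (fun _ => 1) μ b → IsAmp 1 (fun _ => 1) (μ + (-1, -1, 1, 1)) (f b))
    {b : FullPhase d → ℂ} {m l k j : ℝ} (hb : IsAmp 1 (fun _ => 1) (m, l, k, j) b) (r : ℕ) :
    IsAmp 1 (fun _ => 1) (m - r, l - r, k + r, j + r) (f^[r] b) := by
  induction r with
  | zero => simpa using hb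
  | succ r ih =>
    rw [Function.iterate_succ_apply']
    convert hf _ _ ih using 1
    simp only [Prod.mk_add_mk, Nat.cast_succ]
    ring_nf

theorem mixed_iterate_rayAvg (r : ℕ) {b : FullPhase d → ℂ} {m l k j : ℝ}
    (hb : IsAmp 1 (fun _ => 1) (m, l, k, j) b) (κ : ℕ) :
    EqOn (mixed^[r] (rayAvg κ b)) (rayAvg (κ + r) (mixed^[r] b)) (scTFull d) := by
  induction r with
  | zero => exact fun _ _ => rfl
  | succ r ih =>
    rw [Function.iterate_succ_apply', Function.iterate_succ_apply']
    exact fun w hw => (mixed_congr ih hw).trans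
      (mixed_rayAvg (isAmp_iterate (fun _ _ h => isAmp_mixed h) hb r) _ hw)

theorem iterate_congr {f : (FullPhase d → ℂ) → FullPhase d → ℂ}
    (hf : ∀ b b', EqOn b b' (scTFull d) → EqOn (f b) (f b') (scTFull d))
    {b b' : FullPhase d → ℂ} (h : EqOn b b' (scTFull d)) (r : ℕ) :
    EqOn (f^[r] b) (f^[r] b') (scTFull d) := by
  induction r with
  | zero => exact h
  | succ r ih =>
    rw [Function.iterate_succ_apply', Function.iterate_succ_apply']
    exact hf _ _ ih

/-- `rem b` is the ray average with exponent 0 of `mixed b`. Commuting a ray average past `mixed`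
raises its exponent by one, because one Z-derivative is taken, and at Z = 0 an average with exponent
r is multiplication by 1/(r+1). These factors accumulate to the factorial. -/
theorem atZero_rem_iterate (r : ℕ) {b : FullPhase d → ℂ} {m l k j : ℝ}
    (hb : IsAmp 1 (fun _ => 1) (m, l, k, j) b) :
    EqOn (atZero (rem^[r] b)) (fun q => (r.factorial : ℂ)⁻¹ * atZero (mixed^[r] b) q)
      (scT d) := by
  induction r generalizing b m l k j with
  | zero => exact fun q hq => by simp
  | succ r ih =>
    intro q hq
    have hq' : ((q, 0) : FullPhase d) ∈ scTFull d := hq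
    have h1 : IsAmp 1 (fun _ => 1) (m - 1, l - 1, k + 1, j + 1) (mixed b) := by
      simpa using isAmp_iterate (fun _ _ h => isAmp_mixed h) hb 1
    have h1' : IsAmp 1 (fun _ => 1) (m - 1, l - 1, k + 1, j + 1) (rem b) := by
      simpa using isAmp_iterate (fun _ _ h => isAmp_rem h) hb 1
    rw [Function.iterate_succ_apply, ih h1' hq]
    simp only [atZero]
    rw [iterate_congr (fun _ _ => mixed_congr) (rem_eq_rayAvg_mixed hb) r hq',
      mixed_iterate_rayAvg r h1 0 hq', rayAvg_at_zero, Function.iterate_succ_apply,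
      Nat.factorial_succ]
    push_cast
    rw [mul_inv, zero_add]
    ring

/-! ### The multinomial theorem for the mixed operator -/

/-- The functions which are smooth over `M`. -/
def SmoothFn (d : ℕ) : Submodule ℂ (FullPhase d → ℂ) where
  carrier := {f | ContDiffOn ℝ ∞ f (scTFull d)}
  add_mem' hf hg := ContDiffOn.add hf hg
  zero_mem' := contDiffOn_const
  smul_mem' c _ hf := ContDiffOn.const_smul c hf

/-- The coordinate derivatives as linear maps, after setting the values outside the bundle to
zero. -/
def pdLin (e : Dir d) : Module.End ℂ (SmoothFn d) where
  -- Elements of the space may fail to be differentiable outside the bundle; cutting off makes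
  -- linearity and commutation identities of operators, so that the algebraic multinomial theorem
  -- applies.
  toFun f := ⟨(scTFull d).indicator (pd f e), by
    exact (contDiffOn_pd f.2 e).congr fun _ hw => indicator_of_mem hw _⟩
  map_add' f g := by
    refine Subtype.ext (funext fun w => ?_)
    by_cases hw : w ∈ scTFull d
    · simp only [Submodule.coe_add, Pi.add_apply, indicator_of_mem hw]
      exact pd_add f.2 g.2 e hw
    · simp [indicator_of_notMem hw]
  map_smul' z f := by
    ext w
    by_cases hw : w ∈ scTFull d
    · simp only [SetLike.val_smul, Pi.smul_apply, indicator_of_mem hw, RingHom.id_apply]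
      have hf : DifferentiableAt ℝ f.1 w := f.2.differentiableAt_scTFull hw
      simp [pd, act, fderiv_const_smul hf]
    · simp [indicator_of_notMem hw]

theorem pdLin_apply (e : Dir d) (f : SmoothFn d) {b : FullPhase d → ℂ}
    (h : EqOn b f (scTFull d)) : EqOn (pd b e) (pdLin e f : SmoothFn d) (scTFull d) :=
  fun _ hw => (pd_congr h e hw).trans (indicator_of_mem hw _).symm

theorem pd_comm {c : FullPhase d → ℂ} (hc : ContDiffOn ℝ ∞ c (scTFull d)) (e e' : Dir d) :
    EqOn (pd (pd c e) e') (pd (pd c e') e) (scTFull d) := by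
  intro w hw
  have h1 : ContDiffAt ℝ ∞ c w := hc.contDiffAt (isOpen_scTFull.mem_nhds hw)
  have h2 := h1.isSymmSndFDerivAt (by simp; norm_cast)
  have h3 : DifferentiableAt ℝ (fderiv ℝ c) w :=
    (h1.fderiv_right (m := 1) (by norm_cast)).differentiableAt (by simp)
  have h4 : ∀ e e' : Dir d, pd (pd c e) e' w = fderiv ℝ (fderiv ℝ c) w (vec e') (vec e) :=
    fun e e' => by
      have := (h3.hasFDerivAt.clm_apply (hasFDerivAt_const (vec e) w)).fderiv
      have h5 : fderiv ℝ (pd c e) w = _ := this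
      simp only [pd, act] at h5 ⊢
      rw [h5]
      simp
  rw [h4, h4, h2]

theorem commute_pdLin (e e' : Dir d) : Commute (pdLin e) (pdLin e') := by
  refine LinearMap.ext fun f => Subtype.ext (funext fun w => ?_)
  by_cases hw : w ∈ scTFull d
  · have h1 := pdLin_apply e (pdLin e' f) (pdLin_apply e' f fun _ _ => rfl) hw
    have h2 := pdLin_apply e' (pdLin e f) (pdLin_apply e f fun _ _ => rfl) hw
    exact h1.symm.trans ((pd_comm f.2 e' e hw).trans h2)
  · exact (indicator_of_notMem hw _).trans (indicator_of_notMem hw _).symm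

theorem iterate_pd_eq (e : Dir d) (n : ℕ) (f : SmoothFn d) {b : FullPhase d → ℂ}
    (h : EqOn b f (scTFull d)) :
    EqOn ((fun g => pd g e)^[n] b) ((pdLin e ^ n) f : SmoothFn d) (scTFull d) := by
  induction n with
  | zero => exact h
  | succ n ih =>
    rw [Function.iterate_succ_apply', pow_succ']
    exact pdLin_apply e _ ih

theorem foldr_pd_eq (dir : Fin (d + 2) → Dir d) (α : Fin (d + 2) → ℕ) (f : SmoothFn d)
    {b : FullPhase d → ℂ} (h : EqOn b f (scTFull d)) (l : List (Fin (d + 2))) :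
    EqOn (l.foldr (fun i g => (fun g => pd g (dir i))^[α i] g) b)
      ((l.map fun i => pdLin (dir i) ^ α i).prod f : SmoothFn d) (scTFull d) := by
  induction l with
  | nil => exact h
  | cons i l ih => exact iterate_pd_eq (dir i) (α i) _ ih

/-- The multinomial theorem for a sum of products of commuting elements. -/
theorem sum_smul_mul_pow {R : Type*} [Ring R] [Algebra ℂ R] {n : ℕ} (X Y : Fin n → R)
    (hXX : ∀ i j, Commute (X i) (X j)) (hXY : ∀ i j, Commute (X i) (Y j))
    (hYY : ∀ i j, Commute (Y i) (Y j)) (z : ℂ) (r : ℕ) :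
    (∑ i, z • (X i * Y i)) ^ r = ∑ α ∈ Finset.piAntidiag (Finset.univ : Finset (Fin n)) r,
      ((r.factorial : ℂ) * (z ^ r / ((∏ i, (α i).factorial : ℕ) : ℂ))) •
        (((List.finRange n).map fun i => X i ^ α i).prod *
          ((List.finRange n).map fun i => Y i ^ α i).prod) := by
  have hcomm : ∀ i i', Commute (z • (X i * Y i)) (z • (X i' * Y i')) := fun i i' =>
    ((((hXX _ _).mul_left (hXY _ _).symm).mul_right
      ((hXY _ _).mul_left (hYY _ _))).smul_left _).smul_right _
  have hlist : ∀ (α : Fin n → ℕ) (l : List (Fin n)),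
      (l.map fun i => (z • (X i * Y i)) ^ α i).prod =
      z ^ (l.map α).sum • ((l.map fun i => X i ^ α i).prod *
        (l.map fun i => Y i ^ α i).prod) := by
    intro α l
    induction l with
    | nil => simp
    | cons i l ih =>
      -- The power of Y_i must be moved past the remaining powers of X to separate the two products.
      have hc : Commute ((l.map fun i => X i ^ α i).prod) (Y i ^ α i) := by
        refine (Commute.list_prod_right _ _ fun x hx => ?_).symm
        obtain ⟨i', -, rfl⟩ := List.mem_map.1 hx
        exact (hXY _ _).symm.pow_pow _ _
      simp only [List.map_cons, List.prod_cons, List.sum_cons, ih]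
      rw [smul_pow, (hXY _ _).mul_pow, smul_mul_smul_comm, pow_add]
      congr 1
      simp only [mul_assoc]
      congr 1
      rw [← mul_assoc, ← hc.eq, mul_assoc]
  rw [Finset.sum_pow_eq_sum_piAntidiag_of_commute _ _ fun i _ i' _ _ => hcomm i i']
  refine Finset.sum_congr rfl fun α hα => ?_
  have hsum : ∑ i, α i = r := (Finset.mem_piAntidiag.1 hα).1
  have hprod : ∀ (comm), Finset.noncommProd (Finset.univ : Finset (Fin n))
      (fun i => (z • (X i * Y i)) ^ α i) comm =
      z ^ r • (((List.finRange n).map fun i => X i ^ α i).prod *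
        ((List.finRange n).map fun i => Y i ^ α i).prod) := by
    intro comm
    -- The enumeration of `Fin n` behind `Finset.univ` is `List.finRange n`, so the noncommutative
    -- product is the ordered list product.
    have e : Finset.noncommProd (Finset.univ : Finset (Fin n))
      (fun i => (z • (X i * Y i)) ^ α i) comm =
      ((List.finRange n).map fun i => (z • (X i * Y i)) ^ α i).prod :=
      Multiset.noncommProd_coe _ _
    rw [e, hlist, ← hsum]
    congr 2
  have h5 : ((Nat.multinomial Finset.univ α : ℕ) : ℂ) =
      r.factorial / ((∏ i, (α i).factorial : ℕ) : ℂ) := by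
    have := Nat.multinomial_spec (Finset.univ : Finset (Fin n)) α
    rw [hsum] at this
    rw [eq_div_iff (by exact_mod_cast Finset.prod_ne_zero_iff.2 fun i _ =>
      (α i).factorial_ne_zero), ← this]
    push_cast
    ring
  rw [hprod, ← nsmul_eq_mul, ← Nat.cast_smul_eq_nsmul ℂ, smul_smul, h5]
  congr 1
  ring

theorem sum_smul_apply {ι : Type*} (s : Finset ι) (c : ι → ℂ)
    (T : ι → Module.End ℂ (SmoothFn d)) (f : SmoothFn d) (w : FullPhase d) :
    ((∑ i ∈ s, c i • T i) f : SmoothFn d).1 w = ∑ i ∈ s, c i * (T i f).1 w := by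
  rw [LinearMap.sum_apply, Submodule.coe_sum, Finset.sum_apply]
  rfl

/-- The mixed operator as a linear map. -/
def mixedLin (d : ℕ) : Module.End ℂ (SmoothFn d) :=
  ∑ i, Complex.I • (pdLin (d := d) (dirF i) * pdLin (d := d) (dirZ i))

theorem mixedLin_apply (f : SmoothFn d) : ((mixedLin d f : SmoothFn d) : FullPhase d → ℂ) =
    fun w => ∑ i, Complex.I * (pdLin (dirF i) (pdLin (dirZ i) f) : SmoothFn d).1 w :=
  funext fun w => sum_smul_apply _ _ _ _ w

theorem mixedLin_pow (d r : ℕ) : mixedLin d ^ r =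
    ∑ α ∈ Finset.piAntidiag (Finset.univ : Finset (Fin (d + 2))) r,
      ((r.factorial : ℂ) * (Complex.I ^ r / ((∏ i, (α i).factorial : ℕ) : ℂ))) •
        (((List.finRange (d + 2)).map fun i => pdLin (dirF i) ^ α i).prod *
          ((List.finRange (d + 2)).map fun i => pdLin (dirZ i) ^ α i).prod) := by
  have h := sum_smul_mul_pow (fun i : Fin (d + 2) => pdLin (d := d) (dirF i))
    (fun i => pdLin (d := d) (dirZ i)) (fun _ _ => commute_pdLin _ _)
    (fun _ _ => commute_pdLin _ _) (fun _ _ => commute_pdLin _ _) Complex.I r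
  exact h

theorem partialZ_eq (α : Fin (d + 2) → ℕ) (b : FullPhase d → ℂ) : partialZ α b =
    (List.finRange (d + 2)).foldr (fun i g => (fun g => pd g (dirZ i))^[α i] g) b := rfl

theorem partialZeta_eq (α : Fin (d + 2) → ℕ) (b : FullPhase d → ℂ) : partialZeta α b =
    (List.finRange (d + 2)).foldr (fun i g => (fun g => pd g (dirF i))^[α i] g) b := rfl

theorem mixed_iterate_eq (r : ℕ) (f : SmoothFn d) {b : FullPhase d → ℂ}
    (h : EqOn b f (scTFull d)) :
    EqOn (mixed^[r] b) ((mixedLin d ^ r) f : SmoothFn d) (scTFull d) := by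
  induction r with
  | zero => exact h
  | succ r ih =>
    rw [Function.iterate_succ_apply', pow_succ', Module.End.mul_apply, mixedLin_apply]
    exact fun w hw => Finset.sum_congr rfl fun i _ => by
      rw [pdLin_apply (dirF i) _ (pdLin_apply (dirZ i) _ ih) hw]

theorem atZero_mixed_iterate {b : FullPhase d → ℂ} (hb : ContDiffOn ℝ ∞ b (scTFull d)) (r : ℕ)
    {q : Phase d} (hq : q ∈ scT d) :
    (r.factorial : ℂ)⁻¹ * atZero (mixed^[r] b) q =
      ∑ α ∈ Finset.piAntidiag (Finset.univ : Finset (Fin (d + 2))) r,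
        Complex.I ^ r / ((∏ i, (α i).factorial : ℕ) : ℂ) *
          atZero (partialZeta α (partialZ α b)) q := by
  have hq' : ((q, 0) : FullPhase d) ∈ scTFull d := hq
  set f : SmoothFn d := ⟨b, hb⟩ with hf
  have hbf : EqOn b f (scTFull d) := fun _ _ => rfl
  have h1 := (mixed_iterate_eq r f hbf hq').trans
    ((congrArg (fun T => (T f : SmoothFn d).1 (q, 0)) (mixedLin_pow d r)).trans
      (sum_smul_apply _ _ _ f (q, 0)))
  have h6 : (r.factorial : ℂ) ≠ 0 := by exact_mod_cast r.factorial_ne_zero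
  unfold atZero
  rw [h1, Finset.mul_sum]
  refine Finset.sum_congr rfl fun α _ => ?_
  have h2 := foldr_pd_eq dirZ α f hbf (List.finRange (d + 2))
  have h3 := foldr_pd_eq dirF α _ h2 (List.finRange (d + 2)) hq'
  rw [partialZeta_eq, partialZ_eq, h3, mul_assoc, inv_mul_cancel_left₀ h6]
  rfl

/-- This replaces the multi-index sum by iterates of a single operator, the form produced by
repeated Taylor expansion under the oscillatory integral. -/
theorem expansion_eq {b : FullPhase d → ℂ} {m l k j : ℝ}
    (hb : IsAmp 1 (fun _ => 1) (m, l, k, j) b) (N : ℕ) :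
    EqOn (expansion b N) (fun q => ∑ r ∈ Finset.range N, atZero (rem^[r] b) q) (scT d) :=
  fun q hq => Finset.sum_congr rfl fun r _ => by
    rw [atZero_rem_iterate r hb hq]
    exact (atZero_mixed_iterate hb.smooth r hq).symm

end BBCalculus
end

noncomputable section
namespace BBCalculus
open MeasureTheory Topology Set

variable {d : ℕ}

/-! ### The Fourier transform in `(X,Y)` -/

/-- `e^{i θ · Z}`. -/
def osc (θ Z : Coord d) : ℂ := Complex.exp (Complex.I * ((∑ i, θ i * Z i : ℝ) : ℂ))

theorem norm_osc (θ Z : Coord d) : ‖osc θ Z‖ = 1 := Complex.norm_exp_I_mul_ofReal _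

theorem osc_add (θ θ' Z : Coord d) : osc (θ + θ') Z = osc θ Z * osc θ' Z := by
  unfold osc
  rw [← Complex.exp_add, ← mul_add, ← Complex.ofReal_add, ← Finset.sum_add_distrib]
  simp [add_mul]

theorem osc_comm (θ Z : Coord d) : osc θ Z = osc Z θ := by
  simp only [osc, mul_comm]

@[fun_prop]
theorem continuous_osc {X : Type*} [TopologicalSpace X] {f g : X → Coord d} (hf : Continuous f)
    (hg : Continuous g) : Continuous fun x => osc (f x) (g x) := by
  unfold osc
  fun_prop

theorem hasFDerivAt_osc (θ Z : Coord d) : ∃ L : Coord d →L[ℝ] ℂ,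
    HasFDerivAt (fun Z => osc θ Z) L Z ∧
      ∀ i, L (Pi.single i 1) = Complex.I * θ i * osc θ Z := by
  set T : Coord d →L[ℝ] ℝ := ∑ i, θ i • ContinuousLinearMap.proj i with hT
  have hTe : ∀ Z, T Z = ∑ i, θ i * Z i := fun Z => by simp [hT]
  have h1 : HasFDerivAt (fun Z : Coord d => Complex.I * ((T Z : ℝ) : ℂ))
      (Complex.I • Complex.ofRealCLM.comp T) Z :=
    ((Complex.ofRealCLM.hasFDerivAt).comp Z T.hasFDerivAt).const_mul _
  have h2 := h1.cexp
  simp only [hTe] at h2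
  refine ⟨_, h2, ?_⟩
  · intro i
    have : T (Pi.single i 1) = θ i := by simp [hTe, Pi.single_apply]
    simp [this, osc]
    ring

/-- The Fourier transform in `(X,Y)`. -/
def ft (c : FullPhase d → ℂ) (θ : Coord d) (w : FullPhase d) : ℂ := ∫ Z, osc θ Z * c (w.1, Z)

theorem ft_congr {c g : FullPhase d → ℂ} (h : EqOn c g (scTFull d)) (θ : Coord d)
    {w : FullPhase d} (hw : w ∈ scTFull d) : ft c θ w = ft g θ w := by
  unfold ft
  congr 1
  ext Z
  rw [h (show (w.1, Z) ∈ scTFull d from hw)]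

section

variable {D : Coord d → ℝ} {o : ℝ} {μ : Order} {c : FullPhase d → ℂ} {w : FullPhase d}

theorem continuous_slice (hc : ContDiffOn ℝ ∞ c (scTFull d)) (hw : w ∈ scTFull d) :
    Continuous fun Z => c (w.1, Z) :=
  hc.continuousOn.comp_continuous (by fun_prop) fun _ => hw

theorem IsAmp.integrable_slice (hD : Integrable D) (hc : IsAmp o D μ c) (hw : w ∈ scTFull d) :
    Integrable fun Z => c (w.1, Z) := by
  obtain ⟨C, -, H⟩ := hc.bd {w.1.1} isCompact_singleton
  exact (hD.const_mul (C * wt μ w.1)).mono' (continuous_slice hc.smooth hw).aestronglyMeasurable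
    (Filter.Eventually.of_forall fun Z => H (w.1, Z) hw rfl)

theorem Integrable.osc_mul {f : Coord d → ℂ} (hf : Integrable f) (θ : Coord d) :
    Integrable fun Z => osc θ Z * f Z :=
  hf.bdd_mul (c := 1) (by fun_prop : Continuous fun Z : Coord d => osc θ Z).aestronglyMeasurable
    (Filter.Eventually.of_forall fun Z => (norm_osc θ Z).le)

theorem hasFDerivAt_slice (hc : ContDiffOn ℝ ∞ c (scTFull d)) (hw : w ∈ scTFull d)
    (Z : Coord d) : HasFDerivAt (fun Z => c (w.1, Z))
      ((fderiv ℝ c (w.1, Z)).comp (ContinuousLinearMap.inr ℝ _ _)) Z := by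
  have h1 : DifferentiableAt ℝ c (w.1, Z) := hc.differentiableAt_scTFull hw
  exact h1.hasFDerivAt.comp Z (hasFDerivAt_prodMk_right w.1 Z)

/-- Integration by parts in Z_i, whose derivative of e^{iθ·Z} produces iθ_i. -/
theorem mul_ft (hD : Integrable D) (hc : IsAmp o D μ c) (θ : Coord d) (i : Fin (d + 2))
    (hw : w ∈ scTFull d) : (θ i : ℂ) * ft c θ w = Complex.I * ft (pd c (dirZ i)) θ w := by
  have e1 : ∀ Z, fderiv ℝ (fun Z => c (w.1, Z)) Z (Pi.single i 1) = pd c (dirZ i) (w.1, Z) :=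
    fun Z => by rw [(hasFDerivAt_slice hc.smooth hw Z).fderiv]; rfl
  have e2 : ∀ Z, fderiv ℝ (fun Z => osc θ Z) Z (Pi.single i 1) = Complex.I * θ i * osc θ Z :=
    fun Z => by
      obtain ⟨L, hL, h⟩ := hasFDerivAt_osc θ Z
      rw [hL.fderiv, h]
  have i1 := Integrable.osc_mul (hc.integrable_slice hD hw) θ
  have i2 := Integrable.osc_mul ((hc.pd (dirZ i)).integrable_slice hD hw) θ
  have key := integral_mul_fderiv_eq_neg_fderiv_mul_of_integrable (μ := volume)
    (f := fun Z => osc θ Z) (g := fun Z => c (w.1, Z)) (v := Pi.single i 1)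
    (by
      simp only [e2, mul_assoc]
      exact (i1.const_mul _).const_mul _)
    (by simpa only [e1] using i2) i1
    (fun Z _ => (hasFDerivAt_osc θ Z).choose_spec.1.differentiableAt)
    (fun Z _ => (hasFDerivAt_slice hc.smooth hw Z).differentiableAt)
  simp only [e1, e2, mul_assoc, integral_const_mul] at key
  simp only [ft, key]
  linear_combination (θ i : ℂ) * (∫ Z, osc θ Z * c (w.1, Z)) * Complex.I_sq

theorem IsAmp.pdZ (hc : IsAmp 0 D μ c) (i : Fin (d + 2)) : IsAmp 0 D μ (BBCalculus.pd c (dirZ i)) := by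
  have e : ord (d := d) 0 (dirZ i) = 0 := by
    simp only [ord, neg_zero]
    rfl
  simpa [e] using hc.pd (dirZ i)

/-- The Fourier transform in `(X,Y)` decays rapidly. -/
theorem exists_ft_bound (hD : Integrable D) (hc : IsAmp 0 D μ c) (k : ℕ) {B : Set (Coord d)}
    (hB : IsCompact B) : ∃ C : ℝ, 0 ≤ C ∧ ∀ w ∈ scTFull d, w.1.1 ∈ B → ∀ θ,
      (1 + ‖θ‖) ^ k * ‖ft c θ w‖ ≤ C * wt μ w.1 := by
  induction k generalizing c with
  | zero =>
    obtain ⟨C, hC, H⟩ := hc.bd B hB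
    refine ⟨C * |∫ Z, D Z|, by positivity, fun w hw hwB θ => ?_⟩
    rw [pow_zero, one_mul]
    calc ‖ft c θ w‖ ≤ ∫ Z, C * wt μ w.1 * D Z :=
          norm_integral_le_of_norm_le (hD.const_mul _) (Filter.Eventually.of_forall fun Z => by
            rw [norm_mul, norm_osc, one_mul]
            exact H (w.1, Z) hw hwB)
      _ ≤ C * |∫ Z, D Z| * wt μ w.1 := by
          rw [integral_const_mul]
          have := mul_le_mul_of_nonneg_left (le_abs_self (∫ Z, D Z))
            (mul_nonneg hC (wt_pos μ hw).le)
          linarith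
  | succ k ih =>
    obtain ⟨C, hC, H⟩ := ih hc
    -- One more factor 1+‖θ‖ costs one derivative in Z, which with o = 0 keeps both the order and
    -- the decay.
    choose C' hC' H' using fun i => ih (hc.pdZ i)
    refine ⟨C + ∑ i, C' i, add_nonneg hC (Finset.sum_nonneg fun i _ => hC' i),
      fun w hw hwB θ => ?_⟩
    have h1 : ‖θ‖ * ‖ft c θ w‖ ≤ ∑ i, ‖ft (pd c (dirZ i)) θ w‖ := by
      have h2 : ‖θ‖ ≤ ∑ i, ‖θ i‖ := (pi_norm_le_iff_of_nonneg
        (Finset.sum_nonneg fun i _ => norm_nonneg _)).2 fun i =>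
          Finset.single_le_sum (f := fun i => ‖θ i‖) (fun i _ => norm_nonneg _)
            (Finset.mem_univ i)
      refine (mul_le_mul_of_nonneg_right h2 (norm_nonneg _)).trans ?_
      rw [Finset.sum_mul]
      refine Finset.sum_le_sum fun i _ => ?_
      have := congrArg norm (mul_ft hD hc θ i hw)
      rw [norm_mul, norm_mul, Complex.norm_I, one_mul, Complex.norm_real] at this
      exact this.le
    calc (1 + ‖θ‖) ^ (k + 1) * ‖ft c θ w‖
        = (1 + ‖θ‖) ^ k * (‖ft c θ w‖ + ‖θ‖ * ‖ft c θ w‖) := by ring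
      _ ≤ (1 + ‖θ‖) ^ k * (‖ft c θ w‖ + ∑ i, ‖ft (pd c (dirZ i)) θ w‖) := by gcongr
      _ = (1 + ‖θ‖) ^ k * ‖ft c θ w‖ +
          ∑ i, (1 + ‖θ‖) ^ k * ‖ft (pd c (dirZ i)) θ w‖ := by rw [mul_add, Finset.mul_sum]
      _ ≤ C * wt μ w.1 + ∑ i, C' i * wt μ w.1 :=
          add_le_add (H w hw hwB θ) (Finset.sum_le_sum fun i _ => H' i w hw hwB θ)
      _ = _ := by rw [add_mul, Finset.sum_mul]

/-- The derivatives in the base and in the fibre; `0` for the other labels. -/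
def pdB (c : FullPhase d → ℂ) : Dir d → FullPhase d → ℂ
  | .inl i => pd c (.inl i)
  | .inr (.inl i) => pd c (dirF i)
  | .inr (.inr _) => fun _ => 0

theorem IsAmp.pdB (hc : IsAmp o D μ c) (e : Dir d) : IsAmp o D (μ + ord o e) (pdB c e) := by
  rcases e with i | i | i
  · exact hc.pd _
  · exact hc.pd _
  · exact IsAmp.zero

theorem pd_slice (hc : ContDiffOn ℝ ∞ c (scTFull d)) (hw : w ∈ scTFull d) (Z : Coord d) (z : ℂ) :
    DifferentiableAt ℝ (fun w : FullPhase d => z * c (w.1, Z)) w ∧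
      ∀ e, pd (fun w : FullPhase d => z * c (w.1, Z)) e w = z * pdB c e (w.1, Z) := by
  have h1 : DifferentiableAt ℝ c (w.1, Z) := hc.differentiableAt_scTFull hw
  have h2 : HasFDerivAt (fun w : FullPhase d => ((w.1, Z) : FullPhase d))
      ((ContinuousLinearMap.fst ℝ _ _).prod 0) w :=
    (ContinuousLinearMap.fst ℝ _ _).hasFDerivAt.prodMk (hasFDerivAt_const Z w)
  have h3 := (h1.hasFDerivAt.comp (f := fun w : FullPhase d => ((w.1, Z) : FullPhase d))
    w h2).const_mul z
  refine ⟨h3.differentiableAt, fun e => ?_⟩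
  have h4 : fderiv ℝ (fun w : FullPhase d => z * c (w.1, Z)) w = _ := h3.fderiv
  simp only [pd, act, h4]
  rcases e with i | i | i <;> simp [pdB, pd, act, vec]
  right
  exact (fderiv ℝ c (w.1, Z)).map_zero

theorem ft_diff (hD : Integrable D) (hD0 : ∀ Z, 0 ≤ D Z) (hc : IsAmp o D μ c) (θ : Coord d)
    (hw : w ∈ scTFull d) : DifferentiableAt ℝ (ft c θ) w ∧
      ∀ e, pd (ft c θ) e w = ft (pdB c e) θ w := by
  choose s hs hss C hC H using fun e => (hc.pdB e).bd.exists_nhds hD0 hw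
  have hmem : (⋂ e, s e) ∈ 𝓝 w := Filter.iInter_mem.2 hs
  have hsub : ∀ w' ∈ ⋂ e, s e, w' ∈ scTFull d := fun w' hw' => hss (.inl 0) (mem_iInter.1 hw' _)
  have hm : ∀ {c : FullPhase d → ℂ}, ContDiffOn ℝ ∞ c (scTFull d) → ∀ w ∈ scTFull d,
      AEStronglyMeasurable (fun Z => osc θ Z * c (w.1, Z)) := fun hc w hw =>
    ((by fun_prop : Continuous fun Z : Coord d => osc θ Z).mul
      (continuous_slice hc hw)).aestronglyMeasurable
  have key := differentiableAt_integral (ν := volume) (F := fun w Z => osc θ Z * c (w.1, Z))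
    (bound := fun Z => (∑ e, C e) * D Z) hmem
    (fun Z w' hw' => (pd_slice hc.smooth (hsub w' hw') Z _).1)
    (fun w' hw' => hm hc.smooth w' (hsub w' hw'))
    (Integrable.osc_mul (hc.integrable_slice hD hw) θ)
    (fun e => by
      simp only [fun Z => (pd_slice hc.smooth hw Z (osc θ Z)).2 e]
      exact hm (hc.pdB e).smooth w hw)
    (Filter.Eventually.of_forall fun Z w' hw' e => by
      rw [(pd_slice hc.smooth (hsub w' hw') Z (osc θ Z)).2 e, norm_mul, norm_osc, one_mul]
      refine (H e w' (mem_iInter.1 hw' e) _).trans ?_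
      exact mul_le_mul_of_nonneg_right
        (Finset.single_le_sum (fun e _ => hC e) (Finset.mem_univ e)) (hD0 Z))
    (hD.const_mul _)
  refine ⟨key.1, fun e => (key.2 e).trans ?_⟩
  simp only [fun Z => (pd_slice hc.smooth hw Z (osc θ Z)).2 e]
  rfl

end

end BBCalculus
end

noncomputable section
namespace BBCalculus
open MeasureTheory Topology Set

variable {d : ℕ}

/-! ### The reduction of an amplitude -/

/-- An integrable weight on `ℝ^n`. -/
def decay (θ : Coord d) : ℝ := ((1 + ‖θ‖) ^ (d + 3))⁻¹

theorem decay_pos (θ : Coord d) : 0 < decay θ := by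
  unfold decay
  positivity

theorem integrable_decay : Integrable (decay : Coord d → ℝ) := by
  -- The exponent d+3 is the first integer above the dimension d+2.
  have h := integrable_one_add_norm (E := Coord d) (μ := volume) (r := d + 3)
    (by simp; norm_num)
  refine h.congr (Filter.Eventually.of_forall fun θ => ?_)
  simp only [decay]
  rw [Real.rpow_neg (by positivity), ← Real.rpow_natCast]
  norm_num

/-- The point of the bundle with the fibre coordinate shifted by `(X,Y)`. -/
def shiftPt (w : FullPhase d) : FullPhase d := ((w.1.1, w.1.2 + w.2), 0)

/-- `∫ e^{iθZ} c(p,ζ+θ,Z) dZ`, as a function of `((p,ζ),θ)`. -/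
def shifted (c : FullPhase d → ℂ) (w : FullPhase d) : ℂ := ft c w.2 (shiftPt w)

/-- The reduced amplitude `∫∫ e^{iθZ} c(p,ζ+θ,Z) dZ dθ`, up to a constant. -/
def reduced (c : FullPhase d → ℂ) (w : FullPhase d) : ℂ := ∫ θ, shifted c (w.1, θ)

section

variable {D : Coord d → ℝ} {o : ℝ} {μ : Order} {c g : FullPhase d → ℂ} {w : FullPhase d}

theorem reduced_congr (h : EqOn c g (scTFull d)) (hw : w ∈ scTFull d) :
    reduced c w = reduced g w := by
  unfold reduced
  congr 1
  ext θ
  exact ft_congr h _ hw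

/-- The Fourier bound is used with exponent k+(d+3): k powers pay for moving the weight from ζ+θ
back to ζ, and d+3 powers make the result integrable in θ. -/
theorem bd_shifted (hD : Integrable D) (hc : IsAmp 0 D μ c) : Bd decay μ (shifted c) := by
  intro B hB
  obtain ⟨K, hK, k, T⟩ := temperate_wt (d := d) μ
  obtain ⟨C, hC, H⟩ := exists_ft_bound hD hc (k + (d + 3)) hB
  refine ⟨C * K, mul_nonneg hC (by linarith), fun w hw hwB => ?_⟩
  have h1 := H (shiftPt w) hw hwB w.2
  have h2 := T w.1 hw w.2
  have h3 : 0 < (1 + ‖w.2‖) ^ k := by positivity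
  have h4 : 0 < (1 + ‖w.2‖) ^ (d + 3) := by positivity
  have h5 : (1 + ‖w.2‖) ^ k * ((1 + ‖w.2‖) ^ (d + 3) * ‖shifted c w‖) ≤
      (1 + ‖w.2‖) ^ k * (C * K * wt μ w.1) := by
    calc _ = (1 + ‖w.2‖) ^ (k + (d + 3)) * ‖ft c w.2 (shiftPt w)‖ := by
          rw [pow_add, shifted]
          ring
      _ ≤ C * (K * (1 + ‖w.2‖) ^ k * wt μ w.1) :=
          h1.trans (mul_le_mul_of_nonneg_left h2 hC)
      _ = _ := by ring
  have h6 := le_of_mul_le_mul_left h5 h3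
  rw [decay, le_mul_inv_iff₀ h4]
  linarith

theorem shifted_diff (hD : Integrable D) (hD0 : ∀ Z, 0 ≤ D Z) (hc : IsAmp o D μ c) (θ : Coord d)
    (hw : w ∈ scTFull d) : DifferentiableAt ℝ (fun w : FullPhase d => shifted c (w.1, θ)) w ∧
      ∀ e, pd (fun w : FullPhase d => shifted c (w.1, θ)) e w = shifted (pdB c e) (w.1, θ) := by
  set S : FullPhase d →L[ℝ] FullPhase d :=
    (ContinuousLinearMap.fst ℝ _ _).prod 0 with hS
  have hSw : ∀ w : FullPhase d, shiftPt (w.1, θ) = S w + ((0, θ), 0) := fun w => by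
    simp [hS, shiftPt]
    ext <;> simp
  have h0 := ft_diff hD hD0 hc θ (w := shiftPt (w.1, θ)) hw
  have h1 : HasFDerivAt (fun w : FullPhase d => shiftPt (w.1, θ)) S w := by
    simp only [hSw]
    exact S.hasFDerivAt.add_const _
  have h2 := h0.1.hasFDerivAt.comp (f := fun w : FullPhase d => shiftPt (w.1, θ)) w h1
  refine ⟨h2.differentiableAt, fun e => ?_⟩
  have h3 : fderiv ℝ (fun w : FullPhase d => shifted c (w.1, θ)) w = _ := h2.fderiv
  have h4 := h0.2 e
  rw [pd, act, h3, shifted, ContinuousLinearMap.comp_apply]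
  simp only [pd, act] at h4
  rcases e with i | i | i
  · rw [← h4]; simp [hS, vec]
  · rw [← h4]; simp [hS, vec]
  · have : S (vec (.inr (.inr i))) = 0 := by simp [hS, vec]
    rw [this, map_zero]
    simp [pdB, ft]

theorem aestronglyMeasurable_shifted (hc : ContDiffOn ℝ ∞ c (scTFull d)) (hw : w ∈ scTFull d) :
    AEStronglyMeasurable (fun θ => shifted c (w.1, θ)) := by
  have h : Continuous fun x : Coord d × Coord d =>
      osc x.1 x.2 * c ((w.1.1, w.1.2 + x.1), x.2) :=
    Continuous.mul (by fun_prop) (hc.continuousOn.comp_continuous (by fun_prop) fun _ => hw)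
  exact (h.stronglyMeasurable.integral_prod_right (ν := volume)).aestronglyMeasurable

theorem integrable_shifted (hD : Integrable D) (hc : IsAmp 0 D μ c) (hw : w ∈ scTFull d) :
    Integrable fun θ => shifted c (w.1, θ) := by
  obtain ⟨C, -, H⟩ := bd_shifted hD hc {w.1.1} isCompact_singleton
  exact (integrable_decay.const_mul (C * wt μ w.1)).mono'
    (aestronglyMeasurable_shifted hc.smooth hw)
    (Filter.Eventually.of_forall fun Z => H (w.1, Z) hw rfl)

theorem reduced_diff (hD : Integrable D) (hD0 : ∀ Z, 0 ≤ D Z) (hc : IsAmp 0 D μ c)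
    (hw : w ∈ scTFull d) : DifferentiableAt ℝ (reduced c) w ∧
      ∀ e, pd (reduced c) e w = reduced (pdB c e) w := by
  choose s hs hss C hC H using fun e =>
    (bd_shifted hD (hc.pdB e)).exists_nhds (fun θ => (decay_pos θ).le) hw
  have hmem : (⋂ e, s e) ∈ 𝓝 w := Filter.iInter_mem.2 hs
  have hsub : ∀ w' ∈ ⋂ e, s e, w' ∈ scTFull d := fun w' hw' => hss (.inl 0) (mem_iInter.1 hw' _)
  have key := differentiableAt_integral (ν := volume) (F := fun w θ => shifted c (w.1, θ))
    (bound := fun θ => (∑ e, C e) * decay θ) hmem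
    (fun θ w' hw' => (shifted_diff hD hD0 hc θ (hsub w' hw')).1)
    (fun w' hw' => aestronglyMeasurable_shifted hc.smooth (hsub w' hw'))
    (integrable_shifted hD hc hw)
    (fun e => by
      simp only [fun θ => (shifted_diff hD hD0 hc θ hw).2 e]
      exact aestronglyMeasurable_shifted (hc.pdB e).smooth hw)
    (Filter.Eventually.of_forall fun θ w' hw' e => by
      rw [(shifted_diff hD hD0 hc θ (hsub w' hw')).2 e]
      refine (H e w' (mem_iInter.1 hw' e) _).trans ?_
      exact mul_le_mul_of_nonneg_right
        (Finset.single_le_sum (fun e _ => hC e) (Finset.mem_univ e)) (decay_pos θ).le)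
    (integrable_decay.const_mul _)
  refine ⟨key.1, fun e => (key.2 e).trans ?_⟩
  simp only [fun θ => (shifted_diff hD hD0 hc θ hw).2 e]
  rfl

/-- The reduced amplitude does not depend on `(X,Y)`, and the order is preserved. -/
theorem isAmp_reduced (hD : Integrable D) (hD0 : ∀ Z, 0 ≤ D Z) (hc : IsAmp 0 D μ c) (o : ℝ) :
    IsAmp o (fun _ => 1) μ (reduced c) := by
  refine IsAmp.of_stable_diff (fun μ f => f = (fun _ => 0) ∨ ∃ c, IsAmp 0 D μ c ∧ f = reduced c)
    ?_ ?_ ?_ (Or.inr ⟨c, hc, rfl⟩)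
  · rintro μ _ (rfl | ⟨c, hc, rfl⟩) w hw
    · exact differentiableAt_const _
    · exact (reduced_diff hD hD0 hc hw).1
  · rintro μ _ (rfl | ⟨c, hc, rfl⟩) B hB
    · exact ⟨0, le_rfl, fun w _ _ => by simp⟩
    · obtain ⟨C, hC, H⟩ := bd_shifted hD hc B hB
      refine ⟨C * ∫ θ : Coord d, decay θ, mul_nonneg hC
        (integral_nonneg fun θ => (decay_pos θ).le), fun w hw hwB => ?_⟩
      calc ‖reduced c w‖ ≤ ∫ θ, C * wt μ w.1 * decay θ :=
            norm_integral_le_of_norm_le (integrable_decay.const_mul _)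
              (Filter.Eventually.of_forall fun θ => H (w.1, θ) hw hwB)
        _ = _ := by
            rw [integral_const_mul]
            ring
  · rintro μ _ (rfl | ⟨c, hc, rfl⟩) e
    · exact ⟨_, Or.inl rfl, fun w _ => act_const 0⟩
    · rcases e with i | i | i
      · exact ⟨_, Or.inr ⟨_, hc.pd (.inl i), rfl⟩, fun w hw => (reduced_diff hD hD0 hc hw).2 _⟩
      · exact ⟨_, Or.inr ⟨_, hc.pd (dirF i), rfl⟩, fun w hw => (reduced_diff hD hD0 hc hw).2 _⟩
      · refine ⟨_, Or.inl rfl, fun w hw => ((reduced_diff hD hD0 hc hw).2 _).trans ?_⟩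
        simp [reduced, shifted, ft, pdB]

end

end BBCalculus
end

/-! ### Producing decay in (X,Y). -/

noncomputable section
namespace BBCalculus
open MeasureTheory Topology Set

variable {d : ℕ}

/-! ### Functions of `(X,Y)` as amplitudes -/

theorem ord_dirZ (i : Fin (d + 2)) : ord 0 (dirZ i) = 0 := by
  simp only [ord, neg_zero]
  rfl

theorem wtLe_of_le {D D' : Coord d → ℝ} {C : ℝ} (hC : 0 ≤ C) (h : ∀ Z, D Z ≤ C * D' Z)
    (μ : Order) : WtLe D D' μ μ := fun _ _ =>
  ⟨C, hC, fun w hw _ => by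
    have := mul_le_mul_of_nonneg_left (h w.2) (wt_pos μ hw).le
    linarith⟩

theorem Est.mono_decay {o : ℝ} {D D' : Coord d → ℝ} (h : ∀ Z, D Z ≤ D' Z) {n : ℕ} {μ : Order}
    {c : FullPhase d → ℂ} (hc : Est o D n μ c) : Est o D' n μ c := by
  have hb : ∀ {μ c}, Bd D μ c → Bd D' μ c := fun hc =>
    Bd.mono hc (wtLe_of_le zero_le_one (fun Z => by simpa using h Z) _)
  induction n generalizing μ c with
  | zero => exact hb hc
  | succ n ih => exact ⟨hb hc.1, fun e => ih (hc.2 e)⟩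

theorem pd_snd {g : Coord d → ℂ} {w : FullPhase d} (hg : DifferentiableAt ℝ g w.2) (e : Dir d) :
    pd (fun w => g w.2) e w = fderiv ℝ g w.2 (vec e).2 := by
  have h : HasFDerivAt (fun w : FullPhase d => g w.2) _ w :=
    hg.hasFDerivAt.comp w (ContinuousLinearMap.snd ℝ (Phase d) (Coord d)).hasFDerivAt
  rw [pd, act, h.fderiv]
  rfl

/-- The derivatives of φ are again Schwartz but carry no power of x, which forces the gain parameter
0. -/
theorem isAmp_schwartz (φ : 𝓢(Coord d, ℂ)) : IsAmp 0 decay 0 (fun w : FullPhase d => φ w.2) := by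
  refine IsAmp.of_stable (fun μ c => c = (fun _ => 0) ∨
    μ = 0 ∧ ∃ φ : 𝓢(Coord d, ℂ), c = fun w : FullPhase d => φ w.2) ?_ ?_ ?_ (Or.inr ⟨rfl, φ, rfl⟩)
  · rintro μ _ (rfl | ⟨rfl, φ, rfl⟩)
    · exact contDiffOn_const
    · exact ((φ.smooth ⊤).comp contDiff_snd).contDiffOn
  · rintro μ _ (rfl | ⟨rfl, φ, rfl⟩) B -
    · exact ⟨0, le_rfl, fun w _ _ => by simp⟩
    · have h := SchwartzMap.one_add_le_sup_seminorm_apply (𝕜 := ℝ) (m := (d + 3, 0)) (k := d + 3)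
        (n := 0) le_rfl le_rfl φ
      simp only [norm_iteratedFDeriv_zero] at h
      refine ⟨_, le_trans (by positivity) (h 0), fun w _ _ => ?_⟩
      rw [wt_zero, mul_one, decay, le_mul_inv_iff₀ (by positivity), mul_comm]
      exact h w.2
  · rintro μ _ (rfl | ⟨rfl, φ, rfl⟩) e
    · exact ⟨_, Or.inl rfl, fun w _ => act_const 0⟩
    · have key : ∀ e, EqOn (pd (fun w : FullPhase d => φ w.2) e)
          (fun w => fderiv ℝ φ w.2 (vec e).2) (scTFull d) :=
        fun e w _ => pd_snd φ.differentiableAt e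
      rcases e with i | i | i
      · exact ⟨_, Or.inl rfl, fun w hw => (key _ hw).trans (by simp [vec])⟩
      · exact ⟨_, Or.inl rfl, fun w hw => (key _ hw).trans (by simp [vec])⟩
      · refine ⟨_, Or.inr ⟨by rw [ord_dirZ, add_zero],
          LineDeriv.lineDerivOp (Pi.single i 1 : Coord d) φ, rfl⟩, fun w hw => (key _ hw).trans ?_⟩
        rw [SchwartzMap.lineDerivOp_apply_eq_fderiv]
        rfl

/-- `(1 + |Z|²)⁻¹`. -/
def japInv (Z : Coord d) : ℝ := (1 + ∑ i, Z i ^ 2)⁻¹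

theorem one_le_jap (Z : Coord d) : 1 ≤ 1 + ∑ i, Z i ^ 2 := by
  have : 0 ≤ ∑ i, Z i ^ 2 := Finset.sum_nonneg fun i _ => sq_nonneg _
  linarith

theorem japInv_pos (Z : Coord d) : 0 < japInv Z :=
  inv_pos.2 (lt_of_lt_of_le one_pos (one_le_jap Z))

theorem japInv_le_one (Z : Coord d) : japInv Z ≤ 1 := inv_le_one_of_one_le₀ (one_le_jap Z)

theorem abs_mul_japInv_le_one (Z : Coord d) (i : Fin (d + 2)) : |Z i * japInv Z| ≤ 1 := by
  have h1 : Z i ^ 2 ≤ ∑ i, Z i ^ 2 :=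
    Finset.single_le_sum (f := fun i => Z i ^ 2) (fun i _ => sq_nonneg _) (Finset.mem_univ i)
  rw [abs_mul, abs_of_pos (japInv_pos Z), japInv, ← div_eq_mul_inv,
    div_le_one (lt_of_lt_of_le one_pos (one_le_jap Z)), abs_le]
  constructor <;> nlinarith [sq_nonneg (Z i - 1), sq_nonneg (Z i + 1)]

theorem japInv_pow_le (Z : Coord d) : japInv Z ^ (d + 3) ≤ 2 ^ (d + 3) * decay Z := by
  have h0 : ‖Z‖ ^ 2 ≤ ∑ i, Z i ^ 2 := by
    refine (Real.le_sqrt (norm_nonneg _) (Finset.sum_nonneg fun i _ => sq_nonneg _)).1 ?_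
    refine (pi_norm_le_iff_of_nonneg (Real.sqrt_nonneg _)).2 fun i => Real.abs_le_sqrt ?_
    exact Finset.single_le_sum (f := fun i => Z i ^ 2) (fun i _ => sq_nonneg _)
      (Finset.mem_univ i)
  have h1 : japInv Z ≤ 2 * (1 + ‖Z‖)⁻¹ := by
    rw [japInv, ← div_eq_mul_inv, inv_eq_one_div,
      div_le_div_iff₀ (lt_of_lt_of_le one_pos (one_le_jap Z)) (by positivity)]
    nlinarith [sq_nonneg (‖Z‖ - 1), norm_nonneg Z]
  calc japInv Z ^ (d + 3) ≤ (2 * (1 + ‖Z‖)⁻¹) ^ (d + 3) :=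
        pow_le_pow_left₀ (japInv_pos Z).le h1 _
    _ = _ := by rw [mul_pow, inv_pow, decay]

theorem contDiff_japInv : ContDiff ℝ ∞ (japInv : Coord d → ℝ) := by
  unfold japInv
  exact ContDiff.inv (by fun_prop) fun Z => (lt_of_lt_of_le one_pos (one_le_jap Z)).ne'

theorem fderiv_japInv (Z v : Coord d) :
    fderiv ℝ japInv Z v = -2 * (∑ i, Z i * v i) * japInv Z ^ 2 := by
  have h1 : ∀ i, HasFDerivAt (fun Z : Coord d => Z i ^ 2) ((2 * Z i) •
      (ContinuousLinearMap.proj i : Coord d →L[ℝ] ℝ)) Z := fun i => by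
    simpa using (ContinuousLinearMap.proj (R := ℝ) (φ := fun _ : Fin (d + 2) => ℝ)
      i).hasFDerivAt.pow (x := Z) 2
  have h2 := (HasFDerivAt.fun_sum fun i (_ : i ∈ Finset.univ) => h1 i).const_add 1
  have h3 : HasFDerivAt (japInv : Coord d → ℝ) _ Z :=
    (hasDerivAt_inv (lt_of_lt_of_le one_pos (one_le_jap Z)).ne').comp_hasFDerivAt Z h2
  rw [h3.fderiv]
  simp [japInv, Finset.mul_sum, Finset.sum_mul]
  refine Finset.sum_congr rfl fun i _ => by ring

/-- `(1 + |Z|²)⁻¹` as an amplitude. -/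
def japAmp (w : FullPhase d) : ℂ := (japInv w.2 : ℝ)

/-- `Z_i (1 + |Z|²)⁻¹` as an amplitude. -/
def japAmpZ (i : Fin (d + 2)) (w : FullPhase d) : ℂ := (w.2 i * japInv w.2 : ℝ)

theorem contDiff_japAmp : ContDiff ℝ ∞ (japAmp : FullPhase d → ℂ) :=
  Complex.ofRealCLM.contDiff.comp (contDiff_japInv.comp contDiff_snd)

theorem contDiff_japAmpZ (i : Fin (d + 2)) : ContDiff ℝ ∞ (japAmpZ i : FullPhase d → ℂ) :=
  Complex.ofRealCLM.contDiff.comp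
    (ContDiff.mul (f := fun w : FullPhase d => w.2 i) (by fun_prop)
      (contDiff_japInv.comp contDiff_snd))

theorem pd_japAmp (e : Dir d) (w : FullPhase d) : pd japAmp e w =
    ((-2 * (∑ i, w.2 i * (vec e).2 i) * japInv w.2 ^ 2 : ℝ) : ℂ) := by
  have h1 : DifferentiableAt ℝ (japInv : Coord d → ℝ) w.2 :=
    contDiff_japInv.differentiable (by simp) _
  have h2 := pd_snd (g := fun Z => ((japInv Z : ℝ) : ℂ))
    ((Complex.ofRealCLM.differentiableAt).comp w.2 h1) e
  have h3 := (Complex.ofRealCLM.hasFDerivAt.comp w.2 h1.hasFDerivAt).fderiv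
  rw [← fderiv_japInv]
  refine h2.trans ?_
  exact congrArg (fun L : Coord d →L[ℝ] ℂ => L (vec e).2) h3

theorem pd_japAmpZ (j : Fin (d + 2)) (e : Dir d) (w : FullPhase d) : pd (japAmpZ j) e w =
    ((w.2 j * (-2 * (∑ i, w.2 i * (vec e).2 i) * japInv w.2 ^ 2) +
      japInv w.2 * (vec e).2 j : ℝ) : ℂ) := by
  have h1 : DifferentiableAt ℝ (japInv : Coord d → ℝ) w.2 :=
    contDiff_japInv.differentiable (by simp) _
  have h1' := ((ContinuousLinearMap.proj (R := ℝ) (φ := fun _ : Fin (d + 2) => ℝ)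
    j).hasFDerivAt (x := w.2)).mul h1.hasFDerivAt
  have h2 := pd_snd (g := fun Z => ((Z j * japInv Z : ℝ) : ℂ))
    ((Complex.ofRealCLM.differentiableAt).comp w.2 h1'.differentiableAt) e
  have h3 := (Complex.ofRealCLM.hasFDerivAt.comp w.2 h1').fderiv
  rw [← fderiv_japInv]
  refine h2.trans ?_
  exact congrArg (fun L : Coord d →L[ℝ] ℂ => L (vec e).2) h3

theorem bd_japAmp : Bd japInv 0 (japAmp : FullPhase d → ℂ) := fun _ _ =>
  ⟨1, zero_le_one, fun w _ _ => by
    rw [wt_zero, japAmp, Complex.norm_real, Real.norm_of_nonneg (japInv_pos _).le]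
    simp⟩

theorem bd_japAmpZ (i : Fin (d + 2)) : Bd (fun _ => 1) 0 (japAmpZ i : FullPhase d → ℂ) :=
  fun _ _ => ⟨1, zero_le_one, fun w _ _ => by
    rw [wt_zero, japAmpZ, Complex.norm_real, Real.norm_eq_abs]
    simpa using abs_mul_japInv_le_one w.2 i⟩

/-- With u = (1+|Z|²)⁻¹ and v_i = Z_i u, one has ∂_i u = -2v_i u and ∂_i v_j = -2v_i v_j + δ_{ij}u.
The system is closed under differentiation, so both estimates are proved together. -/
theorem est_japAmp (n : ℕ) : Est 0 japInv n 0 (japAmp : FullPhase d → ℂ) ∧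
    ∀ i, Est 0 (fun _ => 1) n 0 (japAmpZ i : FullPhase d → ℂ) := by
  induction n with
  | zero => exact ⟨bd_japAmp, bd_japAmpZ⟩
  | succ n ih =>
    have hu := contDiff_japAmp (d := d).contDiffOn (s := scTFull d)
    have hv := fun i => (contDiff_japAmpZ (d := d) i).contDiffOn (s := scTFull d)
    have hz : ∀ (D : Coord d → ℝ) (μ : Order), Est 0 D n μ fun _ : FullPhase d => (0 : ℂ) :=
      fun _ _ => IsAmp.zero.est n
    have hk : ∀ z : ℂ, Est 0 (fun _ : Coord d => 1) n 0 fun _ : FullPhase d => z :=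
      fun z => (IsAmp.const z).est n
    refine ⟨⟨bd_japAmp, fun e => ?_⟩, fun j => ⟨bd_japAmpZ j, fun e => ?_⟩⟩
    · rcases e with i | i | i
      · exact (hz _ _).congr fun w _ => (pd_japAmp _ w).trans (by simp [vec])
      · exact (hz _ _).congr fun w _ => (pd_japAmp _ w).trans (by simp [vec])
      · have := (hk (-2)).mul ((ih.2 i).mul ih.1 (hv i) hu) contDiffOn_const ((hv i).mul hu)
        rw [ord_dirZ]
        simp only [one_mul, add_zero] at this ⊢
        refine this.congr fun w _ => (pd_japAmp _ w).trans ?_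
        simp [vec, Pi.single_apply, japAmp, japAmpZ]
        ring
    · rcases e with i | i | i
      · exact (hz _ _).congr fun w _ => (pd_japAmpZ _ _ w).trans (by simp [vec])
      · exact (hz _ _).congr fun w _ => (pd_japAmpZ _ _ w).trans (by simp [vec])
      · have h1 := (hk (-2)).mul ((ih.2 i).mul (ih.2 j) (hv i) (hv j)) contDiffOn_const
          ((hv i).mul (hv j))
        have h2 := (hk (if j = i then 1 else 0)).mul (ih.1.mono_decay japInv_le_one)
          contDiffOn_const hu
        rw [ord_dirZ]
        simp only [one_mul, add_zero] at h1 h2 ⊢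
        refine (h1.add h2 (contDiffOn_const.mul ((hv i).mul (hv j)))
          (contDiffOn_const.mul hu)).congr fun w _ => (pd_japAmpZ _ _ w).trans ?_
        by_cases h : j = i <;> simp [vec, Pi.single_apply, japAmp, japAmpZ, h] <;> ring

theorem isAmp_japAmp : IsAmp 0 japInv 0 (japAmp : FullPhase d → ℂ) :=
  ⟨contDiff_japAmp.contDiffOn, fun n => (est_japAmp n).1⟩

/-! ### Gaining decay in `(X,Y)` -/

/-- `(1 - Δ_ζ) (1 + |Z|²)⁻¹ f`. -/
def gain (f : FullPhase d → ℂ) (w : FullPhase d) : ℂ :=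
  japAmp w * f w + ∑ i, -1 * pd (pd (fun w => japAmp w * f w) (dirF i)) (dirF i) w

theorem IsAmp.pdF {D : Coord d → ℝ} (hD : ∀ Z, 0 ≤ D Z) {o : ℝ} {μ : Order}
    {f : FullPhase d → ℂ} (hf : IsAmp o D μ f) (i : Fin (d + 2)) :
    IsAmp o D μ (BBCalculus.pd f (dirF i)) :=
  (hf.pd (dirF i)).mono (wtLe_ord_fib o D hD μ i)

/-- The factor (1+|Z|²)⁻¹ improves the decay, and the two fibre derivatives do not worsen the order.
-/
theorem isAmp_gain {n : ℕ} {μ : Order} {f : FullPhase d → ℂ}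
    (hf : IsAmp 0 (fun Z => japInv Z ^ n) μ f) :
    IsAmp 0 (fun Z => japInv Z ^ (n + 1)) μ (gain f) := by
  have h1 := isAmp_japAmp.mul hf
  simp only [zero_add, ← pow_succ'] at h1
  have h0 : ∀ Z : Coord d, 0 ≤ japInv Z ^ (n + 1) := fun Z => pow_nonneg (japInv_pos Z).le _
  exact h1.add (IsAmp.sum fun i _ => ((h1.pdF h0 i).pdF h0 i).const_mul (-1))

theorem isAmp_gain_iterate (n : ℕ) {μ : Order} {f : FullPhase d → ℂ}
    (hf : IsAmp 0 (fun _ => 1) μ f) : IsAmp 0 (fun Z => japInv Z ^ n) μ (gain^[n] f) := by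
  induction n with
  | zero => simpa using hf
  | succ n ih =>
    rw [Function.iterate_succ_apply']
    exact isAmp_gain ih

end BBCalculus
end

noncomputable section
namespace BBCalculus
open MeasureTheory Topology Set

variable {d : ℕ}

/-! ### Integration by parts in the fibre -/

section

variable {D : Coord d → ℝ} {o : ℝ} {μ : Order} {c g : FullPhase d → ℂ} {w : FullPhase d}

theorem reduced_sum (hD : Integrable D) {ι : Type*} (s : Finset ι) {c : ι → FullPhase d → ℂ}
    (hc : ∀ i ∈ s, IsAmp 0 D μ (c i)) (hw : w ∈ scTFull d) :
    reduced (fun w => ∑ i ∈ s, c i w) w = ∑ i ∈ s, reduced (c i) w := by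
  have h : ∀ θ, shifted (fun w => ∑ i ∈ s, c i w) (w.1, θ) = ∑ i ∈ s, shifted (c i) (w.1, θ) :=
    fun θ => by
      simp only [shifted, ft, Finset.mul_sum]
      exact integral_finsetSum _ fun i hi => Integrable.osc_mul
        ((hc i hi).integrable_slice hD (w := shiftPt (w.1, θ)) hw) _
  simp only [reduced, h]
  exact integral_finsetSum _ fun i hi => integrable_shifted hD (hc i hi) hw

theorem reduced_add (hD : Integrable D) (hc : IsAmp 0 D μ c) (hg : IsAmp 0 D μ g)
    (hw : w ∈ scTFull d) : reduced (fun w => c w + g w) w = reduced c w + reduced g w := by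
  have := reduced_sum hD Finset.univ (c := ![c, g]) (μ := μ) (by simp [hc, hg]) hw
  simpa using this

theorem reduced_const_mul (z : ℂ) (c : FullPhase d → ℂ) (w : FullPhase d) :
    reduced (fun w => z * c w) w = z * reduced c w := by
  simp only [reduced, shifted, ft, mul_left_comm _ z, integral_const_mul]

/-- `∂_{θ_i}` of `∫ e^{iθZ} c(p,ζ+θ,Z) dZ`. -/
theorem hasLineDerivAt_shifted (hD : Integrable D) (hD0 : ∀ Z, 0 ≤ D Z) (i : Fin (d + 2))
    (hc : IsAmp 0 D μ c) (hg : IsAmp 0 D μ g)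
    (h : ∀ w ∈ scTFull d, g w = Complex.I * w.2 i * c w + pd c (dirF i) w)
    (hw : w ∈ scTFull d) (θ : Coord d) :
    HasLineDerivAt ℝ (fun θ => shifted c (w.1, θ)) (shifted g (w.1, θ)) θ (Pi.single i 1) := by
  set e : Coord d := Pi.single i 1 with he
  set P : ℝ → FullPhase d := fun t => ((w.1.1, w.1.2 + (θ + t • e)), 0) with hP
  have hPw : ∀ t, P t ∈ scTFull d := fun t => hw
  have hPc : Continuous P := by fun_prop
  obtain ⟨s, hs, -, C, hC, H⟩ := hg.bd.exists_nhds hD0 (hPw 0)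
  have hs' : P ⁻¹' s ∈ 𝓝 (0 : ℝ) := hPc.continuousAt.preimage_mem_nhds hs
  have hm : ∀ {c : FullPhase d → ℂ}, ContDiffOn ℝ ∞ c (scTFull d) → ∀ t : ℝ,
      AEStronglyMeasurable (fun Z => osc (θ + t • e) Z * c ((P t).1, Z)) := fun hc t =>
    ((by fun_prop : Continuous fun Z : Coord d => osc (θ + t • e) Z).mul
      (continuous_slice hc (hPw t))).aestronglyMeasurable
  have hderiv : ∀ (Z : Coord d) (t : ℝ), HasDerivAt (fun t : ℝ => osc (θ + t • e) Z * c ((P t).1, Z))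
      (osc (θ + t • e) Z * g ((P t).1, Z)) t := by
    intro Z t
    have h1 : HasDerivAt (fun t : ℝ => θ + t • e) e t := by
      have := ((hasDerivAt_id t).smul_const e).const_add θ
      simpa using this
    obtain ⟨L, hL, hLi⟩ := hasFDerivAt_osc Z (θ + t • e)
    have h2 : HasDerivAt (fun t : ℝ => osc (θ + t • e) Z) (Complex.I * Z i * osc (θ + t • e) Z) t := by
      have := hL.comp_hasDerivAt t h1
      rw [hLi, osc_comm] at this
      simpa only [Function.comp_def, osc_comm Z] using this
    have h3 : HasDerivAt (fun t : ℝ => (((P t).1, Z) : FullPhase d)) (vec (dirF i)) t :=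
      (((hasDerivAt_const t w.1.1).prodMk (h1.const_add w.1.2)).prodMk (hasDerivAt_const t Z))
    have h4 : DifferentiableAt ℝ c ((P t).1, Z) := hc.differentiableAt (hPw t)
    have h5 := h4.hasFDerivAt.comp_hasDerivAt t h3
    refine (h2.mul h5).congr_deriv ?_
    rw [h ((P t).1, Z) (hPw t)]
    simp only [pd, act, Function.comp_apply]
    ring
  have key := hasDerivAt_integral_of_dominated_loc_of_deriv_le (μ := volume) (𝕜 := ℝ)
    (F := fun t Z => osc (θ + t • e) Z * c ((P t).1, Z))
    (F' := fun t Z => osc (θ + t • e) Z * g ((P t).1, Z)) (bound := fun Z => C * D Z) hs'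
    (Filter.Eventually.of_forall fun t => hm hc.smooth t)
    (Integrable.osc_mul (hc.integrable_slice hD (hPw 0)) _) (hm hg.smooth 0)
    (Filter.Eventually.of_forall fun Z t ht => by
      rw [norm_mul, norm_osc, one_mul]
      exact H (P t) ht Z)
    (hD.const_mul C) (Filter.Eventually.of_forall fun Z t _ => hderiv Z t)
  have := key.2
  simp only [zero_smul, add_zero, hP] at this
  exact this

/-- Integration by parts in the fibre variables. -/
theorem reduced_mulZ (hD : Integrable D) (hD0 : ∀ Z, 0 ≤ D Z) (i : Fin (d + 2))
    (hc : IsAmp 0 D μ c) (hg : IsAmp 0 D μ g) (h : ∀ w ∈ scTFull d, g w = w.2 i * c w)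
    (hw : w ∈ scTFull d) : reduced g w = Complex.I * reduced (pd c (dirF i)) w := by
  have h1 := hc.pdF hD0 i
  have h2 := (hg.const_mul Complex.I).add h1
  have h3 : reduced (fun w => Complex.I * g w + pd c (dirF i) w) w = 0 := by
    have i1 := integrable_shifted hD hc hw
    have i2 := integrable_shifted hD h2 hw
    -- Integration by parts against the constant 1: the integral over θ of a θ_i-derivative
    -- vanishes.
    have key := integral_bilinear_hasLineDerivAt_right_eq_neg_left_of_integrable (μ := volume)
      (E := Coord d) (f := fun _ => (1 : ℂ)) (f' := fun _ => 0) (v := Pi.single i 1)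
      (B := ContinuousLinearMap.mul ℝ ℂ) (by simp) (by simpa using i2) (by simpa using i1)
      (fun θ _ => hasDerivAt_const (0 : ℝ) (1 : ℂ))
      (fun θ _ => hasLineDerivAt_shifted hD hD0 i hc h2
        (fun w hw => by rw [h w hw, mul_assoc]) hw θ)
    simpa [reduced] using key
  rw [reduced_add hD (hg.const_mul Complex.I) h1 hw, reduced_const_mul] at h3
  linear_combination -Complex.I * h3 + reduced g w * Complex.I_sq

end

/-! ### The pairing with Schwartz functions -/

/-- Multiplication of Schwartz functions by `Z_i`. -/
def mulZ (i : Fin (d + 2)) (φ : 𝓢(Coord d, ℂ)) : 𝓢(Coord d, ℂ) :=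
  SchwartzMap.smulLeftCLM ℂ (fun Z : Coord d => Z i) φ

theorem mulZ_apply (i : Fin (d + 2)) (φ : 𝓢(Coord d, ℂ)) (Z : Coord d) :
    mulZ i φ Z = Z i * φ Z := by
  have h : (fun Z : Coord d => Z i).HasTemperateGrowth :=
    (ContinuousLinearMap.proj (R := ℝ) (φ := fun _ : Fin (d + 2) => ℝ) i).hasTemperateGrowth
  rw [mulZ, SchwartzMap.smulLeftCLM_apply_apply h, Complex.real_smul]

/-- The pairing of the oscillatory integral of `f` with `φ`, up to a constant. -/
def pair (f : FullPhase d → ℂ) (φ : 𝓢(Coord d, ℂ)) (w : FullPhase d) : ℂ :=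
  reduced (fun w => f w * φ w.2) w

section

variable {μ : Order} {f g : FullPhase d → ℂ} {w : FullPhase d} {φ : 𝓢(Coord d, ℂ)}

theorem decay_nonneg (Z : Coord d) : 0 ≤ decay Z := (decay_pos Z).le

theorem IsAmp.mul_schwartz (hf : IsAmp 0 (fun _ => 1) μ f) (φ : 𝓢(Coord d, ℂ)) :
    IsAmp 0 decay μ (fun w => f w * φ w.2) := by
  have := hf.mul (isAmp_schwartz φ)
  simpa using this

theorem pair_add (hf : IsAmp 0 (fun _ => 1) μ f) (hg : IsAmp 0 (fun _ => 1) μ g)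
    (hw : w ∈ scTFull d) : pair (fun w => f w + g w) φ w = pair f φ w + pair g φ w := by
  rw [pair, pair, pair, ← reduced_add integrable_decay (hf.mul_schwartz φ) (hg.mul_schwartz φ) hw]
  simp only [add_mul]

theorem pair_sum {ι : Type*} (s : Finset ι) {f : ι → FullPhase d → ℂ}
    (hf : ∀ i ∈ s, IsAmp 0 (fun _ => 1) μ (f i)) (hw : w ∈ scTFull d) :
    pair (fun w => ∑ i ∈ s, f i w) φ w = ∑ i ∈ s, pair (f i) φ w := by
  simp only [pair]
  rw [← reduced_sum integrable_decay s (fun i hi => (hf i hi).mul_schwartz φ) hw]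
  simp only [Finset.sum_mul]

theorem pair_const_mul (z : ℂ) (f : FullPhase d → ℂ) (φ : 𝓢(Coord d, ℂ)) (w : FullPhase d) :
    pair (fun w => z * f w) φ w = z * pair f φ w := by
  simp only [pair, mul_assoc]
  exact reduced_const_mul z _ w

theorem pair_mulZ (hf : IsAmp 0 (fun _ => 1) μ f) (φ : 𝓢(Coord d, ℂ)) (i : Fin (d + 2))
    (hw : w ∈ scTFull d) : pair f (mulZ i φ) w = Complex.I * pair (pd f (dirF i)) φ w := by
  have h := reduced_mulZ integrable_decay decay_nonneg i (hf.mul_schwartz φ)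
    (hf.mul_schwartz (mulZ i φ)) (fun w _ => by rw [mulZ_apply]; ring) hw
  refine h.trans (congrArg _ (reduced_congr (fun w hw => ?_) hw))
  rw [pd_mul hf.smooth (isAmp_schwartz φ).smooth _ hw]
  simp only
  rw [pd_snd φ.differentiableAt]
  simp [vec]

/-- Put u = f/(1+|Z|²), so that fφ = uφ + ∑ u Z_i²φ. Each factor Z_i² on φ becomes -∂_{ζ_i}² on u,
since each Z_i contributes i∂_{ζ_i}. -/
theorem pair_gain (hf : IsAmp 0 (fun _ => 1) μ f) (φ : 𝓢(Coord d, ℂ)) (hw : w ∈ scTFull d) :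
    pair (gain f) φ w = pair f φ w := by
  have h0 : ∀ Z : Coord d, (0 : ℝ) ≤ 1 := fun _ => zero_le_one
  have h1 : IsAmp 0 (fun _ => 1) μ (fun w => japAmp w * f w) := by
    have := isAmp_japAmp.mul hf
    simp only [zero_add, mul_one] at this
    exact this.mono (wtLe_of_le zero_le_one (fun Z => by simpa using japInv_le_one Z) μ)
  set u : FullPhase d → ℂ := fun w => japAmp w * f w with hu
  have h2 : ∀ i, pair u (mulZ i (mulZ i φ)) w = -1 * pair (pd (pd u (dirF i)) (dirF i)) φ w :=
    fun i => by
      rw [pair_mulZ h1 _ i hw, pair_mulZ (h1.pdF h0 i) _ i hw, ← mul_assoc, Complex.I_mul_I]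
  have h3 : pair (gain f) φ w = pair u φ w + ∑ i, pair u (mulZ i (mulZ i φ)) w := by
    have a1 : ∀ i ∈ Finset.univ, IsAmp 0 (fun _ => 1) μ
        (fun w => -1 * pd (pd u (dirF i)) (dirF i) w) := fun i _ =>
      ((h1.pdF h0 i).pdF h0 i).const_mul (-1)
    simp only [h2]
    refine (pair_add h1 (IsAmp.sum a1) hw).trans ?_
    rw [pair_sum _ a1 hw]
    simp only [pair_const_mul]
  rw [h3]
  have h4 := fun i => h1.mul_schwartz (mulZ i (mulZ i φ))
  simp only [pair]
  rw [← reduced_sum integrable_decay _ (fun i _ => h4 i) hw,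
    ← reduced_add integrable_decay (h1.mul_schwartz φ) (IsAmp.sum fun i _ => h4 i) hw]
  refine reduced_congr (fun w _ => ?_) hw
  simp only [mulZ_apply, hu, japAmp, japInv]
  have h5 : (1 + ∑ i, (w.2 i : ℂ) ^ 2) ≠ 0 := by
    have := (lt_of_lt_of_le one_pos (one_le_jap w.2)).ne'
    exact_mod_cast this
  push_cast
  have h6 : ∑ i, (1 + ∑ i, (w.2 i : ℂ) ^ 2)⁻¹ * f w * (w.2 i * (w.2 i * φ w.2)) =
      (∑ i, (w.2 i : ℂ) ^ 2) * ((1 + ∑ i, (w.2 i : ℂ) ^ 2)⁻¹ * f w * φ w.2) := by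
    rw [Finset.sum_mul]
    exact Finset.sum_congr rfl fun i _ => by ring
  rw [h6]
  field_simp

theorem isAmp_gain_iterate_decay (hf : IsAmp 0 (fun _ => 1) μ f) :
    IsAmp 0 decay μ (gain^[d + 3] f) :=
  (isAmp_gain_iterate (d + 3) hf).mono (wtLe_of_le (by positivity) japInv_pow_le μ)

theorem pair_gain_iterate (hf : IsAmp 0 (fun _ => 1) μ f) (n : ℕ) (φ : 𝓢(Coord d, ℂ))
    (hw : w ∈ scTFull d) : pair (gain^[n] f) φ w = pair f φ w := by
  have h1 : ∀ n, IsAmp 0 (fun _ => 1) μ (gain^[n] f) := fun n => (isAmp_gain_iterate n hf).mono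
    (wtLe_of_le zero_le_one (fun Z => by
      simpa using pow_le_one₀ (japInv_pos Z).le (japInv_le_one Z)) μ)
  induction n with
  | zero => rfl
  | succ n ih => rw [Function.iterate_succ_apply', pair_gain (h1 n) φ hw, ih]

end

end BBCalculus
end

noncomputable section
namespace BBCalculus
open MeasureTheory Topology Set

variable {d : ℕ}

/-! ### The Fourier inversion formula in coordinates -/

section Fourier

open scoped FourierTransform RealInnerProductSpace

/-- The Fourier transform with the conventions of the oscillatory integrals. -/
def hat (φ : 𝓢(Coord d, ℂ)) (ζ : Coord d) : ℂ := ∫ Z, osc ζ Z * φ Z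

/-- `ℝ^n` with the Euclidean norm. -/
abbrev Eucl (d : ℕ) : Type := EuclideanSpace ℝ (Fin (d + 2))

/-- The identification of the two models of `ℝ^n`. -/
def toCoord (d : ℕ) : Eucl d ≃L[ℝ] Coord d := EuclideanSpace.equiv (Fin (d + 2)) ℝ

theorem integral_comp_toCoord (F : Coord d → ℂ) : ∫ v : Eucl d, F (toCoord d v) = ∫ Z, F Z :=
  (PiLp.volume_preserving_ofLp (Fin (d + 2))).integral_comp
    (toCoord d).toHomeomorph.measurableEmbedding F

theorem osc_smul_toCoord (r : ℝ) (v w : Eucl d) :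
    osc (r • toCoord d v) (toCoord d w) = Complex.exp ((r * ⟪w, v⟫ : ℝ) * Complex.I) := by
  rw [osc, mul_comm]
  congr 3
  simp only [PiLp.inner_apply, toCoord, Finset.mul_sum]
  refine Finset.sum_congr rfl fun i _ => ?_
  simp [mul_assoc]

/-- A Schwartz function on `ℝ^n` with the Euclidean norm. -/
def toEucl (φ : 𝓢(Coord d, ℂ)) : 𝓢(Eucl d, ℂ) :=
  SchwartzMap.compCLMOfContinuousLinearEquiv ℂ (toCoord d) φ

theorem hat_eq (φ : 𝓢(Coord d, ℂ)) (v : Eucl d) :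
    hat φ ((-2 * Real.pi) • toCoord d v) = 𝓕 (toEucl φ) v := by
  rw [SchwartzMap.fourier_coe, Real.fourier_eq', hat, ← integral_comp_toCoord]
  simp only [osc_smul_toCoord, smul_eq_mul]
  rfl

theorem fourier_inversion (φ : 𝓢(Coord d, ℂ)) (Z : Coord d) :
    ∫ ζ, osc (-ζ) Z * hat φ ζ = (((2 * Real.pi) ^ (d + 2) : ℝ) : ℂ) * φ Z := by
  obtain ⟨z, rfl⟩ := (toCoord d).surjective Z
  have h1 : φ (toCoord d z) = 𝓕⁻ (𝓕 (toEucl φ)) z := by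
    rw [FourierTransform.fourierInv_fourier_eq]
    rfl
  have h2 : φ (toCoord d z) =
      ∫ ζ : Coord d, osc (-((-2 * Real.pi) • ζ)) (toCoord d z) * hat φ ((-2 * Real.pi) • ζ) := by
    rw [h1, SchwartzMap.fourierInv_coe, Real.fourierInv_eq', ← integral_comp_toCoord]
    refine integral_congr_ae (Filter.Eventually.of_forall fun v => ?_)
    simp only
    rw [hat_eq, ← neg_smul, osc_smul_toCoord, smul_eq_mul, real_inner_comm]
    congr 3
    push_cast
    ring
  -- The substitution by -2π, which matches the two Fourier conventions, has Jacobian (2π)^{d+2} in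
  -- absolute value.
  have h3 := Measure.integral_comp_smul (volume : Measure (Coord d))
    (fun ζ => osc (-ζ) (toCoord d z) * hat φ ζ) (-2 * Real.pi)
  have h4 : |((-2 * Real.pi) ^ (d + 2))⁻¹| = ((2 * Real.pi) ^ (d + 2))⁻¹ := by
    rw [abs_inv, abs_pow]
    congr 2
    rw [neg_mul, abs_neg, abs_of_pos Real.two_pi_pos]
  rw [h2, h3, Module.finrank_fin_fun, h4, Complex.real_smul, ← mul_assoc, ← Complex.ofReal_mul,
    mul_inv_cancel₀ (pow_ne_zero _ Real.two_pi_pos.ne'), Complex.ofReal_one, one_mul]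

theorem exists_hat_eq (g : 𝓢(Coord d, ℂ)) : ∃ φ : 𝓢(Coord d, ℂ), hat φ = g := by
  have h0 : (-2 * Real.pi : ℝ) ≠ 0 := by simp [Real.pi_ne_zero]
  set S : Eucl d ≃L[ℝ] Coord d :=
    (toCoord d).trans (ContinuousLinearEquiv.smulLeft (Units.mk0 _ h0)) with hS
  have hSv : ∀ v, S v = (-2 * Real.pi) • toCoord d v := fun v => rfl
  refine ⟨SchwartzMap.compCLMOfContinuousLinearEquiv ℂ (toCoord d).symm
    (𝓕⁻ (SchwartzMap.compCLMOfContinuousLinearEquiv ℂ S g)), funext fun ζ => ?_⟩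
  obtain ⟨v, rfl⟩ := S.surjective ζ
  have : ∀ ψ : 𝓢(Eucl d, ℂ), toEucl (SchwartzMap.compCLMOfContinuousLinearEquiv ℂ
      (toCoord d).symm ψ) = ψ := fun ψ => by
    ext x
    simp [toEucl]
  rw [hSv, hat_eq, this, FourierTransform.fourier_fourierInv_eq]
  rfl

end Fourier

end BBCalculus
end

/-! ### Kernels of symbols independent of (X,Y): existence and uniqueness. -/

noncomputable section
namespace BBCalculus
open MeasureTheory Topology Set

variable {d : ℕ}

/-! ### Inversion and uniqueness -/

theorem exists_hat_bound (φ : 𝓢(Coord d, ℂ)) (k : ℕ) :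
    ∃ C : ℝ, 0 ≤ C ∧ ∀ ζ, (1 + ‖ζ‖) ^ k * ‖hat φ ζ‖ ≤ C := by
  obtain ⟨C, hC, H⟩ := exists_ft_bound integrable_decay (isAmp_schwartz φ) k
    (isCompact_singleton (x := (1 : Coord d)))
  refine ⟨C, hC, fun ζ => ?_⟩
  -- φ does not depend on the point of the bundle and the weight of order 0 is 1, so any base point
  -- with x > 0 serves.
  have := H ((1, 0), 0) (show (0 : ℝ) < (1 : Coord d) 0 from one_pos) rfl ζ
  rwa [wt_zero, mul_one] at this

theorem stronglyMeasurable_hat (φ : 𝓢(Coord d, ℂ)) : StronglyMeasurable (hat φ) := by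
  have h : Continuous fun x : Coord d × Coord d => osc x.1 x.2 * φ x.2 := by fun_prop
  exact h.stronglyMeasurable.integral_prod_right (ν := volume)

theorem integrable_hat (φ : 𝓢(Coord d, ℂ)) : Integrable (hat φ) := by
  obtain ⟨C, -, H⟩ := exists_hat_bound φ (d + 3)
  refine (integrable_decay.const_mul C).mono' (stronglyMeasurable_hat φ).aestronglyMeasurable
    (Filter.Eventually.of_forall fun ζ => ?_)
  rw [decay, le_mul_inv_iff₀ (by positivity), mul_comm]
  exact H ζ

theorem shifted_constInZ (a : Phase d → ℂ) (φ : 𝓢(Coord d, ℂ)) (w : FullPhase d) :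
    shifted (fun w => constInZ a w * φ w.2) w = a (w.1.1, w.1.2 + w.2) * hat φ w.2 := by
  rw [shifted, ft, hat, ← integral_const_mul]
  congr 1
  ext Z
  simp only [constInZ, shiftPt]
  ring

theorem pair_constInZ (a : Phase d → ℂ) (φ : 𝓢(Coord d, ℂ)) (p : Coord d) :
    pair (constInZ a) φ ((p, 0), 0) = ∫ ζ, a (p, ζ) * hat φ ζ := by
  simp only [pair, reduced, shifted_constInZ, zero_add]

/-- This justifies exchanging σ = ζ+θ with ζ. The weight at ζ is moved to the fixed fibre point 0 at
the cost of k powers of 1+‖ζ‖, paid by the transform of φ. What remains is dominated by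
decay(σ-ζ)·decay(ζ), the integrand of a convolution of integrable functions. -/
theorem integrable_shear {c : FullPhase d → ℂ} {μ : Order} (hc : IsAmp 0 decay μ c)
    (φ : 𝓢(Coord d, ℂ)) {p : Coord d} (hp : 0 < p 0) :
    Integrable (fun x : Coord d × Coord d =>
      ft c (x.1 - x.2) ((p, x.1), 0) * hat φ x.2) (volume.prod volume) := by
  obtain ⟨C, hC, H⟩ := bd_shifted integrable_decay hc {p} isCompact_singleton
  obtain ⟨K, hK, k, T⟩ := temperate_wt (d := d) μ
  obtain ⟨C', hC', H'⟩ := exists_hat_bound φ (k + (d + 3))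
  have hq : ∀ ζ, (p, ζ) ∈ scT d := fun _ => hp
  have h1 := (integrable_decay (d := d)).convolution_integrand (ContinuousLinearMap.mul ℝ ℝ)
    (integrable_decay (d := d))
  refine (h1.const_mul (C * K * wt μ (p, 0) * C')).mono' ?_ ?_
  · have h2 : Continuous fun x : (Coord d × Coord d) × Coord d =>
        osc (x.1.1 - x.1.2) x.2 * c ((p, x.1.1), x.2) :=
      Continuous.mul (by fun_prop)
        (hc.smooth.continuousOn.comp_continuous (by fun_prop) fun _ => hp)
    have h3 := h2.stronglyMeasurable.integral_prod_right' (ν := (volume : Measure (Coord d)))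
    exact (h3.mul ((stronglyMeasurable_hat φ).comp_measurable measurable_snd)).aestronglyMeasurable
  · refine Filter.Eventually.of_forall fun x => ?_
    have a1 := H ((p, x.2), x.1 - x.2) (hq _) rfl
    have e1 : shifted c ((p, x.2), x.1 - x.2) = ft c (x.1 - x.2) ((p, x.1), 0) := by
      simp [shifted, shiftPt]
    rw [e1] at a1
    have a2 := T (p, 0) (hq _) x.2
    simp only [zero_add] at a2 a1
    have a3 : (1 + ‖x.2‖) ^ k * ‖hat φ x.2‖ ≤ C' * decay x.2 := by
      rw [decay, le_mul_inv_iff₀ (by positivity)]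
      refine le_of_eq_of_le ?_ (H' x.2)
      ring
    have w0 := (wt_pos μ (hq 0)).le
    have n0 := norm_nonneg (hat φ x.2)
    have d0 := decay_nonneg (x.1 - x.2)
    rw [norm_mul]
    calc ‖ft c (x.1 - x.2) ((p, x.1), 0)‖ * ‖hat φ x.2‖
        ≤ C * (K * (1 + ‖x.2‖) ^ k * wt μ (p, 0)) * decay (x.1 - x.2) * ‖hat φ x.2‖ := by
          refine mul_le_mul_of_nonneg_right (a1.trans ?_) n0
          exact mul_le_mul_of_nonneg_right (mul_le_mul_of_nonneg_left a2 hC) d0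
      _ = C * K * wt μ (p, 0) * decay (x.1 - x.2) * ((1 + ‖x.2‖) ^ k * ‖hat φ x.2‖) := by ring
      _ ≤ C * K * wt μ (p, 0) * decay (x.1 - x.2) * (C' * decay x.2) :=
          mul_le_mul_of_nonneg_left a3 (by positivity)
      _ = _ := by
          simp only [ContinuousLinearMap.mul_apply']
          ring

/-- The reduced amplitude has the same oscillatory integral, up to a constant. -/
theorem pair_reduced {c : FullPhase d → ℂ} {μ : Order} (hc : IsAmp 0 decay μ c)
    (φ : 𝓢(Coord d, ℂ)) {p : Coord d} (hp : 0 < p 0) :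
    pair (reduced c) φ ((p, 0), 0) =
      (((2 * Real.pi) ^ (d + 2) : ℝ) : ℂ) * pair c φ ((p, 0), 0) := by
  have hw : ∀ σ, (((p, σ), 0) : FullPhase d) ∈ scTFull d := fun _ => hp
  -- Substituting σ = ζ+θ removes ζ from the fibre argument of c; it remains only in the phase and
  -- in the transform of φ.
  have e1 : ∀ ζ, reduced c ((p, ζ), 0) * hat φ ζ =
      ∫ σ, ft c (σ - ζ) ((p, σ), 0) * hat φ ζ := fun ζ => by
    rw [integral_mul_const]
    congr 1
    rw [reduced, ← integral_sub_right_eq_self _ ζ]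
    simp [shifted, shiftPt]
  -- For fixed σ, the ζ-integral inside the Z-integral is Fourier inversion and returns φ(Z) with
  -- the factor (2π)^{d+2}.
  have e2 : ∀ σ, ∫ ζ, ft c (σ - ζ) ((p, σ), 0) * hat φ ζ =
      (((2 * Real.pi) ^ (d + 2) : ℝ) : ℂ) * shifted (fun w => c w * φ w.2) ((p, 0), σ) := by
    intro σ
    have i1 := hc.integrable_slice integrable_decay (hw σ)
    have i2 : Integrable (fun x : Coord d × Coord d =>
        osc (σ - x.1) x.2 * (hat φ x.1 * c ((p, σ), x.2))) (volume.prod volume) :=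
      ((integrable_hat φ).mul_prod i1).bdd_mul (c := 1)
        (by fun_prop : Continuous fun x : Coord d × Coord d =>
          osc (σ - x.1) x.2).aestronglyMeasurable
        (Filter.Eventually.of_forall fun x => (norm_osc _ _).le)
    have e3 : ∀ ζ, ft c (σ - ζ) ((p, σ), 0) * hat φ ζ =
        ∫ Z, osc (σ - ζ) Z * (hat φ ζ * c ((p, σ), Z)) := fun ζ => by
      rw [ft, ← integral_mul_const]
      congr 1
      ext Z
      ring
    simp only [e3]
    rw [integral_integral_swap i2, shifted, ft, ← integral_const_mul]
    congr 1
    ext Z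
    have e4 := fourier_inversion φ Z
    have e5 : ∀ ζ, osc (σ - ζ) Z * (hat φ ζ * c ((p, σ), Z)) =
        osc σ Z * c ((p, σ), Z) * (osc (-ζ) Z * hat φ ζ) := fun ζ => by
      rw [sub_eq_add_neg, osc_add]
      ring
    simp only [e5, shiftPt, zero_add]
    rw [integral_const_mul, e4]
    ring
  have e6 := pair_constInZ (fun q => reduced c (q, 0)) φ p
  refine e6.trans ?_
  simp only [e1]
  rw [← integral_integral_swap (integrable_shear hc φ hp)]
  simp only [e2]
  rw [integral_const_mul]
  rfl

/-- An amplitude which does not depend on `(X,Y)` is determined by its oscillatory integral. -/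
theorem eqOn_zero_of_pair {a : Phase d → ℂ} {o : ℝ} {μ : Order}
    (ha : IsAmp o (fun _ => 1) μ (constInZ a))
    (h : ∀ p : Coord d, 0 < p 0 → ∀ φ, pair (constInZ a) φ ((p, 0), 0) = 0) :
    EqOn a 0 (scT d) := by
  rintro ⟨p, ζ⟩ hq
  have hp : 0 < p 0 := hq
  have hcont : Continuous fun ζ => a (p, ζ) :=
    ha.smooth.continuousOn.comp_continuous (f := fun ζ : Coord d => (((p, ζ), 0) : FullPhase d))
      (by fun_prop) fun _ => hp
  -- The pairing is ∫ a(p,ζ)φ̂(ζ) dζ, and every test function is some φ̂; so a(p,·) vanishes as a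
  -- distribution, and then everywhere by continuity.
  have h1 : ∀ᵐ ζ : Coord d, a (p, ζ) = 0 := by
    refine ae_eq_zero_of_integral_contDiff_smul_eq_zero hcont.locallyIntegrable
      fun g hg hgs => ?_
    have hgs' : HasCompactSupport fun x => ((g x : ℝ) : ℂ) :=
      hgs.comp_left (g := fun x : ℝ => (x : ℂ)) (by simp)
    obtain ⟨φ, hφ⟩ := exists_hat_eq (hgs'.toSchwartzMap (Complex.ofRealCLM.contDiff.comp hg))
    have h2 := h p hp φ
    rw [pair_constInZ, hφ] at h2
    rw [← h2]
    congr 1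
    ext ζ
    rw [Complex.real_smul, mul_comm]
    rfl
  exact congrFun ((hcont.ae_eq_iff_eq volume continuous_const).1 h1) ζ

/-! ### The oscillatory integrals -/

theorem oscIntegrand_eq (f : FullPhase d → ℂ) (p : Coord d) (φ : 𝓢(Coord d, ℂ)) (ζ : Coord d) :
    oscIntegrand f p φ ζ = fun Z => osc ζ Z * (f ((p, ζ), Z) * φ Z) :=
  funext fun _ => mul_assoc _ _ _

theorem integral_oscIntegrand (f : FullPhase d → ℂ) (p : Coord d) (φ : 𝓢(Coord d, ℂ))
    (ζ : Coord d) :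
    ∫ Z, oscIntegrand f p φ ζ Z = shifted (fun w => f w * φ w.2) ((p, 0), ζ) := by
  simp only [oscIntegrand_eq, shifted, ft, shiftPt, zero_add]

theorem oscConverges {f : FullPhase d → ℂ} {μ : Order} (hf : IsAmp 0 (fun _ => 1) μ f)
    {p : Coord d} (hp : 0 < p 0) (φ : 𝓢(Coord d, ℂ)) : OscConverges f p φ := by
  have hw : ∀ ζ, (((p, ζ), 0) : FullPhase d) ∈ scTFull d := fun _ => hp
  refine ⟨fun ζ => ?_, ?_⟩
  · rw [oscIntegrand_eq]
    exact Integrable.osc_mul ((hf.mul_schwartz φ).integrable_slice integrable_decay (hw ζ)) ζ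
  · simp only [integral_oscIntegrand]
    exact integrable_shifted (w := ((p, 0), 0)) integrable_decay (hf.mul_schwartz φ) hp

theorem oscKernel_eq (f : FullPhase d → ℂ) (p : Coord d) (φ : 𝓢(Coord d, ℂ)) :
    oscKernel f p φ = (((2 * Real.pi) ^ (d + 2))⁻¹ : ℝ) * pair f φ ((p, 0), 0) := by
  simp only [oscKernel, integral_oscIntegrand]
  rfl

end BBCalculus
end

noncomputable section
namespace BBCalculus
open MeasureTheory Topology Set

variable {d : ℕ}

/-! ### Left symbols -/

theorem pd_constInZ {a : Phase d → ℂ} {w : FullPhase d} (ha : DifferentiableAt ℝ a w.1)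
    (hw : w ∈ scTFull d) (e : Dir d) :
    pd (constInZ a) e w = ((wt (ord 1 e) w.1 : ℝ) : ℂ) * constInZ (act (frame e) a) w := by
  have h := (wt_pos (ord 1 e) hw).ne'
  have h1 : HasFDerivAt (constInZ a) _ w :=
    ha.hasFDerivAt.comp w (ContinuousLinearMap.fst ℝ (Phase d) (Coord d)).hasFDerivAt
  simp only [pd, act, h1.fderiv, constInZ, frame, map_smul, Complex.real_smul, wt_neg _ hw,
    Complex.ofReal_inv]
  rw [mul_inv_cancel_left₀ (by exact_mod_cast h), ← vec_fst]
  rfl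

theorem isAmp_of_mem_symbolZero {a : Phase d → ℂ} (ha : a ∈ SymbolZero d) :
    IsAmp 1 (fun _ => 1) 0 (constInZ a) := by
  have hs : ∀ a ∈ SymbolZero d, ContDiffOn ℝ ∞ (constInZ a) (scTFull d) := fun a ha =>
    ha.1.comp contDiff_fst.contDiffOn fun _ hw => hw
  have h0 : ∀ a ∈ SymbolZero d, Bd (fun _ => 1) 0 (constInZ a) := fun a ha B hB => by
    obtain ⟨C, hC⟩ := ha.2 [] (by simp) B hB
    refine ⟨max C 0, le_max_right _ _, fun w hw hwB => ?_⟩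
    rw [wt_zero, mul_one, mul_one]
    exact (hC w.1 hw hwB).trans (le_max_left _ _)
  have h1 : ∀ a ∈ SymbolZero d, ∀ e, act (frame e) a ∈ SymbolZero d := fun a ha e => by
    refine ⟨contDiffOn_act isOpen_scT ha.1 ((contDiffOn_wt _).smul contDiffOn_const),
      fun Vs hVs B hB => ?_⟩
    obtain ⟨C, hC⟩ := ha.2 (Vs ++ [frame e]) (by
      intro V hV
      rcases List.mem_append.1 hV with h | h
      · exact hVs V h
      · rw [List.mem_singleton.1 h]
        exact frame_mem e) B hB
    exact ⟨C, by simpa using hC⟩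
  refine ⟨hs a ha, fun n => ?_⟩
  induction n generalizing a with
  | zero => exact h0 a ha
  | succ n ih =>
    refine ⟨h0 a ha, fun e => ?_⟩
    have h2 := ((isAmp_wt 1 (ord 1 e)).est n).mul (ih (h1 a ha e)) (isAmp_wt 1 _).smooth
      (hs _ (h1 a ha e))
    rw [zero_add]
    simp only [add_zero, mul_one] at h2
    refine h2.congr fun w hw => ?_
    have hd : DifferentiableAt ℝ a w.1 := ha.1.differentiableAt_of_isOpen isOpen_scT hw
    exact pd_constInZ hd hw e

theorem isAmp_of_mem_symbol {m l k j : ℝ} {a : Phase d → ℂ} (ha : a ∈ Symbol d m l k j) :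
    IsAmp 1 (fun _ => 1) (m, l, k, j) (constInZ a) := by
  obtain ⟨a', ha', h⟩ := ha
  have := (isAmp_of_mem_symbolZero ha').wt_mul (m, l, k, j)
  rw [add_zero] at this
  exact this.congr fun w hw => h w.1 hw

theorem symbol_add_const_mul {m l k j : ℝ} {a b : Phase d → ℂ} (ha : a ∈ Symbol d m l k j)
    (hb : b ∈ Symbol d m l k j) (z : ℂ) : (fun q => a q + z * b q) ∈ Symbol d m l k j :=
  mem_symbol_of_isAmp ((isAmp_of_mem_symbol ha).add ((isAmp_of_mem_symbol hb).const_mul z))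

section

variable {o : ℝ} {μ : Order} {b : FullPhase d → ℂ}

theorem isAmp_atZero (hb : IsAmp o (fun _ => 1) μ b) :
    IsAmp o (fun _ => 1) μ (constInZ (atZero b)) := by
  have h : IsAmp o (fun _ => 1) μ (fun w : FullPhase d => 1 * b (w.1, 0)) := by
    refine IsAmp.of_stable_diff (fun μ c => ∃ b, IsAmp o (fun _ => 1) μ b ∧
      c = fun w : FullPhase d => 1 * b (w.1, 0)) ?_ ?_ ?_ ⟨b, hb, rfl⟩
    · rintro μ _ ⟨b, hb, rfl⟩ w hw
      exact (pd_slice hb.smooth hw 0 1).1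
    · rintro μ _ ⟨b, hb, rfl⟩ B hB
      obtain ⟨C, hC, H⟩ := hb.bd B hB
      refine ⟨C, hC, fun w hw hwB => ?_⟩
      simpa only [one_mul] using H (w.1, 0) hw hwB
    · rintro μ _ ⟨b, hb, rfl⟩ e
      exact ⟨_, ⟨_, hb.pdB e, rfl⟩, fun w hw => (pd_slice hb.smooth hw 0 1).2 e⟩
  simp only [one_mul] at h
  exact h

/-- The symbol, not depending on `(X,Y)`, with the same oscillatory integral as `b`. -/
def leftSymbol (b : FullPhase d → ℂ) (q : Phase d) : ℂ :=
  (((2 * Real.pi) ^ (d + 2))⁻¹ : ℝ) * reduced (gain^[d + 3] b) (q, 0)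

theorem isAmp_leftSymbol (hb : IsAmp 0 (fun _ => 1) μ b) (o : ℝ) :
    IsAmp o (fun _ => 1) μ (constInZ (leftSymbol b)) :=
  (isAmp_reduced integrable_decay decay_nonneg (isAmp_gain_iterate_decay hb) o).const_mul _

theorem pair_leftSymbol (hb : IsAmp 0 (fun _ => 1) μ b) (φ : 𝓢(Coord d, ℂ)) {p : Coord d}
    (hp : 0 < p 0) :
    pair (constInZ (leftSymbol b)) φ ((p, 0), 0) = pair b φ ((p, 0), 0) := by
  have h1 := pair_reduced (isAmp_gain_iterate_decay hb) φ hp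
  have h2 := pair_const_mul ((((2 * Real.pi) ^ (d + 2))⁻¹ : ℝ) : ℂ)
    (reduced (gain^[d + 3] b)) φ ((p, 0), 0)
  refine h2.trans ?_
  rw [h1, ← mul_assoc, ← Complex.ofReal_mul, inv_mul_cancel₀ (pow_ne_zero _ Real.two_pi_pos.ne'),
    Complex.ofReal_one, one_mul]
  exact pair_gain_iterate hb _ φ hp

/-- Identities between kernels need no gain, so `rem` may be iterated in one fixed class; the
improved orders enter only at the end. -/
theorem isAmp_rem_of_zero (hb : IsAmp 0 (fun _ => 1) μ b) : IsAmp 0 (fun _ => 1) μ (rem b) :=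
  IsAmp.sum fun i _ =>
    (((hb.pdZ i).rayAvg 0).pdF (fun _ => zero_le_one) i).const_mul Complex.I

theorem isAmp_rem_iterate_of_zero (hb : IsAmp 0 (fun _ => 1) μ b) (r : ℕ) :
    IsAmp 0 (fun _ => 1) μ (rem^[r] b) := by
  induction r with
  | zero => exact hb
  | succ r ih =>
    rw [Function.iterate_succ_apply']
    exact isAmp_rem_of_zero ih

/-- The first order expansion of the oscillatory integral. -/
theorem pair_eq_atZero_add_rem (hb : IsAmp 0 (fun _ => 1) μ b) (φ : 𝓢(Coord d, ℂ))
    {w : FullPhase d} (hw : w ∈ scTFull d) :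
    pair b φ w = pair (constInZ (atZero b)) φ w + pair (rem b) φ w := by
  have hR := fun i => (hb.pdZ i).rayAvg 0
  have h1 : pair (rem b) φ w = ∑ i, pair (rayAvg 0 (pd b (dirZ i))) (mulZ i φ) w := by
    refine (pair_sum _ (fun i _ =>
      ((hR i).pdF (fun _ => zero_le_one) i).const_mul Complex.I) hw).trans ?_
    exact Finset.sum_congr rfl fun i _ => by rw [pair_const_mul, pair_mulZ (hR i) φ i hw]
  have h2 := fun i => (hR i).mul_schwartz (mulZ i φ)
  rw [h1]
  simp only [pair]
  rw [← reduced_sum integrable_decay _ (fun i _ => h2 i) hw,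
    ← reduced_add integrable_decay ((isAmp_atZero hb).mul_schwartz φ)
      (IsAmp.sum fun i _ => h2 i) hw]
  refine reduced_congr (fun w hw => ?_) hw
  simp only [eq_atZero_add_rayAvg hb.smooth hw, add_mul, Finset.sum_mul, mulZ_apply]
  refine congrArg _ (Finset.sum_congr rfl fun i _ => ?_)
  ring

theorem pair_expansion (hb : IsAmp 0 (fun _ => 1) μ b) (φ : 𝓢(Coord d, ℂ)) {w : FullPhase d}
    (hw : w ∈ scTFull d) (N : ℕ) :
    pair b φ w = ∑ r ∈ Finset.range N, pair (constInZ (atZero (rem^[r] b))) φ w +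
      pair (rem^[N] b) φ w := by
  induction N with
  | zero => simp
  | succ N ih =>
    rw [ih, Finset.sum_range_succ, Function.iterate_succ_apply',
      pair_eq_atZero_add_rem (isAmp_rem_iterate_of_zero hb N) φ hw, add_assoc]

/-- Both sides are independent of (X,Y) and have the same kernel by `pair_expansion` and
`pair_leftSymbol`, so uniqueness makes them equal. The remainder is thus an honest left symbol, with
no asymptotic summation. -/
theorem leftSymbol_expansion (hb : IsAmp 0 (fun _ => 1) μ b) (N : ℕ) :
    EqOn (leftSymbol b)
      (fun q => ∑ r ∈ Finset.range N, atZero (rem^[r] b) q + leftSymbol (rem^[N] b) q)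
      (scT d) := by
  have hN := isAmp_rem_iterate_of_zero hb N
  have h1 := isAmp_leftSymbol hb 0
  have h2 := fun r => isAmp_atZero (isAmp_rem_iterate_of_zero hb r)
  have h3 := (IsAmp.sum (s := Finset.range N) fun r _ => h2 r).add (isAmp_leftSymbol hN 0)
  have key := eqOn_zero_of_pair (a := fun q => leftSymbol b q + -1 *
    (∑ r ∈ Finset.range N, atZero (rem^[r] b) q + leftSymbol (rem^[N] b) q))
    (h1.add (h3.const_mul (-1))) fun p hp φ => ?_
  · intro q hq
    have := key hq
    simp only [Pi.zero_apply] at this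
    linear_combination this
  · have hw : (((p, 0), 0) : FullPhase d) ∈ scTFull d := hp
    refine (pair_add h1 (h3.const_mul (-1)) hw).trans ?_
    rw [pair_const_mul, pair_add (IsAmp.sum fun r _ => h2 r) (isAmp_leftSymbol hN 0) hw,
      pair_sum _ (fun r _ => h2 r) hw, pair_leftSymbol hb φ hp, pair_leftSymbol hN φ hp,
      pair_expansion hb φ hw N]
    ring

end

/-- The difference is the left symbol of `rem^[N] b`, whose order is improved N times by
`isAmp_rem`; passing to the left symbol keeps that order. -/
theorem leftSymbol_sub_expansion_mem {m l k j : ℝ} {b : FullPhase d → ℂ}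
    (hb : IsAmp 1 (fun _ => 1) (m, l, k, j) b) (N : ℕ) :
    leftSymbol b - expansion b N ∈ Symbol d (m - N) (l - N) (k + N) (j + N) := by
  have h0 := fun {μ : Order} {b : FullPhase d → ℂ} (hb : IsAmp 1 (fun _ => 1) μ b) =>
    hb.of_gain zero_le_one fun _ => zero_le_one
  have hN := isAmp_iterate (fun _ _ h => isAmp_rem h) hb N
  refine mem_symbol_of_isAmp ((isAmp_leftSymbol (h0 hN) 1).congr fun w hw => ?_)
  simp only [constInZ, Pi.sub_apply]
  rw [leftSymbol_expansion (h0 hb) N hw, expansion_eq hb N hw]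
  ring

end BBCalculus
end

theorem mainTheorem7 (d : ℕ) (m l k j : ℝ) (b : BBCalculus.FullPhase d → ℂ)
    (hb : b ∈ BBCalculus.FullSymbol d m l k j) :
    ∃ a ∈ BBCalculus.Symbol d m l k j,
      (∀ p : BBCalculus.Coord d, 0 < p 0 → ∀ φ : SchwartzMap (BBCalculus.Coord d) ℂ,
        BBCalculus.OscConverges b p φ ∧
        BBCalculus.OscConverges (BBCalculus.constInZ a) p φ ∧
        BBCalculus.oscKernel (BBCalculus.constInZ a) p φ = BBCalculus.oscKernel b p φ) ∧
      (∀ N : ℕ, a - BBCalculus.expansion b N ∈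
        BBCalculus.Symbol d (m - N) (l - N) (k + N) (j + N)) ∧
      BBCalculus.atZero b ∈ BBCalculus.Symbol d m l k j ∧
      BBCalculus.principalSymbol m l k j a =
        BBCalculus.principalSymbol m l k j (BBCalculus.atZero b) := by
  have h1 := BBCalculus.isAmp_of_mem_fullSymbol hb
  have h0 := h1.of_gain zero_le_one fun _ => zero_le_one
  have h2 := BBCalculus.isAmp_leftSymbol h0 0
  -- The expansion with N = 1 consists of the single term b|_{(X,Y)=0}.
  have h3 : (fun q => BBCalculus.leftSymbol b q + -1 * BBCalculus.atZero b q) ∈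
      BBCalculus.Symbol d (m - 1) (l - 1) (k + 1) (j + 1) := by
    have h := BBCalculus.isAmp_of_mem_symbol (BBCalculus.leftSymbol_sub_expansion_mem h1 1)
    rw [Nat.cast_one] at h
    refine BBCalculus.mem_symbol_of_isAmp (h.congr fun w hw => ?_)
    simp only [BBCalculus.constInZ, Pi.sub_apply, BBCalculus.expansion_eq h1 1 hw]
    simp
    ring
  refine ⟨BBCalculus.leftSymbol b,
    BBCalculus.mem_symbol_of_isAmp (BBCalculus.isAmp_leftSymbol h0 1), fun p hp φ =>
      ⟨BBCalculus.oscConverges h0 hp φ, BBCalculus.oscConverges h2 hp φ, ?_⟩,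
    BBCalculus.leftSymbol_sub_expansion_mem h1,
    BBCalculus.mem_symbol_of_isAmp (BBCalculus.isAmp_atZero h1), ?_⟩
  · rw [BBCalculus.oscKernel_eq, BBCalculus.oscKernel_eq, BBCalculus.pair_leftSymbol h0 φ hp]
  -- The two differences with c differ by `h3`, which lies in the lower-order class, so they belong
  -- to that class simultaneously.
  · refine Set.ext fun c => and_congr_right fun _ => ⟨fun h => ?_, fun h => ?_⟩
    · convert BBCalculus.symbol_add_const_mul h h3 1 using 1
      ext q
      simp only [Pi.sub_apply]
      ring
    · convert BBCalculus.symbol_add_const_mul h h3 (-1) using 1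
      ext q
      simp only [Pi.sub_apply]
      ring
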